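/- **Setting.** Let $n\ge 2$, let $\Omega\subset\mathbb R^n$ be a bounded domain with Lipschitz boundary, and let $p,q,\nu,\kappa_1,\kappa_2$ be real numbers with $$0<\nu<1<p<n,\qquad p<q<\kappa_i+1\ (i=1,2),\qquad \kappa_1+\kappa_2+2<p^*:=\frac{np}{n-p}.$$ Let $\eta,a_1,a_2\in L^\infty(\Omega)$ with $\eta\ge 0$ and $a_1,a_2>0$ a.e. in $\Omega$. Write $\rho_{\mathcal H}(y)=\int_\Omega(|y|^p+\eta|y|^q)\,dz$, let $L^{\mathcal H}(\Omega)$ be the space of measurable $y$ with $\rho_{\mathcal H}(y)<\infty$, with the Luxemburg norm $\|y\|_{\mathcal H}=\inf\{\tau>0:\rho_{\mathcal H}(y/\tau)\le 1\}$, let $W^{1,\mathcal H}(\Omega)$ be the space of $y\in L^{\mathcal H}(\Omega)$ with weak gradient satisfying $|\nabla y|\in L^{\mathcal H}(\Omega)$ ($|\cdot|$ is the Euclidean norm), normed by $\|\,|\nabla y|\,\|_{\mathcal H}+\|y\|_{\mathcal H}$, and let $W_0^{1,\mathcal H}(\Omega)$ be the closure of $C_0^\infty(\Omega)$ in $W^{1,\mathcal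 H}(\Omega)$. For $\lambda>0$ consider the system $$\begin{cases}-\Delta_p y_1-\operatorname{div}(\eta|\nabla y_1|^{q-2}\nabla y_1)=a_1|y_1|^{-1-\nu}y_1+\lambda(\kappa_1+1)|y_1|^{\kappa_1-1}y_1|y_2|^{\kappa_2+1}&\text{in }\Omega,\\-\Delta_p y_2-\operatorname{div}(\eta|\nabla y_2|^{q-2}\nabla y_2)=a_2|y_2|^{-1-\nu}y_2+\lambda(\kappa_2+1)|y_1|^{\kappa_1+1}|y_2|^{\kappa_2-1}y_2&\text{in }\Omega,\\y_1=y_2=0&\text{on }\partial\Omega.\end{cases}$$ A positive weak solution is a pair $(y_1,y_2)\in W_0^{1,\mathcal H}(\Omega)^2$ with $y_1,y_2>0$ a.e. in $\Omega$ such that, for all $h,w\in W_0^{1,\mathcal H}(\Omega)$, $a_1y_1^{-\nu}h$ and $a_2y_2^{-\nu}w$ are in $L^1(\Omega)$ and $$\begin{aligned}&\int_\Omega(|\nabla y_1|^{p-2}+\eta|\nabla y_1|^{q-2})\nabla y_1\cdot\nabla h\,dz+\int_\Omega(|\nabla y_2|^{p-2}+\eta|\nabla y_2|^{q-2})\nabla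 y_2\cdot\nabla w\,dz-\int_\Omega(a_1y_1^{-\nu}h+a_2y_2^{-\nu}w)\,dz\\&\quad-\lambda(\kappa_1+1)\int_\Omega|y_1|^{\kappa_1}|y_2|^{\kappa_2+1}h\,dz-\lambda(\kappa_2+1)\int_\Omega|y_1|^{\kappa_1+1}|y_2|^{\kappa_2}w\,dz=0.\end{aligned}$$ The energy is $$J(y_1,y_2)=\sum_{i=1}^2\int_\Omega\Big(\frac{|\nabla y_i|^p}{p}+\frac{\eta|\nabla y_i|^q}{q}-\frac{a_i|y_i|^{1-\nu}}{1-\nu}\Big)dz-\lambda\int_\Omega|y_1|^{\kappa_1+1}|y_2|^{\kappa_2+1}dz .$$ Let $$\begin{aligned}\mathcal N_\lambda=\Big\{(y_1,y_2)\in W_0^{1,\mathcal H}(\Omega)^2\setminus\{(0,0)\}:\ &\sum_{i=1}^2\int_\Omega\big(|\nabla y_i|^p+\eta|\nabla y_i|^q-a_i|y_i|^{1-\nu}\big)dz\\&=\lambda(\kappa_1+\kappa_2+2)\int_\Omega|y_1|^{\kappa_1+1}|y_2|^{\kappa_2+1}dz\Big\},\end{aligned}$$ that is, $\langle J'(y),y\rangle=0$.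 With $\psi_y(t)=J(ty)$ for $t>0$, let $\mathcal N_\lambda^{+}$ and $\mathcal N_\lambda^{-}$ be the sets of $y\in\mathcal N_\lambda$ with $\psi_y''(1)>0$ and $\psi_y''(1)<0$, respectively. **Theorem.** There is $\lambda^*>0$ such that for every $\lambda\in(0,\lambda^*)$ the system has at least two distinct positive weak solutions $y^*=(y_1^*,y_2^*)$ and $y_*=(y_{1*},y_{2*})$ in $W_0^{1,\mathcal H}(\Omega)\times W_0^{1,\mathcal H}(\Omega)$ such that $y^*\in\mathcal N_\lambda^+$ minimizes $J$ over $\mathcal N_\lambda^+$, $y_*\in\mathcal N_\lambda^-$ minimizes $J$ over $\mathcal N_\lambda^-$, and $$J(y^*)<0\le J(y_*).$$ -/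

import Mathlib

open MeasureTheory Set
open scoped ContDiff

namespace DoublePhase

noncomputable section

/-- Euclidean space of dimension `n`, with the Euclidean norm. -/
abbrev E (n : ℕ) : Type := EuclideanSpace ℝ (Fin n)

/-- The open set `Ω` has Lipschitz boundary: near each boundary point `x₀` there are a unit vector
`e` and a Lipschitz function `γ` on the hyperplane orthogonal to `e` such that, in a ball around
`x₀`, the set `Ω` is the strict epigraph of `γ` in the direction `e`. -/
def HasLipschitzBoundary {n : ℕ} (Ω : Set (E n)) : Prop :=
  ∀ x₀ ∈ frontier Ω, ∃ e : E n, ‖e‖ = 1 ∧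
    ∃ (K : NNReal) (γ : ((Submodule.span ℝ {e})ᗮ : Submodule ℝ (E n)) → ℝ),
      LipschitzWith K γ ∧ ∃ r : ℝ, 0 < r ∧ ∀ x ∈ Metric.ball x₀ r,
        (x ∈ Ω ↔ γ ((Submodule.span ℝ {e})ᗮ.orthogonalProjectionOnto x) < inner ℝ e x)

/-- A bounded domain (nonempty, open, connected) with Lipschitz boundary. -/
structure IsBoundedLipschitzDomain {n : ℕ} (Ω : Set (E n)) : Prop where
  isOpen : IsOpen Ω
  isConnected : IsConnected Ω
  isBounded : Bornology.IsBounded Ω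
  lipschitz : HasLipschitzBoundary Ω

/-- The critical Sobolev exponent `p^* = n p / (n - p)`, used for `p < n`. -/
def criticalExponent (n : ℕ) (p : ℝ) : ℝ := n * p / (n - p)

/-- `φ ∈ C_0^∞(Ω)`: smooth with compact support contained in `Ω`. -/
structure IsTestFunction {n : ℕ} (Ω : Set (E n)) (φ : E n → ℝ) : Prop where
  smooth : ContDiff ℝ ∞ φ
  compact : HasCompactSupport φ
  support_subset : tsupport φ ⊆ Ω

/-- `g` is a weak gradient of `u` in `Ω`: both are locally integrable in `Ω` and
`∫_Ω u ∇φ = - ∫_Ω φ g` for all `φ ∈ C_0^∞(Ω)`. -/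
structure HasWeakGradient {n : ℕ} (Ω : Set (E n)) (u : E n → ℝ) (g : E n → E n) : Prop where
  locInt : LocallyIntegrableOn u Ω
  locInt_grad : LocallyIntegrableOn g Ω
  integral_eq : ∀ φ : E n → ℝ, IsTestFunction Ω φ →
    ∫ z in Ω, u z • gradient φ z = -∫ z in Ω, φ z • g z

open Classical in
/-- The weak gradient `∇u` of `u` in `Ω` (unique up to null sets); `0` if there is none. -/
def weakGrad {n : ℕ} (Ω : Set (E n)) (u : E n → ℝ) : E n → E n :=
  if h : ∃ g, HasWeakGradient Ω u g then h.choose else 0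

section Spaces

variable {n : ℕ} (Ω : Set (E n)) (p q : ℝ) (η : E n → ℝ)

/-- The modular `ρ_H(y) = ∫_Ω (|y|^p + η |y|^q) dz`, with values in `[0, ∞]`. -/
def modular (y : E n → ℝ) : ENNReal :=
  ∫⁻ z in Ω, ENNReal.ofReal (|y z| ^ p + η z * |y z| ^ q)

/-- `y ∈ L^H(Ω)`. -/
def MemLH (y : E n → ℝ) : Prop :=
  AEStronglyMeasurable y (volume.restrict Ω) ∧ modular Ω p q η y < ⊤

/-- The Luxemburg norm `‖y‖_H = inf {τ > 0 : ρ_H(y / τ) ≤ 1}`. -/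
def luxemburgNorm (y : E n → ℝ) : ℝ :=
  sInf {τ : ℝ | 0 < τ ∧ modular Ω p q η (fun z => y z / τ) ≤ 1}

/-- `y ∈ W^{1,H}(Ω)`: `y ∈ L^H(Ω)` has a weak gradient with `|∇y| ∈ L^H(Ω)`. -/
def MemW1H (y : E n → ℝ) : Prop :=
  MemLH Ω p q η y ∧ (∃ g, HasWeakGradient Ω y g) ∧ MemLH Ω p q η (fun z => ‖weakGrad Ω y z‖)

/-- The norm `‖y‖_{1,H} = ‖∇y‖_H + ‖y‖_H` of `W^{1,H}(Ω)`. -/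
def normW1H (y : E n → ℝ) : ℝ :=
  luxemburgNorm Ω p q η (fun z => ‖weakGrad Ω y z‖) + luxemburgNorm Ω p q η y

/-- `y ∈ W_0^{1,H}(Ω)`, the closure of `C_0^∞(Ω)` in `W^{1,H}(Ω)`. -/
def MemW01H (y : E n → ℝ) : Prop :=
  MemW1H Ω p q η y ∧
    ∀ ε : ℝ, 0 < ε → ∃ φ : E n → ℝ, IsTestFunction Ω φ ∧ normW1H Ω p q η (y - φ) < ε

end Spaces

section System

variable {n : ℕ} (Ω : Set (E n)) (p q ν κ₁ κ₂ : ℝ) (η a₁ a₂ : E n → ℝ) (lam : ℝ)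

/-- The energy functional
`J(y₁,y₂) = (1/p) (‖∇y₁‖_p^p + ‖∇y₂‖_p^p) + (1/q) ∫ η (|∇y₁|^q + |∇y₂|^q)
  - (1/(1-ν)) ∫ (a₁ |y₁|^{1-ν} + a₂ |y₂|^{1-ν}) - λ ∫ |y₁|^{κ₁+1} |y₂|^{κ₂+1}`. -/
def energy (y : (E n → ℝ) × (E n → ℝ)) : ℝ :=
  1 / p * ((∫ z in Ω, ‖weakGrad Ω y.1 z‖ ^ p) + ∫ z in Ω, ‖weakGrad Ω y.2 z‖ ^ p)
  + 1 / q * ((∫ z in Ω, η z * ‖weakGrad Ω y.1 z‖ ^ q) + ∫ z in Ω, η z * ‖weakGrad Ω y.2 z‖ ^ q)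
  - 1 / (1 - ν) * (∫ z in Ω, (a₁ z * |y.1 z| ^ (1 - ν) + a₂ z * |y.2 z| ^ (1 - ν)))
  - lam * ∫ z in Ω, |y.1 z| ^ (κ₁ + 1) * |y.2 z| ^ (κ₂ + 1)

/-- The derivative `⟨J'(y), h⟩` of the energy at `y = (y₁, y₂)` in the direction
`h = (h₁, h₂)`. -/
def energyDeriv (y h : (E n → ℝ) × (E n → ℝ)) : ℝ :=
  (∫ z in Ω, ‖weakGrad Ω y.1 z‖ ^ (p - 2) * inner ℝ (weakGrad Ω y.1 z) (weakGrad Ω h.1 z))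
  + (∫ z in Ω, η z * ‖weakGrad Ω y.1 z‖ ^ (q - 2)
      * inner ℝ (weakGrad Ω y.1 z) (weakGrad Ω h.1 z))
  - (∫ z in Ω, a₁ z * |y.1 z| ^ (-1 - ν) * y.1 z * h.1 z)
  - lam * (κ₁ + 1) * (∫ z in Ω, |y.1 z| ^ (κ₁ - 1) * y.1 z * |y.2 z| ^ (κ₂ + 1) * h.1 z)
  + (∫ z in Ω, ‖weakGrad Ω y.2 z‖ ^ (p - 2) * inner ℝ (weakGrad Ω y.2 z) (weakGrad Ω h.2 z))
  + (∫ z in Ω, η z * ‖weakGrad Ω y.2 z‖ ^ (q - 2)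
      * inner ℝ (weakGrad Ω y.2 z) (weakGrad Ω h.2 z))
  - (∫ z in Ω, a₂ z * |y.2 z| ^ (-1 - ν) * y.2 z * h.2 z)
  - lam * (κ₂ + 1) * (∫ z in Ω, |y.1 z| ^ (κ₁ + 1) * |y.2 z| ^ (κ₂ - 1) * y.2 z * h.2 z)

/-- The Nehari manifold `N_λ`: nonzero `y ∈ W_0^{1,H}(Ω) × W_0^{1,H}(Ω)` with
`⟨J'(y), y⟩ = 0`. -/
def nehari : Set ((E n → ℝ) × (E n → ℝ)) :=
  {y | MemW01H Ω p q η y.1 ∧ MemW01H Ω p q η y.2 ∧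
    ¬ (y.1 =ᵐ[volume.restrict Ω] 0 ∧ y.2 =ᵐ[volume.restrict Ω] 0) ∧
    energyDeriv Ω p q ν κ₁ κ₂ η a₁ a₂ lam y y = 0}

/-- The fibering map `ψ_y(t) = J(t y)`. -/
def fibering (y : (E n → ℝ) × (E n → ℝ)) (t : ℝ) : ℝ :=
  energy Ω p q ν κ₁ κ₂ η a₁ a₂ lam (t • y)

/-- `N_λ^+ = {y ∈ N_λ : ψ_y''(1) > 0}`. -/
def nehariPlus : Set ((E n → ℝ) × (E n → ℝ)) :=
  {y | y ∈ nehari Ω p q ν κ₁ κ₂ η a₁ a₂ lam ∧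
    0 < iteratedDeriv 2 (fibering Ω p q ν κ₁ κ₂ η a₁ a₂ lam y) 1}

/-- `N_λ^- = {y ∈ N_λ : ψ_y''(1) < 0}`. -/
def nehariMinus : Set ((E n → ℝ) × (E n → ℝ)) :=
  {y | y ∈ nehari Ω p q ν κ₁ κ₂ η a₁ a₂ lam ∧
    iteratedDeriv 2 (fibering Ω p q ν κ₁ κ₂ η a₁ a₂ lam y) 1 < 0}

/-- `y = (y₁, y₂) ∈ W_0^{1,H}(Ω) × W_0^{1,H}(Ω)` is a positive weak solution of the system
`-Δ_p y₁ - div(η |∇y₁|^{q-2} ∇y₁) = a₁ y₁^{-ν} + λ (κ₁+1) |y₁|^{κ₁-1} y₁ |y₂|^{κ₂+1}`,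
`-Δ_p y₂ - div(η |∇y₂|^{q-2} ∇y₂) = a₂ y₂^{-ν} + λ (κ₂+1) |y₁|^{κ₁+1} |y₂|^{κ₂-1} y₂` in `Ω`,
`y₁ = y₂ = 0` on the boundary. -/
structure IsPositiveWeakSolution (y : (E n → ℝ) × (E n → ℝ)) : Prop where
  mem₁ : MemW01H Ω p q η y.1
  mem₂ : MemW01H Ω p q η y.2
  pos₁ : ∀ᵐ z ∂volume.restrict Ω, 0 < y.1 z
  pos₂ : ∀ᵐ z ∂volume.restrict Ω, 0 < y.2 z
  integrable₁ : ∀ h : E n → ℝ, MemW01H Ω p q η h →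
    IntegrableOn (fun z => a₁ z * y.1 z ^ (-ν) * h z) Ω
  integrable₂ : ∀ w : E n → ℝ, MemW01H Ω p q η w →
    IntegrableOn (fun z => a₂ z * y.2 z ^ (-ν) * w z) Ω
  weak_eq : ∀ h w : E n → ℝ, MemW01H Ω p q η h → MemW01H Ω p q η w →
    (∫ z in Ω, ‖weakGrad Ω y.1 z‖ ^ (p - 2) * inner ℝ (weakGrad Ω y.1 z) (weakGrad Ω h z))
    + (∫ z in Ω, η z * ‖weakGrad Ω y.1 z‖ ^ (q - 2)
        * inner ℝ (weakGrad Ω y.1 z) (weakGrad Ω h z))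
    - (∫ z in Ω, a₁ z * y.1 z ^ (-ν) * h z)
    + (∫ z in Ω, ‖weakGrad Ω y.2 z‖ ^ (p - 2) * inner ℝ (weakGrad Ω y.2 z) (weakGrad Ω w z))
    + (∫ z in Ω, η z * ‖weakGrad Ω y.2 z‖ ^ (q - 2)
        * inner ℝ (weakGrad Ω y.2 z) (weakGrad Ω w z))
    - (∫ z in Ω, a₂ z * y.2 z ^ (-ν) * w z)
    - lam * (κ₁ + 1) * (∫ z in Ω, |y.1 z| ^ κ₁ * |y.2 z| ^ (κ₂ + 1) * h z)
    - lam * (κ₂ + 1) * (∫ z in Ω, |y.1 z| ^ (κ₁ + 1) * |y.2 z| ^ κ₂ * w z) = 0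

end System

end

end DoublePhase

open DoublePhase

/-!
# Two positive solutions of a singular double phase system

Write `A y = ∑ ∫ |∇y_i|^p`, `B y = ∑ ∫ η |∇y_i|^q`, `S y = ∑ ∫ a_i |y_i|^α` with `α = 1 - ν`, and
`K y = ∫ |y_1|^(κ₁+1) |y_2|^(κ₂+1)`, of degree `r = κ₁ + κ₂ + 2`. The energy is
`J = A / p + B / q - S / α - lam K` with `0 < α < 1 < p < q < r`.

**Fibering.** On a ray, `d/dt J (t y) = t^(α-1) (P t - S y)` with
`P t = A t^(p-α) + B t^(q-α) - r lam K t^(r-α)`. In the variable `x = t^(q-α)` the function `P` is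
concave, so `P = S y` has at most one solution where `P` increases and at most one where it
decreases. By the Sobolev inequality there are `R` and `lam^*` such that for `lam < lam^*` the energy
is positive and increasing along rays at every point of the sphere `A = R^p`
(`FiberedSystem.exists_isBarrier`). Nehari points inside this sphere have `J < 0` and a positive
second derivative along the ray, Nehari points outside have `J > 0` and a negative one, and they are
the maxima of `J` on their rays (`IsBarrier.plus`, `IsBarrier.minus`). So the sphere separates `N^+`
from `N^-`, and no Nehari point is degenerate.

**Minimizers.** The first solution minimizes `J` over the ball `A ≤ R^p`, the second over the Nehari
points outside of it. No weak convergence is used: by Rellich–Kondrachov (test functions bounded in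
`W^{1,1}` are compact in `L^1`, by averaging over small balls and Arzelà–Ascoli, and `L^r` is
reached by interpolation with the critical Sobolev exponent) `S` and `K` converge at all midpoints
of a subsequence of a minimizing sequence. Midpoints are competitors, for the second problem after
multiplication by a factor that leads to the Nehari manifold and under which the energies of the two
endpoints do not rise. Hence the convexity defects of `A` and `B` tend to zero, which makes the
gradients Cauchy (`tendsto_eLpNorm_sub_of_defect`). Passing from `y` to `|y|` does not raise the
energy, so that both minimizers may be taken nonnegative.

**Euler–Lagrange equation.** `J` is not differentiable where a component vanishes. Both minimizers
satisfy `J (t y) ≤ J (t (y + s h))` for all small `s` with some `t` close to `1`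
(`FiberedSystem.IsLineMinimal`). For `h ≥ 0` and `s > 0` this bounds the difference quotients of `S`
from above; by Fatou's lemma `y_i > 0` where `h > 0`, and `a_i y_i^(-ν) h` is integrable
(`pos_and_integrable_of_quotient_bound`). Then every term is differentiable in every direction, and
both signs of `s` give the equation (`sum_deriv_eq_zero`).

Throughout, `W_0^{1,H}(Ω)` is handled through sequences of test functions that converge in `L^p`
with gradients converging in `L^p` and in `L^q(η dz)` (`IsW0`). This is equivalent to the definition
by the Luxemburg norm (`MemW01H.isW0`, `IsW0.memW01H`); the term `∫ η |u|^q` is controlled by the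
Sobolev inequality because `q < p^*`.
-/

open Filter Topology

namespace DoublePhase

/-! ### Fibering functions -/

section Fibering

/-- The fibering function `t ↦ A t^p / p + B t^q / q - S t^α / α - L t^r`. -/
noncomputable def fib (p q α r A B S L t : ℝ) : ℝ :=
  A * t ^ p / p + B * t ^ q / q - S * t ^ α / α - L * t ^ r

/-- The function `P` for which the derivative of the fibering function is `t^(α-1) (P t - S)`. -/
noncomputable def fibSlope (p q α r A B L t : ℝ) : ℝ :=
  A * t ^ (p - α) + B * t ^ (q - α) - r * L * t ^ (r - α)

variable {p q α r A B S L : ℝ}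

theorem hasDerivAt_fib (hp : 0 < p) (hq : 0 < q) (hα : 0 < α) {t : ℝ} (ht : 0 < t) :
    HasDerivAt (fib p q α r A B S L) (t ^ (α - 1) * (fibSlope p q α r A B L t - S)) t := by
  have h : ∀ s : ℝ, HasDerivAt (fun x : ℝ => x ^ s) (s * t ^ (s - 1)) t := fun s =>
    Real.hasDerivAt_rpow_const (Or.inl ht.ne')
  have e : ∀ s : ℝ, t ^ (s - 1) = t ^ (α - 1) * t ^ (s - α) := fun s => by
    rw [← Real.rpow_add ht]; congr 1; ring
  have H := ((((h p).const_mul A).div_const p).add (((h q).const_mul B).div_const q)).sub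
    (((h α).const_mul S).div_const α) |>.sub ((h r).const_mul L)
  refine H.congr_deriv ?_
  rw [e p, e q, e r, fibSlope]
  field_simp
  ring

theorem continuous_fib (hp : 0 < p) (hq : 0 < q) (hα : 0 < α) (hr : 0 < r) :
    Continuous (fib p q α r A B S L) := by
  have h : ∀ s : ℝ, 0 < s → Continuous (fun x : ℝ => x ^ s) := fun s hs =>
    Real.continuous_rpow_const hs.le
  unfold fib
  exact ((((continuous_const.mul (h p hp)).div_const p).add
    ((continuous_const.mul (h q hq)).div_const q)).sub
    ((continuous_const.mul (h α hα)).div_const α)).sub (continuous_const.mul (h r hr))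

theorem continuous_fibSlope (hp : α < p) (hq : α < q) (hr : α < r) :
    Continuous (fibSlope p q α r A B L) := by
  have h : ∀ s : ℝ, α < s → Continuous (fun x : ℝ => x ^ (s - α)) := fun s hs =>
    Real.continuous_rpow_const (by linarith)
  unfold fibSlope
  exact ((continuous_const.mul (h p hp)).add (continuous_const.mul (h q hq))).sub
    (continuous_const.mul (h r hr))

/-- In the variable `x = t^(q-α)` the function `fibSlope` is concave. -/
theorem concaveOn_fibSlope_comp (hα : α < p) (hpq : p < q) (hqr : q < r) (hr : 0 < r)
    (hA : 0 ≤ A) (hL : 0 ≤ L) :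
    ConcaveOn ℝ (Ici 0) (fun x : ℝ =>
      A * x ^ ((p - α) / (q - α)) + B * x - r * L * x ^ ((r - α) / (q - α))) := by
  have h1 : ConcaveOn ℝ (Ici 0) (fun x : ℝ => x ^ ((p - α) / (q - α))) :=
    Real.concaveOn_rpow (div_nonneg (by linarith) (by linarith))
      ((div_le_one (by linarith)).2 (by linarith))
  have h2 : ConvexOn ℝ (Ici 0) (fun x : ℝ => x ^ ((r - α) / (q - α))) :=
    convexOn_rpow ((one_le_div (by linarith)).2 (by linarith))
  have h3 : ConcaveOn ℝ (Ici (0 : ℝ)) (fun x : ℝ => B * x) :=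
    ⟨convex_Ici 0, fun x _ y _ a b _ _ _ => by simp only [smul_eq_mul]; linarith⟩
  have := ((h1.smul hA).add h3).sub (h2.smul (mul_nonneg hr.le hL))
  exact this

theorem fibSlope_eq_comp (hq : α < q) {t : ℝ} (ht : 0 ≤ t) :
    fibSlope p q α r A B L t = A * (t ^ (q - α)) ^ ((p - α) / (q - α)) + B * t ^ (q - α)
      - r * L * (t ^ (q - α)) ^ ((r - α) / (q - α)) := by
  have : q - α ≠ 0 := by linarith
  rw [← Real.rpow_mul ht, ← Real.rpow_mul ht, mul_div_cancel₀ _ this, mul_div_cancel₀ _ this,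
    fibSlope]

/-- Concavity of `fibSlope` in the variable `t^(q-α)`, at three given points. -/
theorem fibSlope_weighted (hα : α < p) (hpq : p < q) (hqr : q < r) (hr : 0 < r)
    (hA : 0 ≤ A) (hL : 0 ≤ L) {a b c : ℝ} (ha : 0 ≤ a) (hab : a < b) (hbc : b < c) :
    ∃ w : ℝ, 0 < w ∧ w < 1 ∧ (1 - w) * fibSlope p q α r A B L a + w * fibSlope p q α r A B L c
      ≤ fibSlope p q α r A B L b := by
  have hq : 0 < q - α := by linarith
  have h1 : a ^ (q - α) < b ^ (q - α) := Real.rpow_lt_rpow ha hab hq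
  have h2 : b ^ (q - α) < c ^ (q - α) := Real.rpow_lt_rpow (ha.trans hab.le) hbc hq
  have h0 : 0 ≤ a ^ (q - α) := Real.rpow_nonneg ha _
  have hco := concaveOn_fibSlope_comp (B := B) hα hpq hqr hr hA hL
  rw [fibSlope_eq_comp (by linarith) ha, fibSlope_eq_comp (by linarith) (ha.trans hab.le),
    fibSlope_eq_comp (by linarith) (ha.trans (hab.trans hbc).le)]
  generalize a ^ (q - α) = x at *
  generalize b ^ (q - α) = y at *
  generalize c ^ (q - α) = z at *
  have hd : 0 < z - x := by linarith
  refine ⟨(y - x) / (z - x), div_pos (by linarith) hd, (div_lt_one hd).2 (by linarith), ?_⟩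
  have hw : 1 - (y - x) / (z - x) = (z - y) / (z - x) := by field_simp; ring
  have := hco.2 h0 (show z ∈ Ici (0 : ℝ) by rw [mem_Ici]; linarith)
    (show 0 ≤ 1 - (y - x) / (z - x) by rw [hw]; exact div_nonneg (by linarith) hd.le)
    (show 0 ≤ (y - x) / (z - x) from div_nonneg (by linarith) hd.le) (by ring)
  have e : (1 - (y - x) / (z - x)) • x + ((y - x) / (z - x)) • z = y := by
    simp only [smul_eq_mul]; field_simp; ring
  rw [e] at this
  simpa [smul_eq_mul] using this

/-- The superlevel sets of `fibSlope` are intervals; the two lemmas after this one are the versions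
with a strict inequality at one end. -/
theorem fibSlope_quasi (hα : α < p) (hpq : p < q) (hqr : q < r) (hr : 0 < r)
    (hA : 0 ≤ A) (hL : 0 ≤ L) {a b c : ℝ} (ha : 0 ≤ a) (hab : a < b) (hbc : b < c)
    (h1 : S ≤ fibSlope p q α r A B L a) (h2 : S ≤ fibSlope p q α r A B L c) :
    S ≤ fibSlope p q α r A B L b := by
  obtain ⟨w, h0, hw, h⟩ := fibSlope_weighted (B := B) hα hpq hqr hr hA hL ha hab hbc
  nlinarith

theorem fibSlope_quasi_right (hα : α < p) (hpq : p < q) (hqr : q < r) (hr : 0 < r)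
    (hA : 0 ≤ A) (hL : 0 ≤ L) {a b c : ℝ} (ha : 0 ≤ a) (hab : a < b) (hbc : b < c)
    (h1 : S ≤ fibSlope p q α r A B L a) (h2 : S < fibSlope p q α r A B L c) :
    S < fibSlope p q α r A B L b := by
  obtain ⟨w, h0, hw, h⟩ := fibSlope_weighted (B := B) hα hpq hqr hr hA hL ha hab hbc
  nlinarith

theorem fibSlope_quasi_left (hα : α < p) (hpq : p < q) (hqr : q < r) (hr : 0 < r)
    (hA : 0 ≤ A) (hL : 0 ≤ L) {a b c : ℝ} (ha : 0 ≤ a) (hab : a < b) (hbc : b < c)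
    (h1 : S < fibSlope p q α r A B L a) (h2 : S ≤ fibSlope p q α r A B L c) :
    S < fibSlope p q α r A B L b := by
  obtain ⟨w, h0, hw, h⟩ := fibSlope_weighted (B := B) hα hpq hqr hr hA hL ha hab hbc
  nlinarith

theorem fibSlope_one : fibSlope p q α r A B L 1 = A + B - r * L := by
  simp [fibSlope]

/-- The tangent line at `t = 1` lies above the concave reparametrization of `fibSlope`. -/
theorem fibSlope_sub_le (hα : α < p) (hpq : p < q) (hqr : q < r) (hr : 0 < r)
    (hA : 0 ≤ A) (hL : 0 ≤ L) {c : ℝ} (hc : 0 < c) :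
    (fibSlope p q α r A B L c - fibSlope p q α r A B L 1) * (q - α) ≤
      ((p - α) * A + (q - α) * B - r * (r - α) * L) * (c ^ (q - α) - 1) := by
  have hq : 0 < q - α := by linarith
  have hx : 0 < c ^ (q - α) := Real.rpow_pos_of_pos hc _
  have b1 := rpow_one_add_le_one_add_mul_self (s := c ^ (q - α) - 1) (by linarith)
    (p := (p - α) / (q - α)) (div_nonneg (by linarith) (by linarith))
      ((div_le_one (by linarith)).2 (by linarith))
  have b2 := one_add_mul_self_le_rpow_one_add (s := c ^ (q - α) - 1) (by linarith)
    (p := (r - α) / (q - α)) ((one_le_div (by linarith)).2 (by linarith))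
  rw [fibSlope_eq_comp (by linarith) hc.le, fibSlope_one]
  rw [add_sub_cancel] at b1 b2
  generalize c ^ (q - α) = x at *
  have c1 := mul_le_mul_of_nonneg_left b1 hA
  have c2 := mul_le_mul_of_nonneg_left b2 (mul_nonneg hr.le hL)
  have : (A * (1 + (p - α) / (q - α) * (x - 1)) + B * x
      - r * L * (1 + (r - α) / (q - α) * (x - 1)) - (A + B - r * L)) * (q - α) =
      ((p - α) * A + (q - α) * B - r * (r - α) * L) * (x - 1) := by
    field_simp
    ring
  rw [← this]
  exact mul_le_mul_of_nonneg_right (by linarith) hq.le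

/-- A critical point at `t = 1` left of a point where the fibering function increases is a
nondegenerate local minimum, and the fibering function is negative there. -/
theorem fib_plus (hα0 : 0 < α) (hα : α < p) (hpq : p < q) (hqr : q < r)
    (hA : 0 ≤ A) (hL : 0 ≤ L) (hN : A + B - r * L = S) {c : ℝ} (hc : 1 < c)
    (hSc : S < fibSlope p q α r A B L c) :
    0 < (p - α) * A + (q - α) * B - r * (r - α) * L ∧ fib p q α r A B S L 1 < 0 := by
  have hr : 0 < r := by linarith
  constructor
  · have h := fibSlope_sub_le (B := B) hα hpq hqr hr hA hL (c := c) (by linarith)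
    rw [fibSlope_one, hN] at h
    have h1 : 0 < c ^ (q - α) - 1 := by
      have := Real.one_lt_rpow hc (z := q - α) (by linarith)
      linarith
    have h2 : 0 < (fibSlope p q α r A B L c - S) * (q - α) :=
      mul_pos (by linarith) (by linarith)
    exact pos_of_mul_pos_left (h2.trans_le h) h1.le
  · have hlt : ∀ t, 0 < t → t < 1 → fibSlope p q α r A B L t < S := by
      intro t h0 h1
      by_contra! hh
      have := fibSlope_quasi_right (B := B) hα hpq hqr hr hA hL h0.le h1 hc hh hSc
      rw [fibSlope_one, hN] at this
      exact lt_irrefl _ this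
    have hanti : StrictAntiOn (fib p q α r A B S L) (Icc 0 1) := by
      refine strictAntiOn_of_deriv_neg (convex_Icc 0 1)
        (continuous_fib (by linarith) (by linarith) hα0 hr).continuousOn ?_
      intro t ht
      rw [interior_Icc] at ht
      rw [(hasDerivAt_fib (by linarith) (by linarith) hα0 ht.1).deriv]
      exact mul_neg_of_pos_of_neg (Real.rpow_pos_of_pos ht.1 _) (by linarith [hlt t ht.1 ht.2])
    have h01 := hanti (left_mem_Icc.2 zero_le_one) (right_mem_Icc.2 zero_le_one) zero_lt_one
    have h0 : fib p q α r A B S L 0 = 0 := by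
      have e : ∀ s : ℝ, 0 < s → (0 : ℝ) ^ s = 0 := fun s hs => Real.zero_rpow hs.ne'
      simp [fib, e p (by linarith), e q (by linarith), e α hα0, e r hr]
    rwa [h0] at h01

/-- A critical point at `t = 1` right of a point where the fibering function increases and is
positive is a nondegenerate global maximum. -/
theorem fib_minus (hα0 : 0 < α) (hα : α < p) (hpq : p < q) (hqr : q < r)
    (hA : 0 ≤ A) (hL : 0 ≤ L) (hN : A + B - r * L = S) {c : ℝ} (hc0 : 0 < c) (hc : c < 1)
    (hSc : S < fibSlope p q α r A B L c) (hpos : 0 < fib p q α r A B S L c) :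
    (p - α) * A + (q - α) * B - r * (r - α) * L < 0 ∧
      (∀ t, 1 < t → fibSlope p q α r A B L t < S) ∧
      (∀ t, c ≤ t → t < 1 → S < fibSlope p q α r A B L t) ∧
      ∀ t, 0 ≤ t → fib p q α r A B S L t ≤ fib p q α r A B S L 1 := by
  have hr : 0 < r := by linarith
  have hright : ∀ t, 1 < t → fibSlope p q α r A B L t < S := by
    intro t h1
    by_contra! hh
    have := fibSlope_quasi_left (B := B) hα hpq hqr hr hA hL hc0.le hc h1 hSc hh
    rw [fibSlope_one, hN] at this
    exact lt_irrefl _ this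
  have hmid : ∀ t, c ≤ t → t < 1 → S < fibSlope p q α r A B L t := by
    intro t h1 h2
    rcases h1.eq_or_lt with rfl | h1
    · exact hSc
    · exact fibSlope_quasi_left (B := B) hα hpq hqr hr hA hL hc0.le h1 h2 hSc
        (by rw [fibSlope_one, hN])
  have hcont := continuous_fib (A := A) (B := B) (S := S) (L := L) (p := p) (q := q)
    (by linarith) (by linarith) hα0 hr
  have hanti : ∀ a b, 0 ≤ a → a ≤ b → (∀ t, a < t → t < b → fibSlope p q α r A B L t ≤ S) →
      fib p q α r A B S L b ≤ fib p q α r A B S L a := by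
    intro a b ha hab h
    refine antitoneOn_of_deriv_nonpos (convex_Icc a b) hcont.continuousOn ?_ ?_
      (left_mem_Icc.2 hab) (right_mem_Icc.2 hab) hab
    · intro t ht
      rw [interior_Icc] at ht
      exact (hasDerivAt_fib (by linarith) (by linarith) hα0
        (ha.trans_lt ht.1)).differentiableAt.differentiableWithinAt
    · intro t ht
      rw [interior_Icc] at ht
      rw [(hasDerivAt_fib (by linarith) (by linarith) hα0 (ha.trans_lt ht.1)).deriv]
      exact mul_nonpos_of_nonneg_of_nonpos (Real.rpow_nonneg (ha.trans ht.1.le) _)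
        (by linarith [h t ht.1 ht.2])
  have hmono : ∀ a b, 0 ≤ a → a ≤ b → (∀ t, a < t → t < b → S ≤ fibSlope p q α r A B L t) →
      fib p q α r A B S L a ≤ fib p q α r A B S L b := by
    intro a b ha hab h
    refine monotoneOn_of_deriv_nonneg (convex_Icc a b) hcont.continuousOn ?_ ?_
      (left_mem_Icc.2 hab) (right_mem_Icc.2 hab) hab
    · intro t ht
      rw [interior_Icc] at ht
      exact (hasDerivAt_fib (by linarith) (by linarith) hα0
        (ha.trans_lt ht.1)).differentiableAt.differentiableWithinAt
    · intro t ht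
      rw [interior_Icc] at ht
      rw [(hasDerivAt_fib (by linarith) (by linarith) hα0 (ha.trans_lt ht.1)).deriv]
      exact mul_nonneg (Real.rpow_nonneg (ha.trans ht.1.le) _)
        (by linarith [h t ht.1 ht.2])
  have hc1 : fib p q α r A B S L c ≤ fib p q α r A B S L 1 :=
    hmono c 1 hc0.le hc.le fun t h1 h2 => (hmid t h1.le h2).le
  refine ⟨?_, hright, hmid, ?_⟩
  · have h := fibSlope_sub_le (B := B) hα hpq hqr hr hA hL (c := c) (by linarith)
    rw [fibSlope_one, hN] at h
    have h1 : c ^ (q - α) - 1 < 0 := by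
      have := Real.rpow_lt_one hc0.le hc (z := q - α) (by linarith)
      linarith
    have h2 : 0 < (fibSlope p q α r A B L c - S) * (q - α) :=
      mul_pos (by linarith) (by linarith)
    nlinarith
  · intro t ht
    rcases le_or_gt 1 t with h1 | h1
    · exact hanti 1 t zero_le_one h1 fun s hs _ => (hright s hs).le
    rcases le_or_gt c t with h2 | h2
    · exact hmono t 1 ht h1.le fun s hs hs1 => (hmid s (h2.trans hs.le) hs1).le
    refine le_trans ?_ hc1
    rcases le_or_gt S (fibSlope p q α r A B L t) with h3 | h3
    · refine hmono t c ht h2.le fun s hs hsc => ?_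
      exact fibSlope_quasi (B := B) hα hpq hqr hr hA hL ht hs hsc h3 hSc.le
    · have h0 : fib p q α r A B S L 0 = 0 := by
        have e : ∀ s : ℝ, 0 < s → (0 : ℝ) ^ s = 0 := fun s hs => Real.zero_rpow hs.ne'
        simp [fib, e p (by linarith), e q (by linarith), e α hα0, e r hr]
      have := hanti 0 t le_rfl ht fun s hs hst => by
        by_contra! hh
        have := fibSlope_quasi (B := B) hα hpq hqr hr hA hL hs.le hst h2 hh.le hSc.le
        linarith
      linarith

/-- Right of a point where the fibering function increases there is a critical point, at most
`T` as soon as `T` satisfies an explicit bound. -/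
theorem exists_fibSlope_eq (hα : α < p) (hpq : p < q) (hqr : q < r)
    (hA : 0 ≤ A) (hS : 0 ≤ S) {c T : ℝ} (hc : 0 < c)
    (hSc : S < fibSlope p q α r A B L c) (hcT : c ≤ T) (hT1 : 1 ≤ T)
    (hT : A + B ≤ r * L * T ^ (r - q)) :
    ∃ t, c < t ∧ t ≤ T ∧ fibSlope p q α r A B L t = S := by
  have hT0 : 0 < T := by linarith
  have h : fibSlope p q α r A B L T ≤ S := by
    have e : T ^ (r - α) = T ^ (q - α) * T ^ (r - q) := by
      rw [← Real.rpow_add hT0]; congr 1; ring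
    have h1 : T ^ (p - α) ≤ T ^ (q - α) := Real.rpow_le_rpow_of_exponent_le hT1 (by linarith)
    have h2 : 0 < T ^ (q - α) := Real.rpow_pos_of_pos hT0 _
    rw [fibSlope, e]
    have h3 := mul_le_mul_of_nonneg_left h1 hA
    have h4 := mul_le_mul_of_nonneg_left hT h2.le
    nlinarith
  have hcont := (continuous_fibSlope (A := A) (B := B) (L := L) (α := α) (p := p) (q := q)
    (r := r) hα (by linarith) (by linarith)).continuousOn (s := Icc c T)
  obtain ⟨t, ht, htS⟩ := intermediate_value_Icc' hcT hcont ⟨h, hSc.le⟩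
  refine ⟨t, lt_of_le_of_ne ht.1 ?_, ht.2, htS⟩
  rintro rfl
  exact hSc.ne' htS

end Fibering

/-! ### Fibered systems and the barrier sphere -/

/-- The midpoint of two vectors. -/
noncomputable def mid {V : Type*} [AddCommGroup V] [Module ℝ V] (y z : V) : V :=
  (1 / 2 : ℝ) • (y + z)

/-- The structure of the energy that the Nehari method uses: four homogeneous functionals on a
vector space, of which the first two are midpoint convex and the last two are compact. The
compactness is phrased through midpoints, so that a minimizing sequence converges strongly as
soon as its convexity defects tend to zero; no topology on the space and no weak convergence is
needed. Homogeneity is asserted for positive factors, and continuity along lines only. -/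
structure FiberedSystem (V : Type*) [AddCommGroup V] [Module ℝ V] where
  /-- the term of degree `p` -/
  A : V → ℝ
  /-- the term of degree `q` -/
  B : V → ℝ
  /-- the sublinear term, of degree `α` -/
  S : V → ℝ
  /-- the superlinear term, of degree `r` -/
  K : V → ℝ
  p : ℝ
  q : ℝ
  α : ℝ
  r : ℝ
  /-- the constant of the bound `S_le` -/
  C₁ : ℝ
  /-- the constant of the bound `K_le` -/
  C₂ : ℝ
  α_pos : 0 < α
  α_lt : α < 1
  one_lt_p : 1 < p
  p_lt_q : p < q
  q_lt_r : q < r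
  C₁_pos : 0 < C₁
  C₂_pos : 0 < C₂
  A_nonneg : ∀ y, 0 ≤ A y
  B_nonneg : ∀ y, 0 ≤ B y
  S_nonneg : ∀ y, 0 ≤ S y
  K_nonneg : ∀ y, 0 ≤ K y
  A_smul : ∀ (t : ℝ) y, 0 < t → A (t • y) = t ^ p * A y
  B_smul : ∀ (t : ℝ) y, 0 < t → B (t • y) = t ^ q * B y
  S_smul : ∀ (t : ℝ) y, 0 < t → S (t • y) = t ^ α * S y
  K_smul : ∀ (t : ℝ) y, 0 < t → K (t • y) = t ^ r * K y
  S_le : ∀ y, S y ≤ C₁ * A y ^ (α / p)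
  K_le : ∀ y, K y ≤ C₂ * A y ^ (r / p)
  S_pos_of_K_pos : ∀ y, 0 < K y → 0 < S y
  A_mid : ∀ y z, A (mid y z) ≤ (A y + A z) / 2
  B_mid : ∀ y z, B (mid y z) ≤ (B y + B z) / 2
  exists_K_pos : ∃ y, 0 < K y
  tendsto_A : ∀ y h, Tendsto (fun s : ℝ => A (y + s • h)) (𝓝 0) (𝓝 (A y))
  tendsto_B : ∀ y h, Tendsto (fun s : ℝ => B (y + s • h)) (𝓝 0) (𝓝 (B y))
  tendsto_S : ∀ y h, Tendsto (fun s : ℝ => S (y + s • h)) (𝓝 0) (𝓝 (S y))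
  tendsto_K : ∀ y h, Tendsto (fun s : ℝ => K (y + s • h)) (𝓝 0) (𝓝 (K y))
  compact : ∀ (u : ℕ → V) (M : ℝ), (∀ k, A (u k) ≤ M) → (∀ k, B (u k) ≤ M) →
    ∃ φ : ℕ → ℕ, StrictMono φ ∧ ∃ s k : ℝ,
      Tendsto (fun m : ℕ × ℕ => S (mid (u (φ m.1)) (u (φ m.2)))) atTop (𝓝 s) ∧
      Tendsto (fun m : ℕ × ℕ => K (mid (u (φ m.1)) (u (φ m.2)))) atTop (𝓝 k) ∧
      (Tendsto (fun m : ℕ × ℕ => (A (u (φ m.1)) + A (u (φ m.2))) / 2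
          - A (mid (u (φ m.1)) (u (φ m.2)))) atTop (𝓝 0) →
       Tendsto (fun m : ℕ × ℕ => (B (u (φ m.1)) + B (u (φ m.2))) / 2
          - B (mid (u (φ m.1)) (u (φ m.2)))) atTop (𝓝 0) →
       ∃ y, Tendsto (fun i => A (u (φ i))) atTop (𝓝 (A y)) ∧
        Tendsto (fun i => B (u (φ i))) atTop (𝓝 (B y)) ∧ S y = s ∧ K y = k)
  /-- the pointwise absolute value -/
  absV : V → V
  A_abs : ∀ y, A (absV y) ≤ A y
  B_abs : ∀ y, B (absV y) ≤ B y
  S_abs : ∀ y, S (absV y) = S y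
  K_abs : ∀ y, K (absV y) = K y

namespace FiberedSystem

variable {V : Type*} [AddCommGroup V] [Module ℝ V] (F : FiberedSystem V) {lam R : ℝ}

/-- The energy. -/
noncomputable def J (lam : ℝ) (y : V) : ℝ :=
  F.A y / F.p + F.B y / F.q - F.S y / F.α - lam * F.K y

/-- The Nehari equation. -/
def IsNehari (lam : ℝ) (y : V) : Prop := F.A y + F.B y - F.r * (lam * F.K y) = F.S y

/-- On the sphere `A = R^p` the energy is positive and increases along rays. -/
def IsBarrier (lam R : ℝ) : Prop :=
  ∀ y, F.A y = R ^ F.p → F.S y < F.A y + F.B y - F.r * (lam * F.K y) ∧ 0 < F.J lam y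

theorem α_lt_p : F.α < F.p := F.α_lt.trans F.one_lt_p
theorem p_pos : 0 < F.p := zero_lt_one.trans F.one_lt_p
theorem q_pos : 0 < F.q := F.p_pos.trans F.p_lt_q
theorem r_pos : 0 < F.r := F.q_pos.trans F.q_lt_r

theorem J_smul {t : ℝ} (ht : 0 < t) (y : V) :
    F.J lam (t • y) = fib F.p F.q F.α F.r (F.A y) (F.B y) (F.S y) (lam * F.K y) t := by
  rw [J, fib, F.A_smul t y ht, F.B_smul t y ht, F.S_smul t y ht, F.K_smul t y ht]
  ring

theorem nehariGap_smul {t : ℝ} (ht : 0 < t) (y : V) :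
    F.A (t • y) + F.B (t • y) - F.r * (lam * F.K (t • y)) - F.S (t • y) =
      t ^ F.α * (fibSlope F.p F.q F.α F.r (F.A y) (F.B y) (lam * F.K y) t - F.S y) := by
  have e : ∀ s : ℝ, t ^ s = t ^ F.α * t ^ (s - F.α) := fun s => by
    rw [← Real.rpow_add ht]; congr 1; ring
  rw [fibSlope, F.A_smul t y ht, F.B_smul t y ht, F.S_smul t y ht, F.K_smul t y ht,
    e F.p, e F.q, e F.r]
  ring

theorem isNehari_smul_iff {t : ℝ} (ht : 0 < t) (y : V) :
    F.IsNehari lam (t • y) ↔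
      fibSlope F.p F.q F.α F.r (F.A y) (F.B y) (lam * F.K y) t = F.S y := by
  have h := F.nehariGap_smul (lam := lam) ht y
  have h2 := Real.rpow_pos_of_pos ht F.α
  unfold IsNehari
  constructor
  · intro h1
    rw [h1, sub_self] at h
    rcases mul_eq_zero.1 h.symm with h3 | h3
    · exact absurd h3 h2.ne'
    · linarith
  · intro h1
    rw [h1, sub_self, mul_zero] at h
    linarith

/-- For small `lam` there is a sphere `A = R^p` on which the energy is positive and increasing. -/
theorem exists_isBarrier :
    ∃ R lamStar : ℝ, 0 < R ∧ 0 < lamStar ∧ ∀ lam, 0 < lam → lam < lamStar → F.IsBarrier lam R := by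
  have hp := F.p_pos; have hq := F.q_pos; have hr := F.r_pos; have hα := F.α_pos
  have hαp := F.α_lt_p; have hC1 := F.C₁_pos; have hC2 := F.C₂_pos
  -- `R` is so large that on the sphere both sublinear contributions are below `R^p / 2`; the bound on
  -- `lam` then keeps the coupling term below the other half.
  set D : ℝ := F.C₁ + F.p * F.C₁ / F.α with hD
  have hDpos : 0 < D := by positivity
  set R : ℝ := (2 * D + 1) ^ (1 / (F.p - F.α)) with hR
  have hRpos : 0 < R := Real.rpow_pos_of_pos (by positivity) _
  have hRp : R ^ F.p = (2 * D + 1) * R ^ F.α := by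
    have : R ^ (F.p - F.α) = 2 * D + 1 := by
      rw [hR, ← Real.rpow_mul (by positivity), one_div, inv_mul_cancel₀ (by linarith),
        Real.rpow_one]
    rw [← this, ← Real.rpow_add hRpos]; congr 1; ring
  have hRα : 0 < R ^ F.α := Real.rpow_pos_of_pos hRpos _
  have hRr : 0 < R ^ F.r := Real.rpow_pos_of_pos hRpos _
  have hRpp : 0 < R ^ F.p := Real.rpow_pos_of_pos hRpos _
  refine ⟨R, R ^ F.p / (2 * F.r * F.C₂ * R ^ F.r), hRpos, by positivity, ?_⟩
  intro lam hl0 hl y hy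
  rw [lt_div_iff₀ (by positivity)] at hl
  have hS : F.S y ≤ F.C₁ * R ^ F.α := by
    have := F.S_le y
    rwa [hy, ← Real.rpow_mul hRpos.le, mul_div_cancel₀ _ hp.ne'] at this
  have hK : F.K y ≤ F.C₂ * R ^ F.r := by
    have := F.K_le y
    rwa [hy, ← Real.rpow_mul hRpos.le, mul_div_cancel₀ _ hp.ne'] at this
  have hB := F.B_nonneg y
  have hlK : lam * F.K y ≤ lam * (F.C₂ * R ^ F.r) := mul_le_mul_of_nonneg_left hK hl0.le
  have hS2 : F.p * (F.S y / F.α) ≤ F.p * (F.C₁ / F.α) * R ^ F.α := by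
    have : F.S y / F.α ≤ F.C₁ * R ^ F.α / F.α := by gcongr
    calc F.p * (F.S y / F.α) ≤ F.p * (F.C₁ * R ^ F.α / F.α) := by gcongr
      _ = _ := by ring
  have hDR : D * R ^ F.α = F.C₁ * R ^ F.α + F.p * (F.C₁ / F.α) * R ^ F.α := by rw [hD]; ring
  have hpos2 : 0 ≤ F.p * (F.C₁ / F.α) * R ^ F.α := by positivity
  have hpos1 : 0 ≤ F.C₁ * R ^ F.α := by positivity
  have hrK : F.r * (lam * F.K y) < R ^ F.p / 2 := by
    have := mul_le_mul_of_nonneg_left hlK hr.le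
    nlinarith
  constructor
  · rw [hy]; nlinarith
  · have hpK : F.p * (lam * F.K y) < R ^ F.p / 2 := by
      have h0 : 0 ≤ lam * F.K y := mul_nonneg hl0.le (F.K_nonneg y)
      have : F.p * (lam * F.K y) ≤ F.r * (lam * F.K y) :=
        mul_le_mul_of_nonneg_right (F.p_lt_q.trans F.q_lt_r).le h0
      linarith
    have h1 : 0 < F.p * F.J lam y := by
      have : F.p * F.J lam y = R ^ F.p + F.p * (F.B y / F.q) - F.p * (F.S y / F.α)
          - F.p * (lam * F.K y) := by
        rw [J, hy]; field_simp
      rw [this]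
      have : 0 ≤ F.p * (F.B y / F.q) := by positivity
      nlinarith
    exact pos_of_mul_pos_right h1 hp.le

variable {F}

/-- The factor that moves a vector to the sphere `A = R^p`. -/
theorem IsBarrier.scaled (hb : F.IsBarrier lam R) (hR : 0 < R) {y : V} (hA : 0 < F.A y) :
    ∃ c, c = R / F.A y ^ (1 / F.p) ∧ 0 < c ∧ c ^ F.p * F.A y = R ^ F.p ∧
      F.S y < fibSlope F.p F.q F.α F.r (F.A y) (F.B y) (lam * F.K y) c ∧
      0 < fib F.p F.q F.α F.r (F.A y) (F.B y) (F.S y) (lam * F.K y) c := by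
  have hAp : 0 < F.A y ^ (1 / F.p) := Real.rpow_pos_of_pos hA _
  have hc : 0 < R / F.A y ^ (1 / F.p) := div_pos hR hAp
  have e : (R / F.A y ^ (1 / F.p)) ^ F.p * F.A y = R ^ F.p := by
    rw [Real.div_rpow hR.le hAp.le, ← Real.rpow_mul hA.le, one_div,
      inv_mul_cancel₀ F.p_pos.ne', Real.rpow_one, div_mul_cancel₀ _ hA.ne']
  refine ⟨_, rfl, hc, e, ?_, ?_⟩
  · have h := (hb ((R / F.A y ^ (1 / F.p)) • y) (by rw [F.A_smul _ _ hc, e])).1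
    have h2 := F.nehariGap_smul (lam := lam) hc y
    have h3 := Real.rpow_pos_of_pos hc F.α
    have h4 : 0 < (R / F.A y ^ (1 / F.p)) ^ F.α * (fibSlope F.p F.q F.α F.r (F.A y) (F.B y)
      (lam * F.K y) (R / F.A y ^ (1 / F.p)) - F.S y) := by rw [← h2]; linarith
    linarith [pos_of_mul_pos_right h4 h3.le]
  · have h := (hb ((R / F.A y ^ (1 / F.p)) • y) (by rw [F.A_smul _ _ hc, e])).2
    rwa [F.J_smul hc] at h

theorem IsBarrier.ne (hb : F.IsBarrier lam R) {y : V} (hy : F.IsNehari lam y) :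
    F.A y ≠ R ^ F.p := fun h => (hb y h).1.ne' hy

/-- Nehari points inside the barrier sphere are nondegenerate minima of their fibering functions and
have negative energy. The first inequality is the sign of the second derivative of `t ↦ J (t y)`
at `1`. -/
theorem IsBarrier.plus (hb : F.IsBarrier lam R) (hR : 0 < R) (hl : 0 ≤ lam) {y : V}
    (hy : F.IsNehari lam y) (hA : 0 < F.A y) (hlt : F.A y < R ^ F.p) :
    0 < (F.p - F.α) * F.A y + (F.q - F.α) * F.B y - F.r * (F.r - F.α) * (lam * F.K y) ∧
      F.J lam y < 0 := by
  obtain ⟨c, -, hc, hcA, hS, -⟩ := hb.scaled hR hA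
  have hc1 : 1 < c := by
    by_contra! h
    have : c ^ F.p ≤ 1 := Real.rpow_le_one hc.le h F.p_pos.le
    nlinarith
  have := fib_plus F.α_pos F.α_lt_p F.p_lt_q F.q_lt_r (F.A_nonneg y)
    (mul_nonneg hl (F.K_nonneg y)) hy hc1 hS
  rwa [← F.J_smul zero_lt_one, one_smul] at this

/-- Nehari points outside the barrier sphere are nondegenerate global maxima of their fibering
functions and have positive energy. The two statements on `fibSlope` record its sign on both sides
of `t = 1`, on the left down to the barrier sphere. -/
theorem IsBarrier.minus (hb : F.IsBarrier lam R) (hR : 0 < R) (hl : 0 ≤ lam) {y : V}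
    (hy : F.IsNehari lam y) (hlt : R ^ F.p < F.A y) :
    (F.p - F.α) * F.A y + (F.q - F.α) * F.B y - F.r * (F.r - F.α) * (lam * F.K y) < 0 ∧
      (∀ t : ℝ, 1 < t → fibSlope F.p F.q F.α F.r (F.A y) (F.B y) (lam * F.K y) t < F.S y) ∧
      (∀ t : ℝ, 0 ≤ t → R ^ F.p ≤ t ^ F.p * F.A y → t < 1 →
        F.S y < fibSlope F.p F.q F.α F.r (F.A y) (F.B y) (lam * F.K y) t) ∧
      (∀ t : ℝ, 0 < t → F.J lam (t • y) ≤ F.J lam y) ∧ 0 < F.J lam y := by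
  have hA : 0 < F.A y := (Real.rpow_pos_of_pos hR _).trans hlt
  obtain ⟨c, -, hc, hcA, hS, hpos⟩ := hb.scaled hR hA
  have hc1 : c < 1 := by
    by_contra! h
    have : 1 ≤ c ^ F.p := Real.one_le_rpow h F.p_pos.le
    nlinarith
  obtain ⟨h1, h2, h3, h4⟩ := fib_minus F.α_pos F.α_lt_p F.p_lt_q F.q_lt_r (F.A_nonneg y)
    (mul_nonneg hl (F.K_nonneg y)) hy hc hc1 hS hpos
  have e : F.J lam y = fib F.p F.q F.α F.r (F.A y) (F.B y) (F.S y) (lam * F.K y) 1 := by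
    rw [← F.J_smul zero_lt_one, one_smul]
  refine ⟨h1, h2, ?_, ?_, ?_⟩
  · intro t ht0 ht ht1
    refine h3 t ?_ ht1
    by_contra! hh
    have := Real.rpow_lt_rpow ht0 hh F.p_pos
    nlinarith
  · intro t ht
    rw [F.J_smul ht, e]
    exact h4 t ht.le
  · rw [e]
    exact hpos.trans_le (h4 c hc.le)

theorem A_pos_of_K_pos {y : V} (h : 0 < F.K y) : 0 < F.A y := by
  refine lt_of_le_of_ne (F.A_nonneg y) fun h0 => ?_
  have := F.K_le y
  rw [← h0, Real.zero_rpow (div_pos F.r_pos F.p_pos).ne', mul_zero] at this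
  linarith

theorem A_pos_of_S_pos {y : V} (h : 0 < F.S y) : 0 < F.A y := by
  refine lt_of_le_of_ne (F.A_nonneg y) fun h0 => ?_
  have := F.S_le y
  rw [← h0, Real.zero_rpow (div_pos F.α_pos F.p_pos).ne', mul_zero] at this
  linarith

/-- Every direction with `K > 0` meets the outer part of the Nehari manifold, at a factor at most
`T` as soon as `T` satisfies an explicit bound. -/
theorem IsBarrier.exists_smul_le (hb : F.IsBarrier lam R) (hR : 0 < R) {y : V}
    (hK : 0 < F.K y) {T : ℝ} (hT1 : 1 ≤ T) (hT2 : R / F.A y ^ (1 / F.p) ≤ T)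
    (hT3 : F.A y + F.B y ≤ F.r * (lam * F.K y) * T ^ (F.r - F.q)) :
    ∃ t : ℝ, R / F.A y ^ (1 / F.p) < t ∧ 0 < t ∧ t ≤ T ∧ F.IsNehari lam (t • y) ∧
      R ^ F.p < F.A (t • y) := by
  have hA := A_pos_of_K_pos hK
  obtain ⟨c, hcdef, hc, hcA, hS, -⟩ := hb.scaled hR hA
  rw [← hcdef] at hT2 ⊢
  obtain ⟨t, ht, htT, h⟩ := exists_fibSlope_eq F.α_lt_p F.p_lt_q F.q_lt_r (F.A_nonneg y)
    (F.S_nonneg y) hc hS hT2 hT1 hT3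
  have ht0 := hc.trans ht
  refine ⟨t, ht, ht0, htT, (F.isNehari_smul_iff ht0 y).2 h, ?_⟩
  rw [F.A_smul t y ht0, ← hcA]
  exact mul_lt_mul_of_pos_right (Real.rpow_lt_rpow hc.le ht F.p_pos) hA

theorem IsBarrier.exists_smul (hb : F.IsBarrier lam R) (hR : 0 < R) (hl : 0 < lam) {y : V}
    (hK : 0 < F.K y) : ∃ t : ℝ, 0 < t ∧ F.IsNehari lam (t • y) ∧ R ^ F.p < F.A (t • y) := by
  have hlim : Tendsto (fun T : ℝ => F.r * (lam * F.K y) * T ^ (F.r - F.q)) atTop atTop :=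
    (tendsto_rpow_atTop (by linarith [F.q_lt_r])).const_mul_atTop
      (mul_pos F.r_pos (mul_pos hl hK))
  obtain ⟨T, h1, h2, h3⟩ := ((eventually_ge_atTop 1).and ((eventually_ge_atTop
    (R / F.A y ^ (1 / F.p))).and (hlim.eventually_ge_atTop (F.A y + F.B y)))).exists
  obtain ⟨t, -, ht, -, h4, h5⟩ := hb.exists_smul_le hR hK h1 h2 h3
  exact ⟨t, ht, h4, h5⟩

theorem mid_self (y : V) : mid y y = y := by
  rw [mid, ← two_smul ℝ y, smul_smul]; norm_num

end FiberedSystem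

/-! ### Minimizers on the two sides of the barrier -/

namespace FiberedSystem

variable {V : Type*} [AddCommGroup V] [Module ℝ V] (F : FiberedSystem V) {lam R : ℝ}

/-- The convexity defect of `A` at a pair of vectors. -/
noncomputable def defectA (y z : V) : ℝ := (F.A y + F.A z) / 2 - F.A (mid y z)

/-- The convexity defect of `B` at a pair of vectors. -/
noncomputable def defectB (y z : V) : ℝ := (F.B y + F.B z) / 2 - F.B (mid y z)

theorem defectA_nonneg (y z : V) : 0 ≤ F.defectA y z := sub_nonneg.2 (F.A_mid y z)

theorem defectB_nonneg (y z : V) : 0 ≤ F.defectB y z := sub_nonneg.2 (F.B_mid y z)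

theorem exists_K_pos_S_pos : ∃ y, 0 < F.K y ∧ 0 < F.S y := by
  obtain ⟨y, hy⟩ := F.exists_K_pos
  exact ⟨y, hy, F.S_pos_of_K_pos y hy⟩

theorem tendsto_fst_atTop {f : ℕ → ℝ} {a : ℝ} (h : Tendsto f atTop (𝓝 a)) :
    Tendsto (fun m : ℕ × ℕ => f m.1) atTop (𝓝 a) := by
  rw [← prod_atTop_atTop_eq]; exact h.comp tendsto_fst

theorem tendsto_snd_atTop {f : ℕ → ℝ} {a : ℝ} (h : Tendsto f atTop (𝓝 a)) :
    Tendsto (fun m : ℕ × ℕ => f m.2) atTop (𝓝 a) := by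
  rw [← prod_atTop_atTop_eq]; exact h.comp tendsto_snd

theorem tendsto_diag {f : ℕ × ℕ → ℝ} {a : ℝ} (h : Tendsto f atTop (𝓝 a)) :
    Tendsto (fun i => f (i, i)) atTop (𝓝 a) := by
  rw [← prod_atTop_atTop_eq] at h
  exact h.comp (tendsto_id.prodMk tendsto_id)

/-- A minimizing sequence for a set of reals. -/
theorem exists_minimizing {X : Type*} {P : X → Prop} {f : X → ℝ} (hne : ∃ y, P y) {c : ℝ}
    (hc : ∀ y, P y → c ≤ f y) :
    ∃ (m : ℝ) (u : ℕ → X), (∀ y, P y → m ≤ f y) ∧ (∀ k, P (u k)) ∧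
      Tendsto (fun k => f (u k)) atTop (𝓝 m) := by
  have h1 : (f '' {y | P y}).Nonempty := by
    obtain ⟨y, hy⟩ := hne
    exact ⟨_, y, hy, rfl⟩
  have h2 : BddBelow (f '' {y | P y}) := ⟨c, by rintro _ ⟨y, hy, rfl⟩; exact hc y hy⟩
  obtain ⟨v, -, hv, hvm⟩ := exists_seq_tendsto_sInf h1 h2
  choose u hu huv using hvm
  exact ⟨_, u, fun y hy => csInf_le h2 ⟨y, hy, rfl⟩, hu, by simpa [huv] using hv⟩

variable {F}

/-- The energy has a minimizer over the ball `A ≤ R^p`; its minimum is negative. -/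
theorem exists_ball_minimizer (hR : 0 < R) (hl : 0 < lam) :
    ∃ y, F.A y ≤ R ^ F.p ∧ F.J lam y < 0 ∧ ∀ z, F.A z ≤ R ^ F.p → F.J lam y ≤ F.J lam z := by
  have hp := F.p_pos; have hq := F.q_pos; have hr := F.r_pos; have hα := F.α_pos
  have hS : ∀ y, F.A y ≤ R ^ F.p → F.S y ≤ F.C₁ * R ^ F.α := fun y hy => by
    refine (F.S_le y).trans (mul_le_mul_of_nonneg_left ?_ F.C₁_pos.le)
    have := Real.rpow_le_rpow (F.A_nonneg y) hy (div_pos hα hp).le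
    rwa [← Real.rpow_mul hR.le, mul_div_cancel₀ _ hp.ne'] at this
  have hK : ∀ y, F.A y ≤ R ^ F.p → F.K y ≤ F.C₂ * R ^ F.r := fun y hy => by
    refine (F.K_le y).trans (mul_le_mul_of_nonneg_left ?_ F.C₂_pos.le)
    have := Real.rpow_le_rpow (F.A_nonneg y) hy (div_pos hr hp).le
    rwa [← Real.rpow_mul hR.le, mul_div_cancel₀ _ hp.ne'] at this
  set c0 : ℝ := F.C₁ * R ^ F.α / F.α + lam * (F.C₂ * R ^ F.r) with hc0
  have hlow : ∀ y, F.A y ≤ R ^ F.p → F.B y / F.q - c0 ≤ F.J lam y := fun y hy => by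
    have h1 : F.S y / F.α ≤ F.C₁ * R ^ F.α / F.α := by
      have := hS y hy
      gcongr
    have h2 := mul_le_mul_of_nonneg_left (hK y hy) hl.le
    have h3 : 0 ≤ F.A y / F.p := div_nonneg (F.A_nonneg y) hp.le
    rw [J]; linarith
  -- the energy is negative at small multiples of any vector with `S > 0`
  have hneg : ∃ y, F.A y ≤ R ^ F.p ∧ F.J lam y < 0 := by
    obtain ⟨y, hKy, hSy⟩ := F.exists_K_pos_S_pos
    have e : ∀ s : ℝ, 0 < s → Tendsto (fun t : ℝ => t ^ s) (𝓝[>] 0) (𝓝 0) := fun s hs => by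
      have := (Real.continuousAt_rpow_const 0 s (Or.inr hs.le)).tendsto
      rw [Real.zero_rpow hs.ne'] at this
      exact this.mono_left nhdsWithin_le_nhds
    have h1 : Tendsto (fun t : ℝ => F.A y / F.p * t ^ (F.p - F.α) + F.B y / F.q * t ^ (F.q - F.α)
        - lam * F.K y * t ^ (F.r - F.α)) (𝓝[>] 0) (𝓝 0) := by
      have hh := (((e (F.p - F.α) (by linarith [F.α_lt_p])).const_mul (F.A y / F.p)).add
        ((e (F.q - F.α) (by linarith [F.α_lt_p, F.p_lt_q])).const_mul (F.B y / F.q))).sub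
        ((e (F.r - F.α) (by linarith [F.α_lt_p, F.p_lt_q, F.q_lt_r])).const_mul (lam * F.K y))
      simpa using hh
    have h2 : Tendsto (fun t : ℝ => t ^ F.p * F.A y) (𝓝[>] 0) (𝓝 0) := by
      simpa using (e F.p hp).mul_const (F.A y)
    obtain ⟨t, ht1, ht2, ht0⟩ := ((h1.eventually_lt_const (div_pos hSy hα)).and
      ((h2.eventually_lt_const (Real.rpow_pos_of_pos hR F.p)).and self_mem_nhdsWithin)).exists
    replace ht0 : 0 < t := ht0
    refine ⟨t • y, by rw [F.A_smul t y ht0]; exact ht2.le, ?_⟩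
    have e2 : ∀ s : ℝ, t ^ s = t ^ F.α * t ^ (s - F.α) := fun s => by
      rw [← Real.rpow_add ht0]; congr 1; ring
    have : F.J lam (t • y) = t ^ F.α * ((F.A y / F.p * t ^ (F.p - F.α)
        + F.B y / F.q * t ^ (F.q - F.α) - lam * F.K y * t ^ (F.r - F.α)) - F.S y / F.α) := by
      rw [F.J_smul ht0, fib, e2 F.p, e2 F.q, e2 F.r]; ring
    rw [this]
    exact mul_neg_of_pos_of_neg (Real.rpow_pos_of_pos ht0 _) (by linarith)
  obtain ⟨y0, hy0, hJ0⟩ := hneg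
  obtain ⟨m, u, hm, hu, hlim⟩ := exists_minimizing (P := fun y => F.A y ≤ R ^ F.p)
    (f := F.J lam) ⟨y0, hy0⟩ (c := -c0) (fun y hy => by
      have := hlow y hy
      have : 0 ≤ F.B y / F.q := div_nonneg (F.B_nonneg y) hq.le
      linarith)
  obtain ⟨b, hb⟩ := hlim.bddAbove_range
  have hub : ∀ k, F.B (u k) ≤ F.q * (b + c0) := fun k => by
    have h1 := hlow (u k) (hu k)
    have h2 : F.J lam (u k) ≤ b := hb ⟨k, rfl⟩
    have h3 : F.B (u k) / F.q ≤ b + c0 := by linarith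
    rwa [div_le_iff₀ hq, mul_comm] at h3
  obtain ⟨φ, hφ, s, k, hs, hk, hstrong⟩ := F.compact u (max (R ^ F.p) (F.q * (b + c0)))
    (fun i => (hu i).trans (le_max_left _ _)) (fun i => (hub i).trans (le_max_right _ _))
  have hs1 : Tendsto (fun i => F.S (u (φ i))) atTop (𝓝 s) := by
    simpa [mid_self] using tendsto_diag hs
  have hk1 : Tendsto (fun i => F.K (u (φ i))) atTop (𝓝 k) := by
    simpa [mid_self] using tendsto_diag hk
  have hJ1 : Tendsto (fun i => F.J lam (u (φ i))) atTop (𝓝 m) := hlim.comp hφ.tendsto_atTop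
  have hmidA : ∀ i j, F.A (mid (u i) (u j)) ≤ R ^ F.p := fun i j => by
    linarith [F.A_mid (u i) (u j), hu i, hu j]
  -- the midpoints are competitors, so the defects of `A / p + B / q` are bounded by terms tending to `0`
  have hsum : Tendsto (fun n : ℕ × ℕ => F.defectA (u (φ n.1)) (u (φ n.2)) / F.p
      + F.defectB (u (φ n.1)) (u (φ n.2)) / F.q) atTop (𝓝 0) := by
    have hup : Tendsto (fun n : ℕ × ℕ =>
        ((F.J lam (u (φ n.1)) + F.J lam (u (φ n.2))) / 2 - m)
        + ((F.S (u (φ n.1)) + F.S (u (φ n.2))) / 2 - F.S (mid (u (φ n.1)) (u (φ n.2)))) / F.α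
        + lam * ((F.K (u (φ n.1)) + F.K (u (φ n.2))) / 2 - F.K (mid (u (φ n.1)) (u (φ n.2)))))
        atTop (𝓝 0) := by
      have h1 := (((tendsto_fst_atTop hJ1).add (tendsto_snd_atTop hJ1)).div_const 2).sub_const m
      have h2 := ((((tendsto_fst_atTop hs1).add (tendsto_snd_atTop hs1)).div_const 2).sub
        hs).div_const F.α
      have h3 := ((((tendsto_fst_atTop hk1).add (tendsto_snd_atTop hk1)).div_const 2).sub
        hk).const_mul lam
      have h4 := (h1.add h2).add h3
      simpa using h4
    refine squeeze_zero (fun n => add_nonneg (div_nonneg (F.defectA_nonneg _ _) hp.le)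
      (div_nonneg (F.defectB_nonneg _ _) hq.le)) (fun n => ?_) hup
    have h1 := hm _ (hmidA (φ n.1) (φ n.2))
    simp only [J, defectA, defectB] at h1 ⊢
    ring_nf at h1 ⊢
    linarith
  have hdA : Tendsto (fun n : ℕ × ℕ => F.defectA (u (φ n.1)) (u (φ n.2))) atTop (𝓝 0) := by
    refine squeeze_zero (fun n => F.defectA_nonneg _ _) (fun n => ?_)
      (by simpa using hsum.const_mul F.p)
    have : 0 ≤ F.defectB (u (φ n.1)) (u (φ n.2)) / F.q :=
      div_nonneg (F.defectB_nonneg _ _) hq.le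
    have e : F.defectA (u (φ n.1)) (u (φ n.2)) =
      F.p * (F.defectA (u (φ n.1)) (u (φ n.2)) / F.p) := by field_simp
    nlinarith
  have hdB : Tendsto (fun n : ℕ × ℕ => F.defectB (u (φ n.1)) (u (φ n.2))) atTop (𝓝 0) := by
    refine squeeze_zero (fun n => F.defectB_nonneg _ _) (fun n => ?_)
      (by simpa using hsum.const_mul F.q)
    have : 0 ≤ F.defectA (u (φ n.1)) (u (φ n.2)) / F.p :=
      div_nonneg (F.defectA_nonneg _ _) hp.le
    have e : F.defectB (u (φ n.1)) (u (φ n.2)) =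
      F.q * (F.defectB (u (φ n.1)) (u (φ n.2)) / F.q) := by field_simp
    nlinarith
  obtain ⟨y, hyA, hyB, hyS, hyK⟩ := hstrong hdA hdB
  have hJy : F.J lam y = m := by
    refine tendsto_nhds_unique ?_ hJ1
    have := (((hyA.div_const F.p).add (hyB.div_const F.q)).sub (hs1.div_const F.α)).sub
      (hk1.const_mul lam)
    rw [← hyS, ← hyK] at this
    exact this
  refine ⟨y, le_of_tendsto' hyA fun i => hu _, ?_, fun z hz => hJy ▸ hm z hz⟩
  rw [hJy]
  exact (hm y0 hy0).trans_lt hJ0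

/-- On the outer part of the Nehari manifold the energy is coercive. -/
theorem exists_bound_of_isNehari (b : ℝ) :
    ∃ M : ℝ, ∀ lam y, F.IsNehari lam y → F.J lam y ≤ b → F.A y ≤ M ∧ F.B y ≤ M := by
  have hp := F.p_pos; have hq := F.q_pos; have hr := F.r_pos; have hα := F.α_pos
  have hpr : F.p < F.r := F.p_lt_q.trans F.q_lt_r
  set a : ℝ := 1 / F.p - 1 / F.r with ha
  set d : ℝ := 1 / F.q - 1 / F.r with hd
  set e : ℝ := 1 / F.α - 1 / F.r with he
  have ha0 : 0 < a := sub_pos.2 (one_div_lt_one_div_of_lt hp hpr)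
  have hd0 : 0 < d := sub_pos.2 (one_div_lt_one_div_of_lt hq F.q_lt_r)
  have he0 : 0 < e := sub_pos.2 (one_div_lt_one_div_of_lt hα (F.α_lt_p.trans hpr))
  -- beyond `X` the sublinear term is absorbed by half of the coercive one
  have hθ : 0 < 1 - F.α / F.p := by
    rw [sub_pos, div_lt_one hp]; exact F.α_lt_p
  have hlim : Tendsto (fun x : ℝ => a / 2 * x ^ (1 - F.α / F.p)) atTop atTop :=
    (tendsto_rpow_atTop hθ).const_mul_atTop (by linarith)
  obtain ⟨X, hX⟩ := (((hlim.eventually_ge_atTop (e * F.C₁)).and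
    (eventually_ge_atTop 1))).exists_forall_of_atTop
  set X1 : ℝ := max X 1
  have habs : ∀ x : ℝ, 0 ≤ x → e * (F.C₁ * x ^ (F.α / F.p)) ≤
      a / 2 * x + e * (F.C₁ * X1 ^ (F.α / F.p)) := fun x hx => by
    have hX1 : 0 < X1 := lt_max_of_lt_right one_pos
    have hnn : 0 ≤ e * (F.C₁ * X1 ^ (F.α / F.p)) :=
      mul_nonneg he0.le (mul_nonneg F.C₁_pos.le (Real.rpow_nonneg hX1.le _))
    rcases le_total x X1 with h | h
    · have h1 : x ^ (F.α / F.p) ≤ X1 ^ (F.α / F.p) :=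
        Real.rpow_le_rpow hx h (div_pos hα hp).le
      have h2 := mul_le_mul_of_nonneg_left (mul_le_mul_of_nonneg_left h1 F.C₁_pos.le) he0.le
      have h3 : 0 ≤ a / 2 * x := by positivity
      linarith
    · have h1 := (hX x ((le_max_left _ _).trans h)).1
      have hx0 : 0 < x := hX1.trans_le h
      have h2 : x = x ^ (1 - F.α / F.p) * x ^ (F.α / F.p) := by
        rw [← Real.rpow_add hx0]; simp
      have h3 : 0 ≤ x ^ (F.α / F.p) := Real.rpow_nonneg hx _
      have h4 := mul_le_mul_of_nonneg_right h1 h3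
      have h5 : a / 2 * x ^ (1 - F.α / F.p) * x ^ (F.α / F.p) = a / 2 * x := by
        rw [mul_assoc, ← h2]
      linarith
  set c : ℝ := e * (F.C₁ * X1 ^ (F.α / F.p))
  refine ⟨max (2 * (b + c) / a) ((b + c) / d), fun lam y hN hJ => ?_⟩
  -- the Nehari equation eliminates the coupling term
  have hid : F.J lam y = a * F.A y + d * F.B y - e * F.S y := by
    have : lam * F.K y = (F.A y + F.B y - F.S y) / F.r := by
      rw [IsNehari] at hN
      field_simp
      linarith
    rw [J, this, ha, hd, he]
    field_simp
    ring
  have h1 : e * F.S y ≤ a / 2 * F.A y + c :=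
    (mul_le_mul_of_nonneg_left (F.S_le y) he0.le).trans (habs _ (F.A_nonneg y))
  have hA0 : 0 ≤ a / 2 * F.A y := mul_nonneg (by linarith) (F.A_nonneg y)
  have hB0 : 0 ≤ d * F.B y := mul_nonneg hd0.le (F.B_nonneg y)
  constructor
  · refine le_trans ?_ (le_max_left _ _)
    rw [le_div_iff₀ ha0]
    nlinarith
  · refine le_trans ?_ (le_max_right _ _)
    rw [le_div_iff₀ hd0]
    nlinarith

end FiberedSystem

namespace FiberedSystem

variable {V : Type*} [AddCommGroup V] [Module ℝ V] {F : FiberedSystem V} {lam R : ℝ}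

/-- The energy has a minimizer over the part `A > R^p` of the Nehari manifold. The convexity
defect of a minimizing sequence is controlled by projecting midpoints to the Nehari manifold:
its elements are global maxima of their fibering functions, so that the same factor applied to
them does not raise the energy. -/
theorem IsBarrier.exists_outer_minimizer (hb : F.IsBarrier lam R) (hR : 0 < R) (hl : 0 < lam) :
    ∃ y, F.IsNehari lam y ∧ R ^ F.p < F.A y ∧
      ∀ z, F.IsNehari lam z → R ^ F.p < F.A z → F.J lam y ≤ F.J lam z := by
  have hp := F.p_pos; have hq := F.q_pos; have hr := F.r_pos; have hα := F.α_pos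
  have hpα := F.α_lt_p; have hpq := F.p_lt_q; have hqr := F.q_lt_r
  have hRp : 0 < R ^ F.p := Real.rpow_pos_of_pos hR _
  have hne : ∃ y, F.IsNehari lam y ∧ R ^ F.p < F.A y := by
    obtain ⟨y, hy⟩ := F.exists_K_pos
    obtain ⟨t, -, h⟩ := hb.exists_smul hR hl hy
    exact ⟨_, h⟩
  obtain ⟨m, u, hm, hu, hlim⟩ := exists_minimizing
    (P := fun y => F.IsNehari lam y ∧ R ^ F.p < F.A y) (f := F.J lam) hne (c := 0)
    (fun y hy => (hb.minus hR hl.le hy.1 hy.2).2.2.2.2.le)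
  obtain ⟨b, hb'⟩ := hlim.bddAbove_range
  obtain ⟨M, hM⟩ := exists_bound_of_isNehari (F := F) b
  have huM : ∀ k, F.A (u k) ≤ M ∧ F.B (u k) ≤ M := fun k =>
    hM lam (u k) (hu k).1 (hb' ⟨k, rfl⟩)
  have hM0 : 0 < M := hRp.trans ((hu 0).2.trans_le (huM 0).1)
  obtain ⟨φ, hφ, s, k, hs, hk, hstrong⟩ := F.compact u M (fun i => (huM i).1)
    (fun i => (huM i).2)
  have hs1 : Tendsto (fun i => F.S (u (φ i))) atTop (𝓝 s) := by
    simpa [mid_self] using tendsto_diag hs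
  have hk1 : Tendsto (fun i => F.K (u (φ i))) atTop (𝓝 k) := by
    simpa [mid_self] using tendsto_diag hk
  have hJ1 : Tendsto (fun i => F.J lam (u (φ i))) atTop (𝓝 m) := hlim.comp hφ.tendsto_atTop
  -- a positive lower bound of `K`
  have hd : 0 < F.r * (F.r - F.α) * lam := mul_pos (mul_pos hr (by linarith)) hl
  obtain ⟨k0, hk0, hKk0⟩ : ∃ k0 : ℝ, 0 < k0 ∧ ∀ i, k0 ≤ F.K (u i) := by
    refine ⟨(F.p - F.α) * R ^ F.p / (F.r * (F.r - F.α) * lam),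
      div_pos (mul_pos (by linarith) hRp) hd, fun i => ?_⟩
    rw [div_le_iff₀ hd]
    have h1 := (hb.minus hR hl.le (hu i).1 (hu i).2).1
    have h2 := mul_lt_mul_of_pos_left (hu i).2 (show 0 < F.p - F.α by linarith)
    have h3 : 0 ≤ (F.q - F.α) * F.B (u i) := mul_nonneg (by linarith) (F.B_nonneg _)
    linarith
  have hkk0 : k0 ≤ k := ge_of_tendsto' hk1 fun i => hKk0 _
  have hKev : ∀ᶠ n : ℕ × ℕ in atTop, k0 / 2 < F.K (mid (u (φ n.1)) (u (φ n.2))) :=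
    hk.eventually_const_lt (by linarith)
  set a1 : ℝ := (k0 / 2 / F.C₂) ^ (F.p / F.r) with ha1
  have hC2 := F.C₂_pos
  have ha1pos : 0 < a1 := Real.rpow_pos_of_pos (by positivity) _
  set D : ℝ := F.r * (lam * (k0 / 2)) with hD
  have hDpos : 0 < D := by positivity
  -- `T` bounds the factors that take midpoints to the Nehari manifold from above, `c0` from below
  set T : ℝ := max 1 (max (R / a1 ^ (1 / F.p)) ((2 * M / D) ^ (1 / (F.r - F.q)))) with hT
  have hT1 : 1 ≤ T := le_max_left _ _
  have hT0 : 0 < T := by linarith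
  have hT2 : R / a1 ^ (1 / F.p) ≤ T := (le_max_left _ _).trans (le_max_right _ _)
  have hT3 : 2 * M ≤ D * T ^ (F.r - F.q) := by
    have h1 : (2 * M / D) ^ (1 / (F.r - F.q)) ≤ T := (le_max_right _ _).trans (le_max_right _ _)
    have h2 := Real.rpow_le_rpow (Real.rpow_nonneg (by positivity) _) h1
      (show 0 ≤ F.r - F.q by linarith)
    rw [← Real.rpow_mul (by positivity), one_div, inv_mul_cancel₀ (by linarith),
      Real.rpow_one, div_le_iff₀ hDpos] at h2
    linarith
  set c0 : ℝ := R / M ^ (1 / F.p) with hc0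
  have hc0pos : 0 < c0 := div_pos hR (Real.rpow_pos_of_pos hM0 _)
  have hup : Tendsto (fun n : ℕ × ℕ =>
      ((F.J lam (u (φ n.1)) + F.J lam (u (φ n.2))) / 2 - m)
      + T ^ F.α * |(F.S (u (φ n.1)) + F.S (u (φ n.2))) / 2
          - F.S (mid (u (φ n.1)) (u (φ n.2)))| / F.α
      + lam * (T ^ F.r * |(F.K (u (φ n.1)) + F.K (u (φ n.2))) / 2
          - F.K (mid (u (φ n.1)) (u (φ n.2)))|))
      atTop (𝓝 0) := by
    have h1 := (((tendsto_fst_atTop hJ1).add (tendsto_snd_atTop hJ1)).div_const 2).sub_const m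
    have h2 := (((((tendsto_fst_atTop hs1).add (tendsto_snd_atTop hs1)).div_const 2).sub
      hs).abs.const_mul (T ^ F.α)).div_const F.α
    have h3 := (((((tendsto_fst_atTop hk1).add (tendsto_snd_atTop hk1)).div_const 2).sub
      hk).abs.const_mul (T ^ F.r)).const_mul lam
    have h4 := (h1.add h2).add h3
    simpa using h4
  have hle : ∀ᶠ n : ℕ × ℕ in atTop, c0 ^ F.p * (F.defectA (u (φ n.1)) (u (φ n.2)) / F.p)
      + c0 ^ F.q * (F.defectB (u (φ n.1)) (u (φ n.2)) / F.q) ≤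
      ((F.J lam (u (φ n.1)) + F.J lam (u (φ n.2))) / 2 - m)
      + T ^ F.α * |(F.S (u (φ n.1)) + F.S (u (φ n.2))) / 2
          - F.S (mid (u (φ n.1)) (u (φ n.2)))| / F.α
      + lam * (T ^ F.r * |(F.K (u (φ n.1)) + F.K (u (φ n.2))) / 2
          - F.K (mid (u (φ n.1)) (u (φ n.2)))|) := by
    filter_upwards [hKev] with n hKn
    set y := u (φ n.1) with hydef
    set z := u (φ n.2) with hzdef
    have hKpos : 0 < F.K (mid y z) := by linarith
    have hApos := A_pos_of_K_pos hKpos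
    have hAM : F.A (mid y z) ≤ M := by
      linarith [F.A_mid y z, (huM (φ n.1)).1, (huM (φ n.2)).1]
    have hBM : F.B (mid y z) ≤ M := by
      linarith [F.B_mid y z, (huM (φ n.1)).2, (huM (φ n.2)).2]
    have hAa : a1 ≤ F.A (mid y z) := by
      have h1 : k0 / 2 / F.C₂ ≤ F.A (mid y z) ^ (F.r / F.p) := by
        rw [div_le_iff₀ hC2, mul_comm]
        exact hKn.le.trans (F.K_le _)
      have h2 := Real.rpow_le_rpow (by positivity) h1 (div_pos hp hr).le
      rw [← Real.rpow_mul hApos.le, div_mul_div_cancel₀ hp.ne', div_self hr.ne',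
        Real.rpow_one] at h2
      exact h2
    have hAT : R / F.A (mid y z) ^ (1 / F.p) ≤ T := by
      refine le_trans ?_ hT2
      have h1 : a1 ^ (1 / F.p) ≤ F.A (mid y z) ^ (1 / F.p) :=
        Real.rpow_le_rpow ha1pos.le hAa (by positivity)
      exact div_le_div_of_nonneg_left hR.le (Real.rpow_pos_of_pos ha1pos _) h1
    have hABT : F.A (mid y z) + F.B (mid y z) ≤
        F.r * (lam * F.K (mid y z)) * T ^ (F.r - F.q) := by
      have h1 : D ≤ F.r * (lam * F.K (mid y z)) := by rw [hD]; gcongr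
      have h2 := mul_le_mul_of_nonneg_right h1 (Real.rpow_nonneg hT0.le (F.r - F.q))
      linarith
    obtain ⟨t, hct, ht0, htT, htN, htA⟩ := hb.exists_smul_le hR hKpos hT1 hAT hABT
    have hc0t : c0 ≤ t := by
      refine le_trans ?_ hct.le
      exact div_le_div_of_nonneg_left hR.le (Real.rpow_pos_of_pos hApos _)
        (Real.rpow_le_rpow hApos.le hAM (by positivity))
    have hmt := hm _ ⟨htN, htA⟩
    have hy1 := (hb.minus hR hl.le (hu (φ n.1)).1 (hu (φ n.1)).2).2.2.2.1 t ht0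
    have hz1 := (hb.minus hR hl.le (hu (φ n.2)).1 (hu (φ n.2)).2).2.2.2.1 t ht0
    rw [← hydef] at hy1
    rw [← hzdef] at hz1
    have htα : t ^ F.α ≤ T ^ F.α := Real.rpow_le_rpow ht0.le htT hα.le
    have htr : t ^ F.r ≤ T ^ F.r := Real.rpow_le_rpow ht0.le htT hr.le
    have htp : c0 ^ F.p ≤ t ^ F.p := Real.rpow_le_rpow hc0pos.le hc0t hp.le
    have htq : c0 ^ F.q ≤ t ^ F.q := Real.rpow_le_rpow hc0pos.le hc0t hq.le
    have key : (F.J lam (t • y) + F.J lam (t • z)) / 2 - F.J lam (t • mid y z) =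
        t ^ F.p * (F.defectA y z / F.p) + t ^ F.q * (F.defectB y z / F.q)
        - t ^ F.α * ((F.S y + F.S z) / 2 - F.S (mid y z)) / F.α
        - lam * (t ^ F.r * ((F.K y + F.K z) / 2 - F.K (mid y z))) := by
      rw [F.J_smul ht0, F.J_smul ht0, F.J_smul ht0]
      simp only [fib, defectA, defectB]
      ring
    have e1 : c0 ^ F.p * (F.defectA y z / F.p) ≤ t ^ F.p * (F.defectA y z / F.p) :=
      mul_le_mul_of_nonneg_right htp (div_nonneg (F.defectA_nonneg _ _) hp.le)
    have e2 : c0 ^ F.q * (F.defectB y z / F.q) ≤ t ^ F.q * (F.defectB y z / F.q) :=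
      mul_le_mul_of_nonneg_right htq (div_nonneg (F.defectB_nonneg _ _) hq.le)
    have e3 : t ^ F.α * ((F.S y + F.S z) / 2 - F.S (mid y z)) / F.α ≤
        T ^ F.α * |(F.S y + F.S z) / 2 - F.S (mid y z)| / F.α := by
      refine div_le_div_of_nonneg_right ?_ hα.le
      exact (mul_le_mul_of_nonneg_left (le_abs_self _) (Real.rpow_nonneg ht0.le _)).trans
        (mul_le_mul_of_nonneg_right htα (abs_nonneg _))
    have e4 : lam * (t ^ F.r * ((F.K y + F.K z) / 2 - F.K (mid y z))) ≤
        lam * (T ^ F.r * |(F.K y + F.K z) / 2 - F.K (mid y z)|) := by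
      refine mul_le_mul_of_nonneg_left ?_ hl.le
      exact (mul_le_mul_of_nonneg_left (le_abs_self _) (Real.rpow_nonneg ht0.le _)).trans
        (mul_le_mul_of_nonneg_right htr (abs_nonneg _))
    linarith
  have hc0p := Real.rpow_pos_of_pos hc0pos F.p
  have hc0q := Real.rpow_pos_of_pos hc0pos F.q
  have hdA : Tendsto (fun n : ℕ × ℕ => F.defectA (u (φ n.1)) (u (φ n.2))) atTop (𝓝 0) := by
    refine squeeze_zero' (.of_forall fun n => F.defectA_nonneg _ _) ?_
      (by simpa using hup.const_mul (F.p / c0 ^ F.p))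
    filter_upwards [hle] with n hn
    have h2 : 0 ≤ c0 ^ F.q * (F.defectB (u (φ n.1)) (u (φ n.2)) / F.q) :=
      mul_nonneg hc0q.le (div_nonneg (F.defectB_nonneg _ _) hq.le)
    have e : F.defectA (u (φ n.1)) (u (φ n.2)) =
      F.p / c0 ^ F.p * (c0 ^ F.p * (F.defectA (u (φ n.1)) (u (φ n.2)) / F.p)) := by field_simp
    rw [e]
    exact mul_le_mul_of_nonneg_left (by linarith) (by positivity)
  have hdB : Tendsto (fun n : ℕ × ℕ => F.defectB (u (φ n.1)) (u (φ n.2))) atTop (𝓝 0) := by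
    refine squeeze_zero' (.of_forall fun n => F.defectB_nonneg _ _) ?_
      (by simpa using hup.const_mul (F.q / c0 ^ F.q))
    filter_upwards [hle] with n hn
    have h2 : 0 ≤ c0 ^ F.p * (F.defectA (u (φ n.1)) (u (φ n.2)) / F.p) :=
      mul_nonneg hc0p.le (div_nonneg (F.defectA_nonneg _ _) hp.le)
    have e : F.defectB (u (φ n.1)) (u (φ n.2)) =
      F.q / c0 ^ F.q * (c0 ^ F.q * (F.defectB (u (φ n.1)) (u (φ n.2)) / F.q)) := by field_simp
    rw [e]
    exact mul_le_mul_of_nonneg_left (by linarith) (by positivity)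
  obtain ⟨y, hyA, hyB, hyS, hyK⟩ := hstrong hdA hdB
  have hJy : F.J lam y = m := by
    refine tendsto_nhds_unique ?_ hJ1
    have := (((hyA.div_const F.p).add (hyB.div_const F.q)).sub (hs1.div_const F.α)).sub
      (hk1.const_mul lam)
    rw [← hyS, ← hyK] at this
    exact this
  have hN : F.IsNehari lam y := by
    have h1 := (hyA.add hyB).sub ((hk1.const_mul lam).const_mul F.r)
    rw [← hyK] at h1
    refine tendsto_nhds_unique h1 ?_
    rw [hyS]
    exact hs1.congr fun i => (hu (φ i)).1.symm
  -- the limit cannot lie on the barrier sphere, since no Nehari point does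
  have hAge : R ^ F.p ≤ F.A y := ge_of_tendsto' hyA fun i => (hu _).2.le
  exact ⟨y, hN, lt_of_le_of_ne hAge (hb.ne hN).symm, fun z h1 h2 => hJy ▸ hm z ⟨h1, h2⟩⟩

/-- The first order property of both minimizers: moving along a line does not lower the energy
after both points have been multiplied by a common factor close to `1`. -/
def IsLineMinimal (F : FiberedSystem V) (lam : ℝ) (y : V) : Prop :=
  ∀ h : V, ∀ δ : ℝ, 0 < δ → ∀ᶠ s : ℝ in 𝓝 0, ∃ t : ℝ, 1 - δ < t ∧ t < 1 + δ ∧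
    F.J lam (t • y) ≤ F.J lam (t • (y + s • h))

/-- A minimizer over the ball that lies in its interior; the factor is `t = 1`. -/
theorem isLineMinimal_of_ball {y : V} (hA : F.A y < R ^ F.p)
    (hmin : ∀ z, F.A z ≤ R ^ F.p → F.J lam y ≤ F.J lam z) : F.IsLineMinimal lam y := by
  intro h δ hδ
  filter_upwards [(F.tendsto_A y h).eventually_lt_const hA] with s hs
  exact ⟨1, by linarith, by linarith, by simpa using hmin _ hs.le⟩

/-- For a minimizer over the outer part of the Nehari manifold, the factor `t` is the one that takes
`y + s h` back to the Nehari manifold: the sign change of `fibSlope` at `1` persists for small `s`.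
Since `y` is the maximum of its own fibering function, `J (t y) ≤ J y ≤ J (t (y + s h))`. -/
theorem IsBarrier.isLineMinimal_outer (hb : F.IsBarrier lam R) (hR : 0 < R) (hl : 0 < lam)
    {y : V} (hN : F.IsNehari lam y) (hA : R ^ F.p < F.A y)
    (hmin : ∀ z, F.IsNehari lam z → R ^ F.p < F.A z → F.J lam y ≤ F.J lam z) :
    F.IsLineMinimal lam y := by
  intro h δ hδ
  have hp := F.p_pos
  obtain ⟨-, hright, hleft, hmax, -⟩ := hb.minus hR hl.le hN hA
  obtain ⟨ε, hε0, hεδ, hε1, hεA⟩ : ∃ ε : ℝ, 0 < ε ∧ ε < δ ∧ ε < 1 ∧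
      R ^ F.p < (1 - ε) ^ F.p * F.A y := by
    have hc : Tendsto (fun ε : ℝ => (1 - ε) ^ F.p * F.A y) (𝓝[>] 0) (𝓝 (F.A y)) := by
      have h1 : Continuous (fun ε : ℝ => (1 - ε) ^ F.p * F.A y) :=
        ((Real.continuous_rpow_const hp.le).comp (continuous_const.sub continuous_id)).mul
          continuous_const
      have h2 := h1.tendsto 0
      simp only [sub_zero, Real.one_rpow, one_mul] at h2
      exact h2.mono_left nhdsWithin_le_nhds
    have hd : ∀ᶠ ε : ℝ in 𝓝[>] 0, ε < min δ 1 :=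
      (eventually_lt_nhds (lt_min hδ one_pos)).filter_mono nhdsWithin_le_nhds
    obtain ⟨ε, h1, h2, h3⟩ := ((hc.eventually_const_lt hA).and
      (hd.and self_mem_nhdsWithin)).exists
    exact ⟨ε, h3, h2.trans_le (min_le_left _ _), h2.trans_le (min_le_right _ _), h1⟩
  have hslope : ∀ t : ℝ, Tendsto (fun s : ℝ => fibSlope F.p F.q F.α F.r (F.A (y + s • h))
      (F.B (y + s • h)) (lam * F.K (y + s • h)) t - F.S (y + s • h)) (𝓝 0)
      (𝓝 (fibSlope F.p F.q F.α F.r (F.A y) (F.B y) (lam * F.K y) t - F.S y)) := fun t =>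
    ((((F.tendsto_A y h).mul_const _).add ((F.tendsto_B y h).mul_const _)).sub
      ((((F.tendsto_K y h).const_mul lam).const_mul F.r).mul_const _)).sub (F.tendsto_S y h)
  have h1 := hleft (1 - ε) (by linarith) hεA.le (by linarith)
  have h2 := hright (1 + ε) (by linarith)
  filter_upwards [(hslope (1 - ε)).eventually_const_lt (sub_pos.2 h1),
    (hslope (1 + ε)).eventually_lt_const (sub_neg.2 h2),
    ((F.tendsto_A y h).const_mul ((1 - ε) ^ F.p)).eventually_const_lt hεA] with s hs1 hs2 hs3
  have hcont := (continuous_fibSlope (A := F.A (y + s • h)) (B := F.B (y + s • h))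
    (L := lam * F.K (y + s • h)) (α := F.α) (p := F.p) (q := F.q)
    (r := F.r) F.α_lt_p (F.α_lt_p.trans F.p_lt_q)
    ((F.α_lt_p.trans F.p_lt_q).trans F.q_lt_r)).continuousOn (s := Icc (1 - ε) (1 + ε))
  obtain ⟨t, ht, htS⟩ := intermediate_value_Icc' (by linarith) hcont
    (show F.S (y + s • h) ∈ Icc _ _ from ⟨by linarith, by linarith⟩)
  have ht0 : 0 < t := by linarith [ht.1]
  refine ⟨t, by linarith [ht.1], by linarith [ht.2], ?_⟩
  refine (hmax t ht0).trans (hmin _ ((F.isNehari_smul_iff ht0 _).2 htS) ?_)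
  rw [F.A_smul t _ ht0]
  have h3 : (1 - ε) ^ F.p ≤ t ^ F.p := Real.rpow_le_rpow (by linarith) ht.1 hp.le
  exact hs3.trans_le (mul_le_mul_of_nonneg_right h3 (F.A_nonneg _))

theorem J_abs_le {t : ℝ} (ht : 0 < t) (y : V) :
    F.J lam (t • F.absV y) ≤ F.J lam (t • y) := by
  have h1 := F.A_abs y
  have h2 := F.B_abs y
  have := F.p_pos; have := F.q_pos
  rw [F.J_smul ht, F.J_smul ht, fib, fib, F.S_abs, F.K_abs]
  gcongr

/-- For small parameters there are a nonnegative inner and a nonnegative outer minimizer. -/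
theorem IsBarrier.exists_minimizers (hb : F.IsBarrier lam R) (hR : 0 < R) (hl : 0 < lam) :
    (∃ y, F.IsNehari lam (F.absV y) ∧ 0 < F.S (F.absV y) ∧ F.A (F.absV y) < R ^ F.p ∧
      F.IsLineMinimal lam (F.absV y) ∧
      ∀ z, F.A z ≤ R ^ F.p → F.J lam (F.absV y) ≤ F.J lam z) ∧
    (∃ (t : ℝ) (y : V), 0 < t ∧ F.IsNehari lam (t • F.absV y) ∧
      0 < F.K (t • F.absV y) ∧ R ^ F.p < F.A (t • F.absV y) ∧
      F.IsLineMinimal lam (t • F.absV y) ∧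
      ∀ z, F.IsNehari lam z → R ^ F.p < F.A z → F.J lam (t • F.absV y) ≤ F.J lam z) := by
  have hKpos : ∀ z, F.IsNehari lam z → R ^ F.p < F.A z → 0 < F.K z := fun z hz hA => by
    have h1 := (hb.minus hR hl.le hz hA).1
    have h2 : 0 < (F.p - F.α) * F.A z :=
      mul_pos (by linarith [F.α_lt_p]) ((Real.rpow_pos_of_pos hR _).trans hA)
    have h3 : 0 ≤ (F.q - F.α) * F.B z :=
      mul_nonneg (by linarith [F.α_lt_p, F.p_lt_q]) (F.B_nonneg _)
    have h4 : 0 < F.r * (F.r - F.α) * (lam * F.K z) := by linarith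
    have h5 : 0 < F.r * (F.r - F.α) :=
      mul_pos F.r_pos (by linarith [F.α_lt_p, F.p_lt_q, F.q_lt_r])
    exact pos_of_mul_pos_right (pos_of_mul_pos_right h4 h5.le) hl.le
  constructor
  · obtain ⟨y, hyA, hyJ, hmin⟩ := exists_ball_minimizer (F := F) hR hl
    have hle : F.J lam (F.absV y) ≤ F.J lam y := by
      simpa using J_abs_le (F := F) one_pos y
    have hmin' : ∀ z, F.A z ≤ R ^ F.p → F.J lam (F.absV y) ≤ F.J lam z :=
      fun z hz => hle.trans (hmin z hz)
    have hA : F.A (F.absV y) < R ^ F.p := by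
      refine lt_of_le_of_ne ((F.A_abs y).trans hyA) fun h => ?_
      have := (hb _ h).2
      linarith
    have hS : 0 < F.S (F.absV y) := by
      refine lt_of_le_of_ne (F.S_nonneg _) fun h => ?_
      have hK : F.K (F.absV y) = 0 := by
        refine le_antisymm ?_ (F.K_nonneg _)
        by_contra! hh
        exact (F.S_pos_of_K_pos _ hh).ne h
      have : 0 ≤ F.J lam (F.absV y) := by
        rw [J, ← h, hK]
        have h1 := div_nonneg (F.A_nonneg (F.absV y)) F.p_pos.le
        have h2 := div_nonneg (F.B_nonneg (F.absV y)) F.q_pos.le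
        simp only [zero_div, mul_zero, sub_zero]
        linarith
      linarith
    refine ⟨y, ?_, hS, hA, isLineMinimal_of_ball hA hmin', hmin'⟩
    -- the fibering function has an interior minimum at `t = 1`
    have hloc : IsLocalMin (fib F.p F.q F.α F.r (F.A (F.absV y)) (F.B (F.absV y))
        (F.S (F.absV y)) (lam * F.K (F.absV y))) 1 := by
      have hc : Tendsto (fun t : ℝ => t ^ F.p * F.A (F.absV y)) (𝓝 1) (𝓝 (F.A (F.absV y))) := by
        have h1 : Continuous (fun t : ℝ => t ^ F.p * F.A (F.absV y)) :=
          (Real.continuous_rpow_const F.p_pos.le).mul continuous_const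
        simpa using h1.tendsto 1
      filter_upwards [hc.eventually_lt_const hA, eventually_gt_nhds zero_lt_one] with t ht ht0
      rw [← F.J_smul ht0, ← F.J_smul one_pos, one_smul]
      exact hmin' _ (by rw [F.A_smul t _ ht0]; exact ht.le)
    have hd := hloc.hasDerivAt_eq_zero (hasDerivAt_fib F.p_pos F.q_pos F.α_pos one_pos)
    rw [Real.one_rpow, one_mul, fibSlope_one] at hd
    rw [IsNehari]
    linarith
  · obtain ⟨y, hN, hA, hmin⟩ := hb.exists_outer_minimizer hR hl
    have hK := hKpos y hN hA
    rw [← F.K_abs] at hK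
    obtain ⟨t, ht, htN, htA⟩ := hb.exists_smul hR hl hK
    have hle : F.J lam (t • F.absV y) ≤ F.J lam y :=
      (J_abs_le (F := F) ht y).trans ((hb.minus hR hl.le hN hA).2.2.2.1 t ht)
    have hmin' : ∀ z, F.IsNehari lam z → R ^ F.p < F.A z → F.J lam (t • F.absV y) ≤ F.J lam z :=
      fun z h1 h2 => hle.trans (hmin z h1 h2)
    exact ⟨t, y, ht, htN, hKpos _ htN htA, htA, hb.isLineMinimal_outer hR hl htN htA hmin',
      hmin'⟩

end FiberedSystem

/-! ### Homogeneous inequalities and integrals -/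

/-- If `F` and `G ≥ 0` are continuous and homogeneous of degree `d` and `F ≤ 0` on the zero set
of `G`, then `F` is bounded by `G` up to an arbitrarily small multiple of the norm: on the unit
sphere, `G` is bounded below where `F ≥ ε`. -/
theorem exists_homogeneous_bound {H : Type*} [NormedAddCommGroup H] [NormedSpace ℝ H]
    [ProperSpace H] {d : ℝ} (hd : 0 < d) {F G : H → ℝ} (hF : Continuous F) (hG : Continuous G)
    (hFd : ∀ (t : ℝ) x, 0 < t → F (t • x) = t ^ d * F x)
    (hGd : ∀ (t : ℝ) x, 0 < t → G (t • x) = t ^ d * G x)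
    (hG0 : ∀ x, 0 ≤ G x) (hFG : ∀ x, G x = 0 → F x ≤ 0) {ε : ℝ} (hε : 0 < ε) :
    ∃ C : ℝ, 0 ≤ C ∧ ∀ x, F x ≤ ε * ‖x‖ ^ d + C * G x := by
  have hcomp : IsCompact (Metric.sphere (0 : H) 1 ∩ {x | ε ≤ F x}) :=
    (isCompact_sphere 0 1).inter_right (isClosed_le continuous_const hF)
  obtain ⟨C, hC0, hC⟩ : ∃ C : ℝ, 0 ≤ C ∧ ∀ x ∈ Metric.sphere (0 : H) 1, F x ≤ ε + C * G x := by
    rcases (Metric.sphere (0 : H) 1 ∩ {x | ε ≤ F x}).eq_empty_or_nonempty with he | hne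
    · refine ⟨0, le_rfl, fun x hx => ?_⟩
      by_contra! h
      have : x ∈ Metric.sphere (0 : H) 1 ∩ {x | ε ≤ F x} := ⟨hx, by
        simp only [zero_mul, add_zero] at h; exact h.le⟩
      rw [he] at this
      exact this
    · obtain ⟨x0, hx0, hmin⟩ := hcomp.exists_isMinOn hne hG.continuousOn
      obtain ⟨x1, hx1, hmax⟩ := hcomp.exists_isMaxOn hne hF.continuousOn
      have hpos : 0 < G x0 := lt_of_le_of_ne (hG0 x0) fun h => by
        have h1 := hFG x0 h.symm
        have h2 : ε ≤ F x0 := hx0.2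
        linarith
      have hF1 : 0 < F x1 := hε.trans_le hx1.2
      refine ⟨F x1 / G x0, (div_pos hF1 hpos).le, fun x hx => ?_⟩
      by_cases h : ε ≤ F x
      · have h1 : F x ≤ F x1 := hmax ⟨hx, h⟩
        have h2 : G x0 ≤ G x := hmin ⟨hx, h⟩
        have h3 : F x1 ≤ F x1 / G x0 * G x := by
          rw [div_mul_eq_mul_div, le_div_iff₀ hpos]
          exact mul_le_mul_of_nonneg_left h2 hF1.le
        linarith
      · have := mul_nonneg (div_pos hF1 hpos).le (hG0 x)
        linarith [not_le.1 h]
  refine ⟨C, hC0, fun x => ?_⟩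
  rcases eq_or_ne x 0 with rfl | hx
  · have hG00 : G 0 = 0 := by
      have h := hGd 2 0 two_pos
      rw [smul_zero] at h
      have : (1 : ℝ) < 2 ^ d := Real.one_lt_rpow one_lt_two hd
      by_contra hne
      have := mul_right_cancel₀ hne ((one_mul _).trans h)
      linarith
    have := hFG 0 hG00
    rw [hG00, norm_zero, Real.zero_rpow hd.ne']
    linarith
  · have hn : 0 < ‖x‖ := norm_pos_iff.2 hx
    have hu : ‖x‖⁻¹ • x ∈ Metric.sphere (0 : H) 1 := by
      rw [mem_sphere_zero_iff_norm, norm_smul, norm_inv, norm_norm, inv_mul_cancel₀ hn.ne']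
    have h := mul_le_mul_of_nonneg_left (hC _ hu) (Real.rpow_nonneg hn.le d)
    have e : x = ‖x‖ • (‖x‖⁻¹ • x) := by rw [smul_smul, mul_inv_cancel₀ hn.ne', one_smul]
    calc F x = ‖x‖ ^ d * F (‖x‖⁻¹ • x) := by
          conv_lhs => rw [e]
          exact hFd _ _ hn
      _ ≤ _ := h
      _ = ε * ‖x‖ ^ d + C * (‖x‖ ^ d * G (‖x‖⁻¹ • x)) := by ring
      _ = ε * ‖x‖ ^ d + C * G x := by rw [← hGd _ _ hn, ← e]

section Integrals

variable {X : Type*} [MeasurableSpace X] {m : Measure X}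

theorem integrable_comp_homogeneous {H : Type*} [NormedAddCommGroup H] [NormedSpace ℝ H]
    [ProperSpace H] {d : ℝ} (hd : 0 < d) {F : H → ℝ} (hF : Continuous F)
    (hFd : ∀ (t : ℝ) x, 0 < t → F (t • x) = t ^ d * F x) {f : X → H}
    (hf : AEStronglyMeasurable f m) (hfi : Integrable (fun x => ‖f x‖ ^ d) m) :
    Integrable (fun x => F (f x)) m := by
  have hn : ∀ (t : ℝ) (x : H), 0 < t → ‖t • x‖ ^ d = t ^ d * ‖x‖ ^ d := fun t x ht => by
    rw [norm_smul, Real.norm_of_nonneg ht.le, Real.mul_rpow ht.le (norm_nonneg _)]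
  obtain ⟨C, hC0, hC⟩ := exists_homogeneous_bound hd hF.abs
    (continuous_norm.rpow_const fun _ => Or.inr hd.le)
    (fun t x ht => by
      rw [hFd t x ht, abs_mul, abs_of_pos (Real.rpow_pos_of_pos ht d)]) hn
    (fun x => Real.rpow_nonneg (norm_nonneg x) d) (fun x hx => by
      have h0 : ‖x‖ = 0 := by
        by_contra h
        exact (Real.rpow_pos_of_pos (lt_of_le_of_ne (norm_nonneg x) (Ne.symm h)) d).ne' hx
      rw [norm_eq_zero] at h0
      subst h0
      have h := hFd 2 0 two_pos
      rw [smul_zero] at h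
      have : (1 : ℝ) < 2 ^ d := Real.one_lt_rpow one_lt_two hd
      have : F 0 = 0 := by
        by_contra hne
        have := mul_right_cancel₀ hne ((one_mul _).trans h)
        linarith
      simp [this]) one_pos
  refine (hfi.const_mul (1 + C)).mono' (hF.comp_aestronglyMeasurable hf) (.of_forall fun x => ?_)
  rw [Real.norm_eq_abs]
  linarith [hC (f x)]

/-- The integrated form of `exists_homogeneous_bound`. -/
theorem tendsto_integral_homogeneous {ι : Type*} {l : Filter ι} {H : Type*}
    [NormedAddCommGroup H] [NormedSpace ℝ H]
    [ProperSpace H] {d : ℝ} (hd : 0 < d) {F G : H → ℝ} (hF : Continuous F) (hG : Continuous G)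
    (hFd : ∀ (t : ℝ) x, 0 < t → F (t • x) = t ^ d * F x)
    (hGd : ∀ (t : ℝ) x, 0 < t → G (t • x) = t ^ d * G x)
    (hF0 : ∀ x, 0 ≤ F x)
    (hG0 : ∀ x, 0 ≤ G x) (hFG : ∀ x, G x = 0 → F x ≤ 0) {f : ι → X → H}
    (hf : ∀ i, AEStronglyMeasurable (f i) m) (hfi : ∀ i, Integrable (fun x => ‖f i x‖ ^ d) m)
    {M : ℝ} (hM : ∀ᶠ i in l, ∫ x, ‖f i x‖ ^ d ∂m ≤ M)
    (hlim : Tendsto (fun i => ∫ x, G (f i x) ∂m) l (𝓝 0)) :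
    Tendsto (fun i => ∫ x, F (f i x) ∂m) l (𝓝 0) := by
  refine Metric.tendsto_nhds.2 fun ε hε => ?_
  have hM0 : 0 < |M| + 1 := by positivity
  obtain ⟨C, hC0, hC⟩ := exists_homogeneous_bound hd hF hG hFd hGd hG0 hFG
    (show 0 < ε / 2 / (|M| + 1) by positivity)
  have h2 : Tendsto (fun i => C * ∫ x, G (f i x) ∂m) l (𝓝 0) := by
    simpa using hlim.const_mul C
  filter_upwards [hM, h2.eventually_lt_const (half_pos hε)] with i hi hi2
  have hFi := integrable_comp_homogeneous hd hF hFd (hf i) (hfi i)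
  have hGi := integrable_comp_homogeneous hd hG hGd (hf i) (hfi i)
  have h1 : ∫ x, F (f i x) ∂m ≤ ε / 2 / (|M| + 1) * ∫ x, ‖f i x‖ ^ d ∂m
      + C * ∫ x, G (f i x) ∂m := by
    rw [← integral_const_mul, ← integral_const_mul, ← integral_add ((hfi i).const_mul _)
      (hGi.const_mul _)]
    exact integral_mono hFi (((hfi i).const_mul _).add (hGi.const_mul _)) fun x => hC _
  have h3 : ε / 2 / (|M| + 1) * ∫ x, ‖f i x‖ ^ d ∂m ≤ ε / 2 := by
    calc _ ≤ ε / 2 / (|M| + 1) * (|M| + 1) := by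
          refine mul_le_mul_of_nonneg_left ?_ (by positivity)
          linarith [le_abs_self M]
      _ = ε / 2 := div_mul_cancel₀ _ hM0.ne'
  have h0 : 0 ≤ ∫ x, F (f i x) ∂m := integral_nonneg fun x => hF0 _
  rw [Real.dist_eq, sub_zero, abs_of_nonneg h0]
  linarith

variable {H : Type*} [NormedAddCommGroup H]

theorem integrable_norm_rpow' {p : ℝ} (hp : 0 < p) {f : X → H}
    (hf : MemLp f (ENNReal.ofReal p) m) : Integrable (fun x => ‖f x‖ ^ p) m := by
  have := hf.integrable_norm_rpow (ENNReal.ofReal_pos.2 hp).ne' ENNReal.ofReal_ne_top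
  rwa [ENNReal.toReal_ofReal hp.le] at this

theorem integral_norm_rpow_eq {p : ℝ} (hp : 0 < p) {f : X → H}
    (hf : MemLp f (ENNReal.ofReal p) m) :
    ∫ x, ‖f x‖ ^ p ∂m = (eLpNorm f (ENNReal.ofReal p) m).toReal ^ p := by
  have h0 : 0 ≤ ∫ x, ‖f x‖ ^ p ∂m :=
    integral_nonneg fun x => Real.rpow_nonneg (norm_nonneg _) _
  rw [hf.eLpNorm_eq_integral_rpow_norm (ENNReal.ofReal_pos.2 hp).ne' ENNReal.ofReal_ne_top,
    ENNReal.toReal_ofReal hp.le, ENNReal.toReal_ofReal (Real.rpow_nonneg h0 _),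
    ← Real.rpow_mul h0, inv_mul_cancel₀ hp.ne', Real.rpow_one]

theorem tendsto_eLpNorm_zero_iff {ι : Type*} {l : Filter ι} {p : ℝ} (hp : 0 < p)
    {f : ι → X → H} (hf : ∀ i, MemLp (f i) (ENNReal.ofReal p) m) :
    Tendsto (fun i => eLpNorm (f i) (ENNReal.ofReal p) m) l (𝓝 0) ↔
      Tendsto (fun i => ∫ x, ‖f i x‖ ^ p ∂m) l (𝓝 0) := by
  have e : ∀ i, ∫ x, ‖f i x‖ ^ p ∂m = (eLpNorm (f i) (ENNReal.ofReal p) m).toReal ^ p :=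
    fun i => integral_norm_rpow_eq hp (hf i)
  have hz : Tendsto (fun i => eLpNorm (f i) (ENNReal.ofReal p) m) l (𝓝 0) ↔
      Tendsto (fun i => (eLpNorm (f i) (ENNReal.ofReal p) m).toReal) l (𝓝 0) := by
    have := ENNReal.tendsto_toReal_iff (x := 0) (fi := l) (f := fun i =>
      eLpNorm (f i) (ENNReal.ofReal p) m) (fun i => (hf i).2.ne) ENNReal.zero_ne_top
    simpa using this.symm
  rw [hz]
  simp_rw [e]
  constructor
  · intro h
    have := h.rpow_const (p := p) (Or.inr hp.le)
    rwa [Real.zero_rpow hp.ne'] at this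
  · intro h
    have := h.rpow_const (p := p⁻¹) (Or.inr (inv_pos.2 hp).le)
    rw [Real.zero_rpow (inv_pos.2 hp).ne'] at this
    refine this.congr fun i => ?_
    rw [← Real.rpow_mul ENNReal.toReal_nonneg, mul_inv_cancel₀ hp.ne', Real.rpow_one]

theorem tendsto_eLpNorm_of_exponent_le [IsFiniteMeasure m] {ι : Type*} {l : Filter ι}
    {p q : ENNReal} (hpq : p ≤ q) (hp : p ≠ 0) (hq : q ≠ ⊤) {f : ι → X → H}
    (hf : ∀ i, AEStronglyMeasurable (f i) m)
    (h : Tendsto (fun i => eLpNorm (f i) q m) l (𝓝 0)) :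
    Tendsto (fun i => eLpNorm (f i) p m) l (𝓝 0) := by
  have hc : m univ ^ (1 / p.toReal - 1 / q.toReal) ≠ ⊤ := by
    refine ENNReal.rpow_ne_top_of_nonneg ?_ (measure_ne_top _ _)
    have hp' : p ≠ ⊤ := (hpq.trans_lt hq.lt_top).ne
    have h1 : 0 < p.toReal := ENNReal.toReal_pos hp hp'
    exact sub_nonneg.2 (one_div_le_one_div_of_le h1 (ENNReal.toReal_mono hq hpq))
  have h2 := ENNReal.Tendsto.mul_const h (Or.inr hc)
  rw [zero_mul] at h2
  exact tendsto_of_tendsto_of_tendsto_of_le_of_le tendsto_const_nhds h2 (fun _ => zero_le)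
    fun i => eLpNorm_le_eLpNorm_mul_rpow_measure_univ hpq (hf i)

theorem tendsto_integral_norm_rpow {ι : Type*} {l : Filter ι} {p : ℝ} (hp : 1 ≤ p)
    {f : ι → X → H} {g : X → H} (hf : ∀ i, MemLp (f i) (ENNReal.ofReal p) m)
    (hg : MemLp g (ENNReal.ofReal p) m)
    (h : Tendsto (fun i => eLpNorm (f i - g) (ENNReal.ofReal p) m) l (𝓝 0)) :
    Tendsto (fun i => ∫ x, ‖f i x‖ ^ p ∂m) l (𝓝 (∫ x, ‖g x‖ ^ p ∂m)) := by
  have : Fact (1 ≤ ENNReal.ofReal p) := ⟨by rwa [ENNReal.one_le_ofReal]⟩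
  have h1 := ((Lp.tendsto_Lp_iff_tendsto_eLpNorm'' f hf g hg).2 h).norm
  simp only [Lp.norm_toLp] at h1
  have h2 := h1.rpow_const (p := p) (Or.inr (by linarith))
  rw [integral_norm_rpow_eq (by linarith) hg]
  refine h2.congr fun i => ?_
  rw [integral_norm_rpow_eq (by linarith) (hf i)]

theorem norm_prod_rpow_le {H' : Type*} [NormedAddCommGroup H'] {d : ℝ} (v : H) (w : H') :
    ‖(v, w)‖ ^ d ≤ ‖v‖ ^ d + ‖w‖ ^ d := by
  have h1 := Real.rpow_nonneg (norm_nonneg v) d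
  have h2 := Real.rpow_nonneg (norm_nonneg w) d
  rw [Prod.norm_def]
  rcases max_cases ‖v‖ ‖w‖ with ⟨h, -⟩ | ⟨h, -⟩ <;> rw [h] <;> linarith

theorem integrable_norm_prod_rpow {H' : Type*} [NormedAddCommGroup H'] {p : ℝ} (hp : 0 < p)
    {f : X → H} {g : X → H'} (hf : MemLp f (ENNReal.ofReal p) m)
    (hg : MemLp g (ENNReal.ofReal p) m) : Integrable (fun x => ‖(f x, g x)‖ ^ p) m := by
  refine ((integrable_norm_rpow' hp hf).add (integrable_norm_rpow' hp hg)).mono' ?_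
    (.of_forall fun x => ?_)
  · exact (continuous_norm.rpow_const fun _ => Or.inr hp.le).comp_aestronglyMeasurable
      (hf.1.prodMk hg.1)
  · rw [Real.norm_of_nonneg (Real.rpow_nonneg (norm_nonneg _) _)]
    exact norm_prod_rpow_le _ _

theorem integral_norm_prod_rpow_le {H' : Type*} [NormedAddCommGroup H'] {p : ℝ} (hp : 0 < p)
    {f : X → H} {g : X → H'} (hf : MemLp f (ENNReal.ofReal p) m)
    (hg : MemLp g (ENNReal.ofReal p) m) :
    ∫ x, ‖(f x, g x)‖ ^ p ∂m ≤ ∫ x, ‖f x‖ ^ p ∂m + ∫ x, ‖g x‖ ^ p ∂m := by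
  rw [← integral_add (integrable_norm_rpow' hp hf) (integrable_norm_rpow' hp hg)]
  exact integral_mono (integrable_norm_prod_rpow hp hf hg)
    ((integrable_norm_rpow' hp hf).add (integrable_norm_rpow' hp hg))
    fun x => norm_prod_rpow_le _ _

theorem norm_mid_rpow_le [NormedSpace ℝ H] {p : ℝ} (hp : 1 ≤ p) (v w : H) :
    ‖(1 / 2 : ℝ) • (v + w)‖ ^ p ≤ (‖v‖ ^ p + ‖w‖ ^ p) / 2 := by
  have h1 : ‖(1 / 2 : ℝ) • (v + w)‖ ≤ (1 / 2) * ‖v‖ + (1 / 2) * ‖w‖ := by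
    rw [norm_smul, Real.norm_of_nonneg (by norm_num)]
    linarith [norm_add_le v w]
  have h2 := (convexOn_rpow hp).2 (norm_nonneg v) (norm_nonneg w)
    (show (0 : ℝ) ≤ 1 / 2 by norm_num) (show (0 : ℝ) ≤ 1 / 2 by norm_num) (by norm_num)
  simp only [smul_eq_mul] at h2
  have h3 := Real.rpow_le_rpow (norm_nonneg _) h1 (by linarith : 0 ≤ p)
  linarith

/-- Strict convexity of `‖·‖^p`. -/
theorem eq_of_norm_mid_rpow_eq [NormedSpace ℝ H] [StrictConvexSpace ℝ H] {p : ℝ} (hp : 1 < p)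
    {v w : H} (h : (‖v‖ ^ p + ‖w‖ ^ p) / 2 - ‖(1 / 2 : ℝ) • (v + w)‖ ^ p = 0) : v = w := by
  have h0 : ‖(1 / 2 : ℝ) • (v + w)‖ = (1 / 2) * ‖v + w‖ := by
    rw [norm_smul, Real.norm_of_nonneg (by norm_num)]
  have h1 : (1 / 2) * ‖v + w‖ ≤ (1 / 2) * ‖v‖ + (1 / 2) * ‖w‖ := by
    linarith [norm_add_le v w]
  have h3 := Real.rpow_le_rpow (by positivity) h1 (by linarith : 0 ≤ p)
  rw [h0] at h
  have hvw : ‖v‖ = ‖w‖ := by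
    by_contra hne
    have h2 := (strictConvexOn_rpow hp).2 (norm_nonneg v) (norm_nonneg w) hne
      (show (0 : ℝ) < 1 / 2 by norm_num) (show (0 : ℝ) < 1 / 2 by norm_num) (by norm_num)
    simp only [smul_eq_mul] at h2
    linarith
  refine eq_of_norm_eq_of_norm_add_eq hvw (le_antisymm (norm_add_le _ _) ?_)
  by_contra! hlt
  have h4 : (1 / 2) * ‖v + w‖ < ‖v‖ := by linarith
  have h5 := Real.rpow_lt_rpow (by positivity) h4 (by linarith : 0 < p)
  rw [← hvw] at h
  linarith

/-- Uniform convexity of `L^p` norms in the form used here: pairs whose convexity defects tend to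
zero approach each other. -/
theorem tendsto_eLpNorm_sub_of_defect [NormedSpace ℝ H] [StrictConvexSpace ℝ H] [ProperSpace H]
    {ι : Type*} {l : Filter ι} {p : ℝ} (hp : 1 < p)
    {f g : ι → X → H} (hf : ∀ i, MemLp (f i) (ENNReal.ofReal p) m)
    (hg : ∀ i, MemLp (g i) (ENNReal.ofReal p) m) {M : ℝ}
    (hfM : ∀ i, ∫ x, ‖f i x‖ ^ p ∂m ≤ M) (hgM : ∀ i, ∫ x, ‖g i x‖ ^ p ∂m ≤ M)
    (h : Tendsto (fun i => (∫ x, ‖f i x‖ ^ p ∂m + ∫ x, ‖g i x‖ ^ p ∂m) / 2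
      - ∫ x, ‖(1 / 2 : ℝ) • (f i x + g i x)‖ ^ p ∂m) l (𝓝 0)) :
    Tendsto (fun i => eLpNorm (f i - g i) (ENNReal.ofReal p) m) l (𝓝 0) := by
  have hp0 : 0 < p := by linarith
  have hn : ∀ (t : ℝ) (x : H), 0 < t → ‖t • x‖ ^ p = t ^ p * ‖x‖ ^ p := fun t x ht => by
    rw [norm_smul, Real.norm_of_nonneg ht.le, Real.mul_rpow ht.le (norm_nonneg _)]
  have hcont : Continuous (fun x : H => ‖x‖ ^ p) :=
    continuous_norm.rpow_const fun _ => Or.inr hp0.le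
  rw [tendsto_eLpNorm_zero_iff hp0 fun i => (hf i).sub (hg i)]
  refine tendsto_integral_homogeneous (H := H × H) hp0 (f := fun i x => (f i x, g i x))
    (F := fun z => ‖z.1 - z.2‖ ^ p)
    (G := fun z => (‖z.1‖ ^ p + ‖z.2‖ ^ p) / 2 - ‖(1 / 2 : ℝ) • (z.1 + z.2)‖ ^ p)
    (hcont.comp (continuous_fst.sub continuous_snd)) ?_ ?_ ?_
    (fun z => Real.rpow_nonneg (norm_nonneg _) _)
    (fun z => sub_nonneg.2 (norm_mid_rpow_le hp.le _ _)) ?_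
    (fun i => (hf i).1.prodMk (hg i).1)
    (fun i => integrable_norm_prod_rpow hp0 (hf i) (hg i)) (M := M + M)
    (.of_forall fun i => (integral_norm_prod_rpow_le hp0 (hf i) (hg i)).trans
      (add_le_add (hfM i) (hgM i))) ?_
  · exact (((hcont.comp continuous_fst).add (hcont.comp continuous_snd)).div_const 2).sub
      (hcont.comp ((continuous_fst.add continuous_snd).const_smul _))
  · intro t z ht
    rw [Prod.smul_fst, Prod.smul_snd, ← smul_sub, hn _ _ ht]
  · intro t z ht
    have e : (1 / 2 : ℝ) • (t • z.1 + t • z.2) = t • ((1 / 2 : ℝ) • (z.1 + z.2)) := by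
      rw [← smul_add, smul_comm]
    rw [Prod.smul_fst, Prod.smul_snd, e, hn _ _ ht, hn _ _ ht, hn _ _ ht]
    ring
  · intro z hz
    rw [eq_of_norm_mid_rpow_eq hp hz, sub_self, norm_zero, Real.zero_rpow hp0.ne']
  · refine h.congr fun i => ?_
    have h1 := integrable_norm_rpow' hp0 (hf i)
    have h2 := integrable_norm_rpow' hp0 (hg i)
    have h3 := integrable_norm_rpow' hp0 (((hf i).add (hg i)).const_smul (1 / 2 : ℝ))
    symm
    refine (integral_sub ((h1.add h2).div_const 2) h3).trans ?_
    have h4 : ∫ x, ((fun x => ‖f i x‖ ^ p) + fun x => ‖g i x‖ ^ p) x / 2 ∂m =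
        (∫ x, ‖f i x‖ ^ p ∂m + ∫ x, ‖g i x‖ ^ p ∂m) / 2 := by
      rw [integral_div]
      exact congrArg (· / 2) (integral_add h1 h2)
    rw [h4]
    rfl

/-- Continuity on `L^(a+b)` of the coupling functional `∫ |u|^a |v|^b`. -/
theorem tendsto_integral_coupling {ι : Type*} {l : Filter ι} {a b : ℝ} (ha : 0 < a) (hb : 0 < b)
    (hab : 1 ≤ a + b) {f g : ι → X → ℝ} {u v : X → ℝ}
    (hf : ∀ i, MemLp (f i) (ENNReal.ofReal (a + b)) m)
    (hg : ∀ i, MemLp (g i) (ENNReal.ofReal (a + b)) m)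
    (hu : MemLp u (ENNReal.ofReal (a + b)) m) (hv : MemLp v (ENNReal.ofReal (a + b)) m)
    (hfu : Tendsto (fun i => eLpNorm (f i - u) (ENNReal.ofReal (a + b)) m) l (𝓝 0))
    (hgv : Tendsto (fun i => eLpNorm (g i - v) (ENNReal.ofReal (a + b)) m) l (𝓝 0)) :
    (∀ i, Integrable (fun x => |f i x| ^ a * |g i x| ^ b) m) ∧
    Integrable (fun x => |u x| ^ a * |v x| ^ b) m ∧
    Tendsto (fun i => ∫ x, |f i x| ^ a * |g i x| ^ b ∂m) l
      (𝓝 (∫ x, |u x| ^ a * |v x| ^ b ∂m)) := by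
  have hr : 0 < a + b := by linarith
  have hd : ∀ (t x y : ℝ), 0 < t → |t * x| ^ a * |t * y| ^ b = t ^ (a + b) * (|x| ^ a * |y| ^ b) :=
    fun t x y ht => by
      rw [abs_mul, abs_mul, abs_of_pos ht, Real.mul_rpow ht.le (abs_nonneg _),
        Real.mul_rpow ht.le (abs_nonneg _), Real.rpow_add ht]
      ring
  have hc : Continuous (fun z : ℝ × ℝ => |z.1| ^ a * |z.2| ^ b) :=
    (continuous_fst.abs.rpow_const fun _ => Or.inr ha.le).mul
      (continuous_snd.abs.rpow_const fun _ => Or.inr hb.le)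
  have hint : ∀ {f g : X → ℝ}, MemLp f (ENNReal.ofReal (a + b)) m →
      MemLp g (ENNReal.ofReal (a + b)) m → Integrable (fun x => |f x| ^ a * |g x| ^ b) m :=
    fun {f g} hf hg => integrable_comp_homogeneous (H := ℝ × ℝ) hr hc
      (fun t z ht => by simpa using hd t z.1 z.2 ht) (hf.1.prodMk hg.1)
      (integrable_norm_prod_rpow hr hf hg)
  refine ⟨fun i => hint (hf i) (hg i), hint hu hv, ?_⟩
  have hn : ∀ (t : ℝ) (x y : ℝ), 0 < t → |t * x - t * y| ^ (a + b)
      = t ^ (a + b) * |x - y| ^ (a + b) := fun t x y ht => by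
    rw [← mul_sub, abs_mul, abs_of_pos ht, Real.mul_rpow ht.le (abs_nonneg _)]
  have hcn : Continuous (fun x : ℝ => |x| ^ (a + b)) :=
    continuous_abs.rpow_const fun _ => Or.inr hr.le
  have key := tendsto_integral_homogeneous (m := m) (l := l) (H := (ℝ × ℝ) × (ℝ × ℝ)) hr
    (f := fun i x => ((f i x, g i x), (u x, v x)))
    (F := fun z => |(|z.1.1| ^ a * |z.1.2| ^ b - |z.2.1| ^ a * |z.2.2| ^ b)|)
    (G := fun z => |z.1.1 - z.2.1| ^ (a + b) + |z.1.2 - z.2.2| ^ (a + b))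
    (M := (∫ x, |u x| ^ (a + b) ∂m + 1) + (∫ x, |v x| ^ (a + b) ∂m + 1)
      + ∫ x, ‖(u x, v x)‖ ^ (a + b) ∂m)
    ((hc.comp continuous_fst).sub (hc.comp continuous_snd)).abs
    ((hcn.comp ((continuous_fst.comp continuous_fst).sub
      (continuous_fst.comp continuous_snd))).add
      (hcn.comp ((continuous_snd.comp continuous_fst).sub
      (continuous_snd.comp continuous_snd))))
    (fun t z ht => by
      simp only [Prod.smul_fst, Prod.smul_snd, smul_eq_mul]
      rw [hd _ _ _ ht, hd _ _ _ ht, ← mul_sub, abs_mul, abs_of_pos (Real.rpow_pos_of_pos ht _)])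
    (fun t z ht => by
      simp only [Prod.smul_fst, Prod.smul_snd, smul_eq_mul]
      rw [hn _ _ _ ht, hn _ _ _ ht, mul_add])
    (fun z => abs_nonneg _) (fun z => by positivity)
    (fun z hz => by
      have h1 : 0 ≤ |z.1.1 - z.2.1| ^ (a + b) := by positivity
      have h2 : 0 ≤ |z.1.2 - z.2.2| ^ (a + b) := by positivity
      have h3 : |z.1.1 - z.2.1| ^ (a + b) = 0 := by linarith
      have h4 : |z.1.2 - z.2.2| ^ (a + b) = 0 := by linarith
      rw [Real.rpow_eq_zero (abs_nonneg _) hr.ne', abs_eq_zero, sub_eq_zero] at h3 h4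
      rw [h3, h4, sub_self, abs_zero])
    (fun i => ((hf i).1.prodMk (hg i).1).prodMk (hu.1.prodMk hv.1)) ?_ ?_ ?_
  · have h0 : Tendsto (fun i => ∫ x, |f i x| ^ a * |g i x| ^ b ∂m - ∫ x, |u x| ^ a * |v x| ^ b ∂m)
        l (𝓝 0) := by
      refine squeeze_zero_norm (fun i => ?_) key
      rw [← integral_sub (hint (hf i) (hg i)) (hint hu hv)]
      exact norm_integral_le_integral_norm _
    simpa using h0.add_const (∫ x, |u x| ^ a * |v x| ^ b ∂m)
  · intro i
    refine ((integrable_norm_prod_rpow hr (hf i) (hg i)).add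
      (integrable_norm_prod_rpow hr hu hv)).mono' ?_ (.of_forall fun x => ?_)
    · exact (continuous_norm.rpow_const fun _ => Or.inr hr.le).comp_aestronglyMeasurable
        (((hf i).1.prodMk (hg i).1).prodMk (hu.1.prodMk hv.1))
    · rw [Real.norm_of_nonneg (Real.rpow_nonneg (norm_nonneg _) _)]
      exact norm_prod_rpow_le _ _
  · have h1 := tendsto_integral_norm_rpow hab hf hu hfu
    have h2 := tendsto_integral_norm_rpow hab hg hv hgv
    filter_upwards [h1.eventually_lt_const (lt_add_one _),
      h2.eventually_lt_const (lt_add_one _)] with i hi1 hi2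
    have h3 : ∫ x, ‖((f i x, g i x), (u x, v x))‖ ^ (a + b) ∂m ≤
        ∫ x, ‖(f i x, g i x)‖ ^ (a + b) ∂m + ∫ x, ‖(u x, v x)‖ ^ (a + b) ∂m := by
      rw [← integral_add (integrable_norm_prod_rpow hr (hf i) (hg i))
        (integrable_norm_prod_rpow hr hu hv)]
      refine integral_mono_of_nonneg (.of_forall fun x => Real.rpow_nonneg (norm_nonneg _) _)
        ((integrable_norm_prod_rpow hr (hf i) (hg i)).add
        (integrable_norm_prod_rpow hr hu hv)) (.of_forall fun x => norm_prod_rpow_le _ _)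
    have h4 := integral_norm_prod_rpow_le hr (hf i) (hg i)
    simp only [Real.norm_eq_abs] at hi1 hi2 h4
    linarith
  · have h1 := (tendsto_eLpNorm_zero_iff hr fun i => (hf i).sub hu).1 hfu
    have h2 := (tendsto_eLpNorm_zero_iff hr fun i => (hg i).sub hv).1 hgv
    have h3 := h1.add h2
    rw [add_zero] at h3
    refine h3.congr fun i => ?_
    rw [← integral_add (integrable_norm_rpow' hr ((hf i).sub hu))
      (integrable_norm_rpow' hr ((hg i).sub hv))]
    rfl

theorem abs_rpow_sub_rpow_le {α : ℝ} (h0 : 0 ≤ α) (h1 : α ≤ 1) (x y : ℝ) :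
    |(|x| ^ α - |y| ^ α)| ≤ |x - y| ^ α := by
  have h : ∀ x y : ℝ, |x| ^ α - |y| ^ α ≤ |x - y| ^ α := fun x y => by
    have h2 : |x| ≤ |x - y| + |y| := by
      have := abs_add_le (x - y) y
      rwa [sub_add_cancel] at this
    have h3 := Real.rpow_le_rpow (abs_nonneg x) h2 h0
    have h4 := Real.rpow_add_le_add_rpow (abs_nonneg (x - y)) (abs_nonneg y) h0 h1
    linarith
  rw [abs_le]
  have h5 := h y x
  rw [abs_sub_comm y x] at h5
  exact ⟨by linarith, h x y⟩

/-- Continuity on `L^1` of the sublinear functional `∫ a |u|^α` with a bounded weight. -/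
theorem tendsto_integral_sublinear [IsFiniteMeasure m] {ι : Type*} {l : Filter ι} {α : ℝ}
    (h0 : 0 < α) (h1 : α ≤ 1) {a : X → ℝ} (ha : MemLp a ⊤ m) {f : ι → X → ℝ} {u : X → ℝ}
    (hf : ∀ i, MemLp (f i) 1 m) (hu : MemLp u 1 m)
    (hfu : Tendsto (fun i => eLpNorm (f i - u) 1 m) l (𝓝 0)) :
    (∀ i, Integrable (fun x => a x * |f i x| ^ α) m) ∧
    Integrable (fun x => a x * |u x| ^ α) m ∧
    Tendsto (fun i => ∫ x, a x * |f i x| ^ α ∂m) l (𝓝 (∫ x, a x * |u x| ^ α ∂m)) := by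
  have hα1 : ENNReal.ofReal α ≤ 1 := by rwa [ENNReal.ofReal_le_one]
  have hint : ∀ {f : X → ℝ}, MemLp f 1 m → Integrable (fun x => |f x| ^ α) m := fun {f} hf =>
    integrable_norm_rpow' h0 (hf.mono_exponent hα1)
  have hinta : ∀ {f : X → ℝ}, MemLp f 1 m → Integrable (fun x => a x * |f x| ^ α) m :=
    fun {f} hf => by
      have := (hint hf).mul_of_top_right ha
      exact this
  refine ⟨fun i => hinta (hf i), hinta hu, ?_⟩
  have hα := tendsto_eLpNorm_of_exponent_le hα1 (ENNReal.ofReal_pos.2 h0).ne' ENNReal.one_ne_top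
    (fun i => ((hf i).sub hu).1) hfu
  rw [tendsto_eLpNorm_zero_iff h0 fun i => ((hf i).sub hu).mono_exponent hα1] at hα
  have hb : Tendsto (fun i => (eLpNorm a ⊤ m).toReal * ∫ x, ‖(f i - u) x‖ ^ α ∂m) l (𝓝 0) := by
    simpa using hα.const_mul (eLpNorm a ⊤ m).toReal
  have hz : Tendsto (fun i => ∫ x, a x * |f i x| ^ α ∂m - ∫ x, a x * |u x| ^ α ∂m) l (𝓝 0) := by
    refine squeeze_zero_norm (fun i => ?_) hb
    rw [← integral_sub (hinta (hf i)) (hinta hu), ← integral_const_mul]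
    refine norm_integral_le_of_norm_le ((hint ((hf i).sub hu)).const_mul _) ?_
    have hae : ∀ᵐ x ∂m, ‖a x‖ ≤ (eLpNorm a ⊤ m).toReal := by
      have := ae_le_eLpNormEssSup (f := a) (μ := m)
      filter_upwards [this] with x hx
      rw [← eLpNorm_exponent_top] at hx
      have h3 := ENNReal.toReal_mono ha.2.ne hx
      simpa using h3
    filter_upwards [hae] with x hx
    rw [← mul_sub, norm_mul]
    exact mul_le_mul hx (abs_rpow_sub_rpow_le h0.le h1 _ _) (norm_nonneg _)
      ENNReal.toReal_nonneg
  simpa using hz.add_const (∫ x, a x * |u x| ^ α ∂m)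

end Integrals

/-! ### Test functions and the weighted measure -/

/-- The measure `η dz` on `Ω`. -/
noncomputable def weighted {n : ℕ} (Ω : Set (E n)) (η : E n → ℝ) : Measure (E n) :=
  (volume.restrict Ω).withDensity (fun z => ENNReal.ofReal (η z))

/-- The hypotheses on the domain, the exponents and the weight, with `r` the degree of the
coupling term. -/
structure Admissible {n : ℕ} (Ω : Set (E n)) (p q r : ℝ) (η : E n → ℝ) : Prop where
  isOpen : IsOpen Ω
  nonempty : Ω.Nonempty
  isBounded : Bornology.IsBounded Ω
  one_lt_p : 1 < p
  p_lt_n : p < n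
  p_lt_q : p < q
  q_lt_r : q < r
  r_lt : r < criticalExponent n p
  memLp : MemLp η ⊤ (volume.restrict Ω)
  nonneg : ∀ᵐ z ∂volume.restrict Ω, 0 ≤ η z

section Convergence

variable {X : Type*} [MeasurableSpace X] {m : Measure X} {H : Type*} [NormedAddCommGroup H]

theorem exists_subseq_ae_tendsto {p : ENNReal} (hp : p ≠ 0) {f : ℕ → X → H} {g : X → H}
    (hf : ∀ k, AEStronglyMeasurable (f k) m) (hg : AEStronglyMeasurable g m)
    (h : Tendsto (fun k => eLpNorm (f k - g) p m) atTop (𝓝 0)) :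
    ∃ ns : ℕ → ℕ, StrictMono ns ∧ ∀ᵐ x ∂m, Tendsto (fun k => f (ns k) x) atTop (𝓝 (g x)) :=
  (tendstoInMeasure_of_tendsto_eLpNorm hp hf hg h).exists_seq_tendsto_ae

theorem exists_eLpNorm_limit {p : ENNReal} (hp : 1 ≤ p) [CompleteSpace H] {f : ℕ → X → H}
    (hf : ∀ k, MemLp (f k) p m)
    (h : Tendsto (fun k : ℕ × ℕ => eLpNorm (f k.1 - f k.2) p m) atTop (𝓝 0)) :
    ∃ g, MemLp g p m ∧ Tendsto (fun k => eLpNorm (f k - g) p m) atTop (𝓝 0) := by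
  have : Fact (1 ≤ p) := ⟨hp⟩
  have hc : CauchySeq (fun k => (hf k).toLp (f k)) := by
    rw [Lp.cauchySeq_Lp_iff_cauchySeq_eLpNorm]
    refine h.congr fun k => eLpNorm_congr_ae ?_
    exact ((hf k.1).coeFn_toLp.sub (hf k.2).coeFn_toLp).symm
  obtain ⟨g, hg⟩ := cauchySeq_tendsto_of_complete hc
  refine ⟨g, Lp.memLp g, ?_⟩
  rw [Lp.tendsto_Lp_iff_tendsto_eLpNorm'] at hg
  refine hg.congr fun k => eLpNorm_congr_ae ?_
  exact (hf k).coeFn_toLp.sub (ae_eq_refl _)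

/-- An almost everywhere limit of a sequence that is Cauchy in `L^p` is its limit in `L^p`. -/
theorem tendsto_eLpNorm_of_cauchy_of_ae {p : ENNReal} {f : ℕ → X → H} {g : X → H}
    (hf : ∀ k, AEStronglyMeasurable (f k) m)
    (h : Tendsto (fun k : ℕ × ℕ => eLpNorm (f k.1 - f k.2) p m) atTop (𝓝 0))
    {ns : ℕ → ℕ} (hns : StrictMono ns)
    (hae : ∀ᵐ x ∂m, Tendsto (fun k => f (ns k) x) atTop (𝓝 (g x))) :
    Tendsto (fun k => eLpNorm (f k - g) p m) atTop (𝓝 0) := by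
  rw [ENNReal.tendsto_nhds_zero] at h ⊢
  intro ε hε
  obtain ⟨⟨a, b⟩, hab⟩ := eventually_atTop.1 (h ε hε)
  filter_upwards [eventually_ge_atTop a] with i hi
  refine (Lp.eLpNorm_lim_le_liminf_eLpNorm (f := fun k => f i - f (ns k))
    (fun k => (hf i).sub (hf _)) (f i - g) ?_).trans ?_
  · filter_upwards [hae] with x hx
    exact hx.const_sub (f i x)
  · refine liminf_le_of_frequently_le' (Eventually.frequently ?_)
    filter_upwards [hns.tendsto_atTop.eventually_ge_atTop b] with k hk
    exact hab (i, ns k) ⟨hi, hk⟩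

theorem tendsto_eLpNorm_sub_zero_trans {ι : Type*} {l : Filter ι} {p : ENNReal} (hp : 1 ≤ p)
    {f g h : ι → X → H}
    (hf : ∀ i, AEStronglyMeasurable (f i) m) (hg : ∀ i, AEStronglyMeasurable (g i) m)
    (hh : ∀ i, AEStronglyMeasurable (h i) m)
    (h1 : Tendsto (fun i => eLpNorm (f i - g i) p m) l (𝓝 0))
    (h2 : Tendsto (fun i => eLpNorm (g i - h i) p m) l (𝓝 0)) :
    Tendsto (fun i => eLpNorm (f i - h i) p m) l (𝓝 0) := by
  have h3 := h1.add h2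
  rw [add_zero] at h3
  refine tendsto_of_tendsto_of_tendsto_of_le_of_le tendsto_const_nhds h3 (fun _ => zero_le)
    fun i => ?_
  have e : f i - h i = (f i - g i) + (g i - h i) := by abel
  show eLpNorm (f i - h i) p m ≤ _
  rw [e]
  exact eLpNorm_add_le ((hf i).sub (hg i)) ((hg i).sub (hh i)) hp

theorem tendsto_eLpNorm_sub_comm {ι : Type*} {l : Filter ι} {p : ENNReal} {f g : ι → X → H}
    (h : Tendsto (fun i => eLpNorm (f i - g i) p m) l (𝓝 0)) :
    Tendsto (fun i => eLpNorm (g i - f i) p m) l (𝓝 0) :=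
  h.congr fun _ => eLpNorm_sub_comm _ _ _ _

theorem memLp_of_tendsto_eLpNorm {p : ENNReal} {f : ℕ → X → H} {g : X → H}
    (hf : ∀ k, MemLp (f k) p m) (hg : AEStronglyMeasurable g m)
    (h : Tendsto (fun k => eLpNorm (f k - g) p m) atTop (𝓝 0)) : MemLp g p m := by
  obtain ⟨k, hk⟩ := (h.eventually_lt_const ENNReal.zero_lt_top).exists
  have h1 : MemLp (f k - g) p m := ⟨(hf k).1.sub hg, hk⟩
  have := (hf k).sub h1
  rwa [sub_sub_cancel] at this

theorem tendsto_eLpNorm_norm {p : ENNReal} (hp : 1 ≤ p) {f : ℕ → X → H} {g : X → H}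
    (hf : ∀ k, MemLp (f k) p m) (hg : MemLp g p m)
    (h : Tendsto (fun k => eLpNorm (f k - g) p m) atTop (𝓝 0)) :
    Tendsto (fun k => eLpNorm (f k) p m) atTop (𝓝 (eLpNorm g p m)) := by
  have : Fact (1 ≤ p) := ⟨hp⟩
  have h1 := ((Lp.tendsto_Lp_iff_tendsto_eLpNorm'' f hf g hg).2 h).enorm
  simpa [Lp.enorm_toLp] using h1

/-- Dominated convergence for products `c_k g` with uniformly bounded factors `c_k`. -/
theorem tendsto_eLpNorm_smul_sub [NormedSpace ℝ H] {p : ℝ} (hp : 0 < p) {c : ℕ → X → ℝ}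
    {c' : X → ℝ} {g : X → H} (hc : ∀ k, AEStronglyMeasurable (c k) m)
    (hc' : AEStronglyMeasurable c' m) (hg : MemLp g (ENNReal.ofReal p) m)
    (hb : ∀ k x, |c k x| ≤ 1) (hb' : ∀ x, |c' x| ≤ 1)
    (hae : ∀ᵐ x ∂m, Tendsto (fun k => c k x) atTop (𝓝 (c' x))) :
    Tendsto (fun k => eLpNorm ((fun x => c k x • g x) - fun x => c' x • g x)
      (ENNReal.ofReal p) m) atTop (𝓝 0) := by
  have hm : ∀ {c : X → ℝ}, AEStronglyMeasurable c m → (∀ x, |c x| ≤ 1) →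
      MemLp (fun x => c x • g x) (ENNReal.ofReal p) m := fun {c} hc hb =>
    hg.of_le (hc.smul hg.1) (.of_forall fun x => by
      rw [norm_smul]
      exact mul_le_of_le_one_left (norm_nonneg _) (hb x))
  rw [tendsto_eLpNorm_zero_iff hp fun k => (hm (hc k) (hb k)).sub (hm hc' hb')]
  have h2 : (0 : ℝ) = ∫ _ : X, (0 : ℝ) ∂m := by simp
  rw [h2]
  refine tendsto_integral_of_dominated_convergence (fun x => 2 ^ p * ‖g x‖ ^ p)
    (fun k => (integrable_norm_rpow' hp ((hm (hc k) (hb k)).sub (hm hc' hb'))).1)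
    ((integrable_norm_rpow' hp hg).const_mul _) (fun k => .of_forall fun x => ?_) ?_
  · rw [Real.norm_of_nonneg (Real.rpow_nonneg (norm_nonneg _) _),
      ← Real.mul_rpow two_pos.le (norm_nonneg _)]
    refine Real.rpow_le_rpow (norm_nonneg _) ?_ hp.le
    show ‖c k x • g x - c' x • g x‖ ≤ _
    rw [← sub_smul, norm_smul]
    refine mul_le_mul_of_nonneg_right ?_ (norm_nonneg _)
    calc ‖c k x - c' x‖ ≤ ‖c k x‖ + ‖c' x‖ := norm_sub_le _ _
      _ ≤ 1 + 1 := add_le_add (hb k x) (hb' x)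
      _ = 2 := by norm_num
  · filter_upwards [hae] with x hx
    have h3 : Tendsto (fun k => c k x • g x - c' x • g x) atTop (𝓝 0) := by
      have := (hx.smul_const (g x)).sub_const (c' x • g x)
      rwa [sub_self] at this
    have h4 := h3.norm.rpow_const (p := p) (Or.inr hp.le)
    rw [norm_zero, Real.zero_rpow hp.ne'] at h4
    exact h4

end Convergence

variable {n : ℕ} {Ω : Set (E n)} {p q r : ℝ} {η : E n → ℝ}

theorem weighted_le_smul :
    weighted Ω η ≤ eLpNorm η ⊤ (volume.restrict Ω) • volume.restrict Ω := by
  rw [weighted, ← withDensity_const]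
  refine withDensity_mono ?_
  rw [eLpNorm_exponent_top]
  filter_upwards [ae_le_eLpNormEssSup (f := η) (μ := volume.restrict Ω)] with z hz
  refine le_trans ?_ hz
  rw [← ofReal_norm]
  exact ENNReal.ofReal_le_ofReal (le_abs_self _)

namespace Admissible

theorem isFiniteMeasure (ha : Admissible Ω p q r η) : IsFiniteMeasure (volume.restrict Ω) :=
  ⟨by rw [Measure.restrict_apply_univ]; exact ha.isBounded.measure_lt_top⟩

theorem p_pos (ha : Admissible Ω p q r η) : 0 < p := by linarith [ha.one_lt_p]
theorem one_lt_q (ha : Admissible Ω p q r η) : 1 < q := by linarith [ha.one_lt_p, ha.p_lt_q]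
theorem q_pos (ha : Admissible Ω p q r η) : 0 < q := by linarith [ha.one_lt_q]
theorem one_lt_r (ha : Admissible Ω p q r η) : 1 < r := by linarith [ha.one_lt_q, ha.q_lt_r]
theorem r_pos (ha : Admissible Ω p q r η) : 0 < r := by linarith [ha.one_lt_r]

theorem one_le_ofReal_p (ha : Admissible Ω p q r η) : 1 ≤ ENNReal.ofReal p := by
  rw [ENNReal.one_le_ofReal]; exact ha.one_lt_p.le

theorem one_le_ofReal_q (ha : Admissible Ω p q r η) : 1 ≤ ENNReal.ofReal q := by
  rw [ENNReal.one_le_ofReal]; exact ha.one_lt_q.le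

theorem one_le_ofReal_r (ha : Admissible Ω p q r η) : 1 ≤ ENNReal.ofReal r := by
  rw [ENNReal.one_le_ofReal]; exact ha.one_lt_r.le

theorem aemeasurable_ofReal (ha : Admissible Ω p q r η) :
    AEMeasurable (fun z => ENNReal.ofReal (η z)) (volume.restrict Ω) :=
  ha.memLp.1.aemeasurable.ennreal_ofReal

theorem isFiniteMeasure_weighted (ha : Admissible Ω p q r η) : IsFiniteMeasure (weighted Ω η) := by
  have := ha.isFiniteMeasure
  refine ⟨(weighted_le_smul univ).trans_lt ?_⟩
  rw [Measure.smul_apply, smul_eq_mul]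
  exact ENNReal.mul_lt_top ha.memLp.2 (measure_lt_top _ _)

end Admissible

theorem weighted_absolutelyContinuous : weighted Ω η ≪ volume.restrict Ω :=
  withDensity_absolutelyContinuous _ _

theorem Admissible.memLp_weighted (ha : Admissible Ω p q r η) {H : Type*} [NormedAddCommGroup H]
    {s : ENNReal} {f : E n → H} (hf : MemLp f s (volume.restrict Ω)) :
    MemLp f s (weighted Ω η) :=
  hf.of_measure_le_smul ha.memLp.2.ne weighted_le_smul

theorem Admissible.tendsto_weighted (ha : Admissible Ω p q r η) {H : Type*}
    [NormedAddCommGroup H] {ι : Type*} {l : Filter ι} {s : ENNReal} (hs : s ≠ ⊤)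
    {f : ι → E n → H}
    (hf : Tendsto (fun i => eLpNorm (f i) s (volume.restrict Ω)) l (𝓝 0)) :
    Tendsto (fun i => eLpNorm (f i) s (weighted Ω η)) l (𝓝 0) := by
  have hc : eLpNorm η ⊤ (volume.restrict Ω) ^ (1 / s).toReal ≠ ⊤ :=
    ENNReal.rpow_ne_top_of_nonneg ENNReal.toReal_nonneg ha.memLp.2.ne
  have h2 := ENNReal.Tendsto.const_mul hf (Or.inr hc)
  rw [mul_zero] at h2
  refine tendsto_of_tendsto_of_tendsto_of_le_of_le tendsto_const_nhds h2 (fun _ => zero_le)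
    fun i => ?_
  refine (eLpNorm_mono_measure _ weighted_le_smul).trans ?_
  rw [eLpNorm_smul_measure_of_ne_top hs, smul_eq_mul]

theorem gradient_add' {f g : E n → ℝ} {x : E n} (hf : DifferentiableAt ℝ f x)
    (hg : DifferentiableAt ℝ g x) : gradient (f + g) x = gradient f x + gradient g x := by
  rw [gradient, fderiv_add hf hg, map_add]; rfl

theorem gradient_const_smul' {f : E n → ℝ} {x : E n} (c : ℝ) (hf : DifferentiableAt ℝ f x) :
    gradient (c • f) x = c • gradient f x := by
  rw [gradient, fderiv_const_smul hf, map_smulₛₗ]; rfl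

namespace IsTestFunction

variable {φ ψ : E n → ℝ}

theorem differentiable (h : IsTestFunction Ω φ) : Differentiable ℝ φ :=
  h.smooth.differentiable (by simp)

theorem gradient_add (h : IsTestFunction Ω φ) (h' : IsTestFunction Ω ψ) :
    gradient (φ + ψ) = gradient φ + gradient ψ :=
  funext fun x => gradient_add' (h.differentiable x) (h'.differentiable x)

theorem gradient_smul (h : IsTestFunction Ω φ) (c : ℝ) :
    gradient (c • φ) = c • gradient φ :=
  funext fun x => gradient_const_smul' c (h.differentiable x)

theorem add (h : IsTestFunction Ω φ) (h' : IsTestFunction Ω ψ) : IsTestFunction Ω (φ + ψ) :=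
  ⟨h.smooth.add h'.smooth, h.compact.add h'.compact,
    (tsupport_add φ ψ).trans (union_subset h.support_subset h'.support_subset)⟩

theorem smul (h : IsTestFunction Ω φ) (c : ℝ) : IsTestFunction Ω (c • φ) := by
  have hs : tsupport (c • φ) ⊆ tsupport φ :=
    closure_mono (Function.support_const_smul_subset c φ)
  exact ⟨h.smooth.const_smul c, h.compact.mono' ((Function.support_const_smul_subset c φ).trans
    subset_closure), hs.trans h.support_subset⟩

theorem sub (h : IsTestFunction Ω φ) (h' : IsTestFunction Ω ψ) : IsTestFunction Ω (φ - ψ) := by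
  have := h.add (h'.smul (-1))
  rwa [neg_one_smul, ← sub_eq_add_neg] at this

theorem continuous_gradient (h : IsTestFunction Ω φ) : Continuous (gradient φ) :=
  (LinearIsometryEquiv.continuous _).comp (h.smooth.continuous_fderiv (by simp))

theorem support_gradient (h : IsTestFunction Ω φ) : Function.support (gradient φ) ⊆ Ω := by
  refine Subset.trans ?_ ((support_fderiv_subset ℝ).trans h.support_subset)
  intro x hx hx'
  exact hx (by simp [gradient, hx'])

theorem hasCompactSupport_gradient (h : IsTestFunction Ω φ) :
    HasCompactSupport (gradient φ) := by
  refine (h.compact.fderiv ℝ).mono ?_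
  intro x hx hx'
  exact hx (by simp [gradient, hx'])

theorem memLp (h : IsTestFunction Ω φ) {s : ENNReal} {m : Measure (E n)}
    [IsFiniteMeasureOnCompacts m] : MemLp φ s m :=
  h.smooth.continuous.memLp_of_hasCompactSupport h.compact

theorem memLp_gradient (h : IsTestFunction Ω φ) {s : ENNReal} {m : Measure (E n)}
    [IsFiniteMeasureOnCompacts m] : MemLp (gradient φ) s m :=
  h.continuous_gradient.memLp_of_hasCompactSupport h.hasCompactSupport_gradient

theorem eq_zero_of_notMem (h : IsTestFunction Ω φ) {x : E n} (hx : x ∉ Ω) : φ x = 0 := by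
  by_contra hne
  exact hx (h.support_subset (subset_tsupport _ hne))

theorem zero : IsTestFunction Ω (0 : E n → ℝ) :=
  ⟨contDiff_const, HasCompactSupport.zero, by simp⟩

theorem inner_gradient (v z : E n) : inner ℝ v (gradient φ z) = fderiv ℝ φ z v := by
  rw [real_inner_comm, inner_gradient_left]

/-- The gradient of a test function is its weak gradient. -/
theorem integral_gradient (h : IsTestFunction Ω φ) (h' : IsTestFunction Ω ψ) :
    ∫ z in Ω, φ z • gradient ψ z = -∫ z in Ω, ψ z • gradient φ z := by
  have h1 : ∀ {φ ψ : E n → ℝ}, IsTestFunction Ω φ → IsTestFunction Ω ψ →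
      Integrable (fun z => φ z • gradient ψ z) := fun {φ ψ} h h' =>
    (h.smooth.continuous.smul h'.continuous_gradient).integrable_of_hasCompactSupport
      h.compact.smul_right
  rw [setIntegral_eq_integral_of_forall_compl_eq_zero fun x hx => by
      rw [h.eq_zero_of_notMem hx, zero_smul],
    setIntegral_eq_integral_of_forall_compl_eq_zero fun x hx => by
      rw [h'.eq_zero_of_notMem hx, zero_smul]]
  refine ext_inner_left ℝ fun v => ?_
  have e : ∀ {φ ψ : E n → ℝ}, IsTestFunction Ω φ → IsTestFunction Ω ψ →
      inner ℝ v (∫ z, φ z • gradient ψ z) = ∫ z, φ z * fderiv ℝ ψ z v := fun {φ ψ} h h' => by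
    rw [← integral_inner (h1 h h')]
    refine integral_congr_ae (.of_forall fun z => ?_)
    show inner ℝ v (φ z • gradient ψ z) = φ z * fderiv ℝ ψ z v
    rw [inner_smul_right, inner_gradient]
  have h2 : ∀ {φ ψ : E n → ℝ}, IsTestFunction Ω φ → IsTestFunction Ω ψ →
      Integrable (fun z => φ z * fderiv ℝ ψ z v) := fun {φ ψ} h h' =>
    (h.smooth.continuous.mul ((h'.smooth.continuous_fderiv (by simp)).clm_apply
      continuous_const)).integrable_of_hasCompactSupport h.compact.mul_right
  rw [inner_neg_right, e h h', e h' h, integral_mul_fderiv_eq_neg_fderiv_mul_of_integrable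
    (by simpa only [mul_comm] using h2 h' h) (h2 h h')
    ((h.smooth.continuous.mul h'.smooth.continuous).integrable_of_hasCompactSupport
      h.compact.mul_right) (fun x _ => h.differentiable x) (fun x _ => h'.differentiable x)]
  simp only [mul_comm]

end IsTestFunction

/-- The Sobolev inequality for test functions. -/
theorem Admissible.exists_sobolev_test (ha : Admissible Ω p q r η) {s : ℝ} (hs : 1 ≤ s)
    (hsc : s ≤ criticalExponent n p) :
    ∃ C : NNReal, ∀ φ : E n → ℝ, IsTestFunction Ω φ →
      eLpNorm φ (ENNReal.ofReal s) (volume.restrict Ω) ≤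
        C * eLpNorm (gradient φ) (ENNReal.ofReal p) (volume.restrict Ω) := by
  refine ⟨eLpNormLESNormFDerivOfLeConst ℝ (volume : Measure (E n)) Ω p.toNNReal s.toNNReal,
    fun φ hφ => ?_⟩
  have hp0 := ha.p_pos
  have hn : (0 : ℝ) < n := hp0.trans ha.p_lt_n
  have h1 := eLpNorm_le_eLpNorm_fderiv_of_le (volume : Measure (E n)) (u := φ) (s := Ω)
    (hφ.smooth.of_le (by simp)) ((subset_tsupport _).trans hφ.support_subset)
    (p := p.toNNReal) (q := s.toNNReal)
    (by rw [Real.one_le_toNNReal]; exact ha.one_lt_p.le)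
    (by rw [finrank_euclideanSpace_fin, Real.toNNReal_lt_natCast (by exact_mod_cast hn.ne')]; exact ha.p_lt_n)
    (by
      rw [finrank_euclideanSpace_fin, NNReal.coe_inv, Real.coe_toNNReal _ hp0.le,
        Real.coe_toNNReal _ (by linarith)]
      have h3 : (criticalExponent n p)⁻¹ ≤ s⁻¹ := inv_anti₀ (by linarith) hsc
      refine le_trans (le_of_eq ?_) h3
      have : (n : ℝ) - p ≠ 0 := by linarith [ha.p_lt_n]
      rw [criticalExponent]
      field_simp)
    ha.isBounded
  have e : eLpNorm (fderiv ℝ φ) (ENNReal.ofReal p) (volume : Measure (E n)) =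
      eLpNorm (gradient φ) (ENNReal.ofReal p) (volume.restrict Ω) := by
    rw [eLpNorm_restrict_eq_of_support_subset hφ.support_gradient]
    refine eLpNorm_congr_norm_ae (.of_forall fun x => ?_)
    rw [gradient, LinearIsometryEquiv.norm_map]
  rw [← e, eLpNorm_restrict_eq_of_support_subset
    ((subset_tsupport _).trans hφ.support_subset)]
  exact h1

/-! ### The space `W_0^{1,H}` through approximating sequences -/

variable {n : ℕ} {Ω : Set (E n)} {p q r : ℝ} {η : E n → ℝ}

/-- The sequence `φ` of test functions approximates `u` in `L^p`, and its gradients approximate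
`g` in `L^p` and in the weighted space `L^q(η dz)`. -/
structure Approximates (Ω : Set (E n)) (p q : ℝ) (η : E n → ℝ) (φ : ℕ → E n → ℝ)
    (u : E n → ℝ) (g : E n → E n) : Prop where
  test : ∀ k, IsTestFunction Ω (φ k)
  fn : Tendsto (fun k => eLpNorm (φ k - u) (ENNReal.ofReal p) (volume.restrict Ω)) atTop (𝓝 0)
  grad : Tendsto (fun k => eLpNorm (gradient (φ k) - g) (ENNReal.ofReal p)
    (volume.restrict Ω)) atTop (𝓝 0)
  gradw : Tendsto (fun k => eLpNorm (gradient (φ k) - g) (ENNReal.ofReal q)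
    (weighted Ω η)) atTop (𝓝 0)

/-- `u` is a limit of test functions in `W^{1,H}(Ω)`, with limit gradient `g`. The gradient is part of
the data, so that sums, multiples and limits need no choice of a weak gradient; `MemW01H.isW0` and
`IsW0.memW01H` identify this notion with membership in `W_0^{1,H}(Ω)`. -/
structure IsW0 (Ω : Set (E n)) (p q : ℝ) (η : E n → ℝ) (u : E n → ℝ) (g : E n → E n) : Prop where
  aesm : AEStronglyMeasurable u (volume.restrict Ω)
  aesm_grad : AEStronglyMeasurable g (volume.restrict Ω)
  exists_approx : ∃ φ : ℕ → E n → ℝ, Approximates Ω p q η φ u g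

namespace IsW0

variable {u v : E n → ℝ} {g g' : E n → E n}

theorem memLp (ha : Admissible Ω p q r η) (h : IsW0 Ω p q η u g) :
    MemLp u (ENNReal.ofReal p) (volume.restrict Ω) := by
  obtain ⟨φ, hφ⟩ := h.exists_approx
  have := ha.isFiniteMeasure
  exact memLp_of_tendsto_eLpNorm (fun k => (hφ.test k).memLp) h.aesm hφ.fn

theorem memLp_grad (ha : Admissible Ω p q r η) (h : IsW0 Ω p q η u g) :
    MemLp g (ENNReal.ofReal p) (volume.restrict Ω) := by
  obtain ⟨φ, hφ⟩ := h.exists_approx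
  have := ha.isFiniteMeasure
  exact memLp_of_tendsto_eLpNorm (fun k => (hφ.test k).memLp_gradient) h.aesm_grad hφ.grad

theorem memLp_gradw (ha : Admissible Ω p q r η) (h : IsW0 Ω p q η u g) :
    MemLp g (ENNReal.ofReal q) (weighted Ω η) := by
  obtain ⟨φ, hφ⟩ := h.exists_approx
  have := ha.isFiniteMeasure_weighted
  exact memLp_of_tendsto_eLpNorm (fun k => (hφ.test k).memLp_gradient)
    (h.aesm_grad.mono_ac weighted_absolutelyContinuous) hφ.gradw

theorem of_test {φ : E n → ℝ} (hφ : IsTestFunction Ω φ) : IsW0 Ω p q η φ (gradient φ) := by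
  refine ⟨hφ.smooth.continuous.aestronglyMeasurable,
    hφ.continuous_gradient.aestronglyMeasurable, fun _ => φ, fun _ => hφ, ?_, ?_, ?_⟩ <;>
  simp

theorem add (ha : Admissible Ω p q r η) (h : IsW0 Ω p q η u g) (h' : IsW0 Ω p q η v g') :
    IsW0 Ω p q η (u + v) (g + g') := by
  obtain ⟨φ, hφ⟩ := h.exists_approx
  obtain ⟨ψ, hψ⟩ := h'.exists_approx
  refine ⟨h.aesm.add h'.aesm, h.aesm_grad.add h'.aesm_grad, fun k => φ k + ψ k,
    fun k => (hφ.test k).add (hψ.test k), ?_, ?_, ?_⟩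
  · have h1 := hφ.fn.add hψ.fn
    rw [add_zero] at h1
    refine tendsto_of_tendsto_of_tendsto_of_le_of_le tendsto_const_nhds h1 (fun _ => zero_le)
      fun k => ?_
    have e : φ k + ψ k - (u + v) = (φ k - u) + (ψ k - v) := by abel
    show eLpNorm (φ k + ψ k - (u + v)) _ _ ≤ _
    rw [e]
    exact eLpNorm_add_le ((hφ.test k).smooth.continuous.aestronglyMeasurable.sub h.aesm)
      ((hψ.test k).smooth.continuous.aestronglyMeasurable.sub h'.aesm) ha.one_le_ofReal_p
  · have h1 := hφ.grad.add hψ.grad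
    rw [add_zero] at h1
    refine tendsto_of_tendsto_of_tendsto_of_le_of_le tendsto_const_nhds h1 (fun _ => zero_le)
      fun k => ?_
    have e : gradient (φ k + ψ k) - (g + g') = (gradient (φ k) - g) + (gradient (ψ k) - g') := by
      rw [(hφ.test k).gradient_add (hψ.test k)]; abel
    show eLpNorm (gradient (φ k + ψ k) - (g + g')) _ _ ≤ _
    rw [e]
    exact eLpNorm_add_le ((hφ.test k).continuous_gradient.aestronglyMeasurable.sub h.aesm_grad)
      ((hψ.test k).continuous_gradient.aestronglyMeasurable.sub h'.aesm_grad) ha.one_le_ofReal_p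
  · have h1 := hφ.gradw.add hψ.gradw
    rw [add_zero] at h1
    refine tendsto_of_tendsto_of_tendsto_of_le_of_le tendsto_const_nhds h1 (fun _ => zero_le)
      fun k => ?_
    have e : gradient (φ k + ψ k) - (g + g') = (gradient (φ k) - g) + (gradient (ψ k) - g') := by
      rw [(hφ.test k).gradient_add (hψ.test k)]; abel
    show eLpNorm (gradient (φ k + ψ k) - (g + g')) _ _ ≤ _
    rw [e]
    exact eLpNorm_add_le ((hφ.test k).continuous_gradient.aestronglyMeasurable.sub
        (h.aesm_grad.mono_ac weighted_absolutelyContinuous))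
      ((hψ.test k).continuous_gradient.aestronglyMeasurable.sub
        (h'.aesm_grad.mono_ac weighted_absolutelyContinuous)) ha.one_le_ofReal_q

theorem smul (h : IsW0 Ω p q η u g) (c : ℝ) : IsW0 Ω p q η (c • u) (c • g) := by
  obtain ⟨φ, hφ⟩ := h.exists_approx
  refine ⟨h.aesm.const_smul c, h.aesm_grad.const_smul c, fun k => c • φ k,
    fun k => (hφ.test k).smul c, ?_, ?_, ?_⟩
  · have h1 := ENNReal.Tendsto.const_mul hφ.fn (Or.inr (enorm_ne_top (x := c)))
    rw [mul_zero] at h1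
    refine h1.congr fun k => ?_
    rw [← smul_sub, eLpNorm_const_smul]
  · have h1 := ENNReal.Tendsto.const_mul hφ.grad (Or.inr (enorm_ne_top (x := c)))
    rw [mul_zero] at h1
    refine h1.congr fun k => ?_
    rw [(hφ.test k).gradient_smul, ← smul_sub, eLpNorm_const_smul]
  · have h1 := ENNReal.Tendsto.const_mul hφ.gradw (Or.inr (enorm_ne_top (x := c)))
    rw [mul_zero] at h1
    refine h1.congr fun k => ?_
    rw [(hφ.test k).gradient_smul, ← smul_sub, eLpNorm_const_smul]

theorem sub (ha : Admissible Ω p q r η) (h : IsW0 Ω p q η u g) (h' : IsW0 Ω p q η v g') :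
    IsW0 Ω p q η (u - v) (g - g') := by
  have := h.add ha (h'.smul (-1))
  rwa [neg_one_smul, neg_one_smul, ← sub_eq_add_neg, ← sub_eq_add_neg] at this

theorem congr (h : IsW0 Ω p q η u g) (hu : u =ᵐ[volume.restrict Ω] v)
    (hg : g =ᵐ[volume.restrict Ω] g') : IsW0 Ω p q η v g' := by
  obtain ⟨φ, hφ⟩ := h.exists_approx
  refine ⟨h.aesm.congr hu, h.aesm_grad.congr hg, φ, hφ.test, ?_, ?_, ?_⟩
  · exact hφ.fn.congr fun k => eLpNorm_congr_ae ((ae_eq_refl _).sub hu)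
  · exact hφ.grad.congr fun k => eLpNorm_congr_ae ((ae_eq_refl _).sub hg)
  · exact hφ.gradw.congr fun k => eLpNorm_congr_ae
      ((ae_eq_refl _).sub (weighted_absolutelyContinuous.ae_le hg))

/-- The Sobolev inequality on `W_0^{1,H}(Ω)`. -/
theorem sobolev (ha : Admissible Ω p q r η) {s : ℝ} {C : NNReal} (hC : ∀ φ : E n → ℝ,
      IsTestFunction Ω φ → eLpNorm φ (ENNReal.ofReal s) (volume.restrict Ω) ≤
        C * eLpNorm (gradient φ) (ENNReal.ofReal p) (volume.restrict Ω))
    (h : IsW0 Ω p q η u g) : eLpNorm u (ENNReal.ofReal s) (volume.restrict Ω) ≤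
      C * eLpNorm g (ENNReal.ofReal p) (volume.restrict Ω) := by
  have := ha.isFiniteMeasure
  obtain ⟨φ, hφ⟩ := h.exists_approx
  obtain ⟨ns, hns, hae⟩ := exists_subseq_ae_tendsto (ENNReal.ofReal_pos.2 ha.p_pos).ne'
    (fun k => (hφ.test k).smooth.continuous.aestronglyMeasurable) h.aesm hφ.fn
  refine (Lp.eLpNorm_lim_le_liminf_eLpNorm (f := fun k => φ (ns k))
    (fun k => (hφ.test _).smooth.continuous.aestronglyMeasurable) u hae).trans ?_
  have h1 : Tendsto (fun k => C * eLpNorm (gradient (φ (ns k))) (ENNReal.ofReal p)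
      (volume.restrict Ω)) atTop (𝓝 (C * eLpNorm g (ENNReal.ofReal p) (volume.restrict Ω))) :=
    ENNReal.Tendsto.const_mul ((tendsto_eLpNorm_norm ha.one_le_ofReal_p
      (fun k => (hφ.test k).memLp_gradient) (h.memLp_grad ha) hφ.grad).comp hns.tendsto_atTop)
      (Or.inr ENNReal.coe_ne_top)
  rw [← h1.liminf_eq]
  exact liminf_le_liminf (.of_forall fun k => hC _ (hφ.test _))

theorem memLp_of_le (ha : Admissible Ω p q r η) {s : ℝ} (hs : 1 ≤ s)
    (hsc : s ≤ criticalExponent n p) (h : IsW0 Ω p q η u g) :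
    MemLp u (ENNReal.ofReal s) (volume.restrict Ω) := by
  obtain ⟨C, hC⟩ := ha.exists_sobolev_test hs hsc
  exact ⟨h.aesm, (h.sobolev ha hC).trans_lt
    (ENNReal.mul_lt_top ENNReal.coe_lt_top (h.memLp_grad ha).2)⟩

theorem memLp_r (ha : Admissible Ω p q r η) (h : IsW0 Ω p q η u g) :
    MemLp u (ENNReal.ofReal r) (volume.restrict Ω) :=
  h.memLp_of_le ha ha.one_lt_r.le ha.r_lt.le

theorem memLp_one (ha : Admissible Ω p q r η) (h : IsW0 Ω p q η u g) :
    MemLp u 1 (volume.restrict Ω) := by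
  have := ha.isFiniteMeasure
  exact (h.memLp ha).mono_exponent ha.one_le_ofReal_p

theorem memLp_q (ha : Admissible Ω p q r η) (h : IsW0 Ω p q η u g) :
    MemLp u (ENNReal.ofReal q) (weighted Ω η) :=
  ha.memLp_weighted (h.memLp_of_le ha ha.one_lt_q.le (ha.q_lt_r.trans ha.r_lt).le)

/-- Closedness of `W_0^{1,H}(Ω)` under convergence in `L^p` of the functions and in `L^p` and
`L^q(η dz)` of the gradients. -/
theorem of_tendsto (ha : Admissible Ω p q r η) {w : ℕ → E n → ℝ} {G : ℕ → E n → E n}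
    (h : ∀ k, IsW0 Ω p q η (w k) (G k)) (hu : AEStronglyMeasurable u (volume.restrict Ω))
    (hg : AEStronglyMeasurable g (volume.restrict Ω))
    (h1 : Tendsto (fun k => eLpNorm (w k - u) (ENNReal.ofReal p) (volume.restrict Ω)) atTop (𝓝 0))
    (h2 : Tendsto (fun k => eLpNorm (G k - g) (ENNReal.ofReal p) (volume.restrict Ω)) atTop (𝓝 0))
    (h3 : Tendsto (fun k => eLpNorm (G k - g) (ENNReal.ofReal q) (weighted Ω η)) atTop (𝓝 0)) :
    IsW0 Ω p q η u g := by
  have hex : ∀ k : ℕ, ∃ φ : E n → ℝ, IsTestFunction Ω φ ∧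
      eLpNorm (φ - w k) (ENNReal.ofReal p) (volume.restrict Ω) ≤ ENNReal.ofReal (1 / (k + 1)) ∧
      eLpNorm (gradient φ - G k) (ENNReal.ofReal p) (volume.restrict Ω) ≤
        ENNReal.ofReal (1 / (k + 1)) ∧
      eLpNorm (gradient φ - G k) (ENNReal.ofReal q) (weighted Ω η) ≤
        ENNReal.ofReal (1 / (k + 1)) := fun k => by
    obtain ⟨φ, hφ⟩ := (h k).exists_approx
    have hpos : 0 < ENNReal.ofReal (1 / ((k : ℝ) + 1)) := ENNReal.ofReal_pos.2 (by positivity)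
    obtain ⟨j, a, b, c⟩ := ((hφ.fn.eventually_lt_const hpos).and
      ((hφ.grad.eventually_lt_const hpos).and (hφ.gradw.eventually_lt_const hpos))).exists
    exact ⟨φ j, hφ.test j, a.le, b.le, c.le⟩
  choose φ hφ a b c using hex
  have hz : Tendsto (fun k : ℕ => ENNReal.ofReal (1 / ((k : ℝ) + 1))) atTop (𝓝 0) := by
    have := (ENNReal.continuous_ofReal.tendsto 0).comp
      (tendsto_one_div_add_atTop_nhds_zero_nat (𝕜 := ℝ))
    simpa [Function.comp_def] using this
  have sq : ∀ {f : ℕ → ENNReal}, (∀ k : ℕ, f k ≤ ENNReal.ofReal (1 / ((k : ℝ) + 1))) →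
      Tendsto f atTop (𝓝 0) := fun hf =>
    tendsto_of_tendsto_of_tendsto_of_le_of_le tendsto_const_nhds hz (fun _ => zero_le) hf
  have hac := weighted_absolutelyContinuous (Ω := Ω) (η := η)
  refine ⟨hu, hg, φ, hφ, ?_, ?_, ?_⟩
  · exact tendsto_eLpNorm_sub_zero_trans ha.one_le_ofReal_p
      (fun k => (hφ k).smooth.continuous.aestronglyMeasurable) (fun k => (h k).aesm)
      (fun _ => hu) (sq a) h1
  · exact tendsto_eLpNorm_sub_zero_trans ha.one_le_ofReal_p
      (fun k => (hφ k).continuous_gradient.aestronglyMeasurable) (fun k => (h k).aesm_grad)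
      (fun _ => hg) (sq b) h2
  · exact tendsto_eLpNorm_sub_zero_trans ha.one_le_ofReal_q
      (fun k => (hφ k).continuous_gradient.aestronglyMeasurable)
      (fun k => (h k).aesm_grad.mono_ac hac)
      (fun _ => hg.mono_ac hac) (sq c) h3

/-- Completeness: a sequence that converges in `L^p` and whose gradients are Cauchy in `L^p` and
in `L^q(η dz)` has its limit in `W_0^{1,H}(Ω)`. -/
theorem exists_limit (ha : Admissible Ω p q r η) {w : ℕ → E n → ℝ} {G : ℕ → E n → E n}
    (h : ∀ k, IsW0 Ω p q η (w k) (G k)) (hu : AEStronglyMeasurable u (volume.restrict Ω))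
    (h1 : Tendsto (fun k => eLpNorm (w k - u) (ENNReal.ofReal p) (volume.restrict Ω)) atTop (𝓝 0))
    (h2 : Tendsto (fun k : ℕ × ℕ => eLpNorm (G k.1 - G k.2) (ENNReal.ofReal p)
      (volume.restrict Ω)) atTop (𝓝 0))
    (h3 : Tendsto (fun k : ℕ × ℕ => eLpNorm (G k.1 - G k.2) (ENNReal.ofReal q)
      (weighted Ω η)) atTop (𝓝 0)) :
    ∃ g, IsW0 Ω p q η u g ∧
      Tendsto (fun k => eLpNorm (G k - g) (ENNReal.ofReal p) (volume.restrict Ω)) atTop (𝓝 0) ∧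
      Tendsto (fun k => eLpNorm (G k - g) (ENNReal.ofReal q) (weighted Ω η)) atTop (𝓝 0) := by
  obtain ⟨g, hg, hlim⟩ := exists_eLpNorm_limit ha.one_le_ofReal_p
    (fun k => (h k).memLp_grad ha) h2
  obtain ⟨ns, hns, hae⟩ := exists_subseq_ae_tendsto (ENNReal.ofReal_pos.2 ha.p_pos).ne'
    (fun k => (h k).aesm_grad) hg.1 hlim
  have hac := weighted_absolutelyContinuous (Ω := Ω) (η := η)
  have hlim2 := tendsto_eLpNorm_of_cauchy_of_ae (fun k => (h k).aesm_grad.mono_ac hac) h3 hns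
    (hac.ae_le hae)
  exact ⟨g, of_tendsto ha h hu hg.1 h1 hlim hlim2, hlim, hlim2⟩

end IsW0

/-! ### Weak gradients -/

theorem HasWeakGradient.ae_eq (hΩ : IsOpen Ω) {u : E n → ℝ} {g g' : E n → E n}
    (h : HasWeakGradient Ω u g) (h' : HasWeakGradient Ω u g') :
    g =ᵐ[volume.restrict Ω] g' := by
  have hint : ∀ {g : E n → E n}, LocallyIntegrableOn g Ω → ∀ φ : E n → ℝ, IsTestFunction Ω φ →
      IntegrableOn (fun z => φ z • g z) Ω := fun {g} hg φ hφ => by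
    have h1 : IntegrableOn g (tsupport φ) :=
      hg.integrableOn_compact_subset hφ.support_subset hφ.compact
    have h2 : IntegrableOn (fun z => φ z • g z) (tsupport φ) :=
      h1.continuousOn_smul hφ.smooth.continuous.continuousOn hφ.compact
    refine ((integrableOn_iff_integrable_of_support_subset ?_).1 h2).integrableOn
    intro x hx
    by_contra hne
    exact hx (by simp [image_eq_zero_of_notMem_tsupport hne])
  have h1 := hΩ.ae_eq_zero_of_integral_contDiff_smul_eq_zero (μ := volume) (f := g - g')
    (h.locInt_grad.sub h'.locInt_grad) fun φ h1 h2 h3 => by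
      have hφ : IsTestFunction Ω φ := ⟨h1, h2, h3⟩
      rw [← setIntegral_eq_integral_of_forall_compl_eq_zero (s := Ω) fun x hx => by
        rw [hφ.eq_zero_of_notMem hx, zero_smul]]
      have e : ∀ z, φ z • (g - g') z = φ z • g z - φ z • g' z := fun z => smul_sub _ _ _
      simp_rw [e]
      rw [integral_sub (hint h.locInt_grad φ hφ) (hint h'.locInt_grad φ hφ), sub_eq_zero,
        ← neg_inj, ← h.integral_eq φ hφ, ← h'.integral_eq φ hφ]
  rw [EventuallyEq, ae_restrict_iff' hΩ.measurableSet]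
  filter_upwards [h1] with z hz hzΩ
  exact sub_eq_zero.1 (hz hzΩ)

theorem weakGrad_ae_eq (hΩ : IsOpen Ω) {u : E n → ℝ} {g : E n → E n}
    (h : HasWeakGradient Ω u g) : weakGrad Ω u =ᵐ[volume.restrict Ω] g := by
  have hex : ∃ g, HasWeakGradient Ω u g := ⟨g, h⟩
  rw [weakGrad, dif_pos hex]
  exact hex.choose_spec.ae_eq hΩ h

theorem hasWeakGradient_weakGrad {u : E n → ℝ} (hex : ∃ g, HasWeakGradient Ω u g) :
    HasWeakGradient Ω u (weakGrad Ω u) := by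
  rw [weakGrad, dif_pos hex]
  exact hex.choose_spec

theorem tendsto_eLpNorm_one_mul {X : Type*} [MeasurableSpace X] {m : Measure X} {H : Type*}
    [NormedAddCommGroup H] {f : ℕ → X → H} {g : X → H} {H' : Type*} [NormedAddCommGroup H']
    {F : ℕ → X → H'} {G : X → H'} {c : ℝ}
    (h : Tendsto (fun k => eLpNorm (f k - g) 1 m) atTop (𝓝 0))
    (hb : ∀ k x, ‖(F k - G) x‖ ≤ c * ‖(f k - g) x‖) :
    Tendsto (fun k => eLpNorm (F k - G) 1 m) atTop (𝓝 0) := by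
  have h2 := ENNReal.Tendsto.const_mul h (Or.inr (ENNReal.ofReal_ne_top (r := c)))
  rw [mul_zero] at h2
  exact tendsto_of_tendsto_of_tendsto_of_le_of_le tendsto_const_nhds h2 (fun _ => zero_le)
    fun k => eLpNorm_le_mul_eLpNorm_of_ae_le_mul (.of_forall (hb k)) 1

/-- The limit of the gradients of the approximating test functions is the weak gradient. -/
theorem IsW0.hasWeakGradient (ha : Admissible Ω p q r η) {u : E n → ℝ} {g : E n → E n}
    (h : IsW0 Ω p q η u g) : HasWeakGradient Ω u g := by
  have := ha.isFiniteMeasure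
  have hu : Integrable u (volume.restrict Ω) := memLp_one_iff_integrable.1 (h.memLp_one ha)
  have hg : Integrable g (volume.restrict Ω) :=
    memLp_one_iff_integrable.1 ((h.memLp_grad ha).mono_exponent ha.one_le_ofReal_p)
  refine ⟨IntegrableOn.locallyIntegrableOn hu, IntegrableOn.locallyIntegrableOn hg,
    fun ψ hψ => ?_⟩
  obtain ⟨φ, hφ⟩ := h.exists_approx
  have hp0 : ENNReal.ofReal p ≠ ⊤ := ENNReal.ofReal_ne_top
  have h1 := tendsto_eLpNorm_of_exponent_le ha.one_le_ofReal_p one_ne_zero hp0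
    (fun k => (hφ.test k).smooth.continuous.aestronglyMeasurable.sub h.aesm) hφ.fn
  have h2 := tendsto_eLpNorm_of_exponent_le ha.one_le_ofReal_p one_ne_zero hp0
    (fun k => (hφ.test k).continuous_gradient.aestronglyMeasurable.sub h.aesm_grad) hφ.grad
  obtain ⟨c1, hc1⟩ := hψ.compact.exists_bound_of_continuous hψ.smooth.continuous
  obtain ⟨c2, hc2⟩ := hψ.hasCompactSupport_gradient.exists_bound_of_continuous
    hψ.continuous_gradient
  have h3 : Tendsto (fun k => ∫ z in Ω, φ k z • gradient ψ z) atTop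
      (𝓝 (∫ z in Ω, u z • gradient ψ z)) := by
    refine tendsto_integral_of_L1' _ (h.aesm.smul hψ.continuous_gradient.aestronglyMeasurable)
      (.of_forall fun k => ?_) (tendsto_eLpNorm_one_mul (c := c2) h1 fun k x => ?_)
    · exact (((hφ.test k).smooth.continuous.smul
        hψ.continuous_gradient).integrable_of_hasCompactSupport
        (hφ.test k).compact.smul_right).integrableOn
    · show ‖φ k x • gradient ψ x - u x • gradient ψ x‖ ≤ _
      rw [← sub_smul, norm_smul, mul_comm]
      exact mul_le_mul_of_nonneg_right (hc2 x) (norm_nonneg _)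
  have h4 : Tendsto (fun k => ∫ z in Ω, ψ z • gradient (φ k) z) atTop
      (𝓝 (∫ z in Ω, ψ z • g z)) := by
    refine tendsto_integral_of_L1' _
      (hψ.smooth.continuous.aestronglyMeasurable.smul h.aesm_grad)
      (.of_forall fun k => ?_) (tendsto_eLpNorm_one_mul (c := c1) h2 fun k x => ?_)
    · exact ((hψ.smooth.continuous.smul
        (hφ.test k).continuous_gradient).integrable_of_hasCompactSupport
        hψ.compact.smul_right).integrableOn
    · show ‖ψ x • gradient (φ k) x - ψ x • g x‖ ≤ _
      rw [← smul_sub, norm_smul]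
      exact mul_le_mul_of_nonneg_right (hc1 x) (norm_nonneg _)
  refine tendsto_nhds_unique h3 (h4.neg.congr fun k => ?_)
  exact ((hφ.test k).integral_gradient hψ).symm

/-! ### The Luxemburg norm -/

variable {n : ℕ} {Ω : Set (E n)} {p q r : ℝ} {η : E n → ℝ}

/-- The modular splits into an unweighted `L^p` and a weighted `L^q` part; all facts about the
Luxemburg norm are read off from this. -/
theorem Admissible.modular_eq (ha : Admissible Ω p q r η) {y : E n → ℝ}
    (hy : AEStronglyMeasurable y (volume.restrict Ω)) :
    modular Ω p q η y = eLpNorm y (ENNReal.ofReal p) (volume.restrict Ω) ^ p +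
      eLpNorm y (ENNReal.ofReal q) (weighted Ω η) ^ q := by
  have hp := ha.p_pos
  have hq := ha.q_pos
  have e : ∀ {s : ℝ} (m : Measure (E n)), 0 < s →
      eLpNorm y (ENNReal.ofReal s) m ^ s = ∫⁻ z, ‖y z‖ₑ ^ s ∂m := fun {s} m hs => by
    rw [eLpNorm_eq_lintegral_rpow_enorm_toReal (ENNReal.ofReal_pos.2 hs).ne'
      ENNReal.ofReal_ne_top, ENNReal.toReal_ofReal hs.le, ← ENNReal.rpow_mul,
      one_div, inv_mul_cancel₀ hs.ne', ENNReal.rpow_one]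
  have e2 : ∀ {s : ℝ} (x : ℝ), 0 < s → ‖x‖ₑ ^ s = ENNReal.ofReal (|x| ^ s) := fun {s} x hs => by
    rw [← ofReal_norm, ENNReal.ofReal_rpow_of_nonneg (norm_nonneg _) hs.le, Real.norm_eq_abs]
  rw [e _ hp, e _ hq, weighted, lintegral_withDensity_eq_lintegral_mul₀ ha.aemeasurable_ofReal
    (hy.enorm.pow_const q), ← lintegral_add_left' (hy.enorm.pow_const p), modular]
  refine lintegral_congr_ae ?_
  filter_upwards [ha.nonneg] with z hz
  rw [Pi.mul_apply, e2 _ hp, e2 _ hq, ← ENNReal.ofReal_mul hz, ← ENNReal.ofReal_add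
    (Real.rpow_nonneg (abs_nonneg _) _) (mul_nonneg hz (Real.rpow_nonneg (abs_nonneg _) _))]

theorem Admissible.memLH_iff (ha : Admissible Ω p q r η) {y : E n → ℝ} :
    MemLH Ω p q η y ↔ MemLp y (ENNReal.ofReal p) (volume.restrict Ω) ∧
      MemLp y (ENNReal.ofReal q) (weighted Ω η) := by
  have key : AEStronglyMeasurable y (volume.restrict Ω) → (modular Ω p q η y < ⊤ ↔
      eLpNorm y (ENNReal.ofReal p) (volume.restrict Ω) < ⊤ ∧
      eLpNorm y (ENNReal.ofReal q) (weighted Ω η) < ⊤) := fun hy => by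
    rw [ha.modular_eq hy, ENNReal.add_lt_top, ENNReal.rpow_lt_top_iff_of_pos ha.p_pos,
      ENNReal.rpow_lt_top_iff_of_pos ha.q_pos]
  constructor
  · rintro ⟨hy, hm⟩
    exact ⟨⟨hy, ((key hy).1 hm).1⟩, ⟨hy.mono_ac weighted_absolutelyContinuous, ((key hy).1 hm).2⟩⟩
  · rintro ⟨h1, h2⟩
    exact ⟨h1.1, (key h1.1).2 ⟨h1.2, h2.2⟩⟩

theorem luxemburgNorm_nonneg (y : E n → ℝ) : 0 ≤ luxemburgNorm Ω p q η y :=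
  Real.sInf_nonneg fun _ h => h.1.le

theorem eLpNorm_div_const {y : E n → ℝ} {τ : ℝ} (hτ : 0 < τ) (s : ENNReal)
    (m : Measure (E n)) :
    eLpNorm (fun z => y z / τ) s m = ENNReal.ofReal τ⁻¹ * eLpNorm y s m := by
  have e : (fun z => y z / τ) = τ⁻¹ • y := by
    ext z; rw [Pi.smul_apply, smul_eq_mul, div_eq_inv_mul]
  rw [e, eLpNorm_const_smul, Real.enorm_of_nonneg (inv_pos.2 hτ).le]

theorem Admissible.modular_div (ha : Admissible Ω p q r η) {y : E n → ℝ}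
    (hy : AEStronglyMeasurable y (volume.restrict Ω)) {τ : ℝ} (hτ : 0 < τ) :
    modular Ω p q η (fun z => y z / τ) =
      (ENNReal.ofReal τ⁻¹ * eLpNorm y (ENNReal.ofReal p) (volume.restrict Ω)) ^ p +
      (ENNReal.ofReal τ⁻¹ * eLpNorm y (ENNReal.ofReal q) (weighted Ω η)) ^ q := by
  rw [ha.modular_eq (by simpa only [div_eq_mul_inv] using hy.mul_const τ⁻¹), eLpNorm_div_const hτ, eLpNorm_div_const hτ]

theorem ofReal_inv_mul_le_iff {τ : ℝ} (hτ : 0 < τ) {a : ENNReal} {b : ENNReal} :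
    ENNReal.ofReal τ⁻¹ * a ≤ b ↔ a ≤ ENNReal.ofReal τ * b := by
  rw [ENNReal.ofReal_inv_of_pos hτ, ENNReal.inv_mul_le_iff
    (ENNReal.ofReal_pos.2 hτ).ne' ENNReal.ofReal_ne_top]

/-- Together with `Admissible.luxemburgNorm_le`: convergence in the Luxemburg norm is convergence in
`L^p` and in `L^q(η dz)`. -/
theorem Admissible.eLpNorm_le_of_luxemburgNorm_lt (ha : Admissible Ω p q r η) {y : E n → ℝ}
    (hy : MemLH Ω p q η y) {ε : ℝ} (h : luxemburgNorm Ω p q η y < ε) :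
    eLpNorm y (ENNReal.ofReal p) (volume.restrict Ω) ≤ ENNReal.ofReal ε ∧
      eLpNorm y (ENNReal.ofReal q) (weighted Ω η) ≤ ENNReal.ofReal ε := by
  have hp := ha.p_pos
  have hq := ha.q_pos
  have hne : {τ : ℝ | 0 < τ ∧ modular Ω p q η (fun z => y z / τ) ≤ 1}.Nonempty := by
    obtain ⟨h1, h2⟩ := ha.memLH_iff.1 hy
    have hl : ∀ {a : ENNReal} {s : ℝ}, a < ⊤ → 0 < s →
        Tendsto (fun τ : ℝ => (ENNReal.ofReal τ⁻¹ * a) ^ s) atTop (𝓝 0) := fun {a s} h hs => by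
      have h3 := (ENNReal.continuous_ofReal.tendsto 0).comp tendsto_inv_atTop_zero
      rw [ENNReal.ofReal_zero] at h3
      have h4 := ENNReal.Tendsto.mul_const h3 (Or.inr h.ne)
      rw [zero_mul] at h4
      have h5 := h4.ennrpow_const s
      rw [ENNReal.zero_rpow_of_pos hs] at h5
      exact h5
    have h3 := (hl h1.2 hp).add (hl h2.2 hq)
    rw [add_zero] at h3
    obtain ⟨τ, h4, h5⟩ := ((h3.eventually_lt_const zero_lt_one).and
      (eventually_gt_atTop 0)).exists
    exact ⟨τ, h5, by rw [ha.modular_div hy.1 h5]; exact h4.le⟩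
  obtain ⟨τ, ⟨hτ, hm⟩, hτε⟩ := exists_lt_of_csInf_lt hne h
  rw [ha.modular_div hy.1 hτ] at hm
  have key : ∀ {a : ENNReal} {s : ℝ}, 0 < s → (ENNReal.ofReal τ⁻¹ * a) ^ s ≤ 1 →
      a ≤ ENNReal.ofReal ε := fun {a s} hs h1 => by
    have h2 : ENNReal.ofReal τ⁻¹ * a ≤ 1 := by
      by_contra! h3
      exact (ENNReal.one_lt_rpow h3 hs).not_ge h1
    rw [ofReal_inv_mul_le_iff hτ, mul_one] at h2
    exact h2.trans (ENNReal.ofReal_le_ofReal hτε.le)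
  exact ⟨key hp (le_self_add.trans hm), key hq (le_add_self.trans hm)⟩

theorem Admissible.luxemburgNorm_le (ha : Admissible Ω p q r η) {y : E n → ℝ}
    (hy : AEStronglyMeasurable y (volume.restrict Ω)) {δ : ℝ} (hδ : 0 < δ)
    (h1 : eLpNorm y (ENNReal.ofReal p) (volume.restrict Ω) ≤ ENNReal.ofReal δ)
    (h2 : eLpNorm y (ENNReal.ofReal q) (weighted Ω η) ≤ ENNReal.ofReal δ) :
    luxemburgNorm Ω p q η y ≤ 2 * δ := by
  have hτ : 0 < 2 * δ := by positivity
  refine csInf_le ⟨0, fun τ h => h.1.le⟩ ⟨hτ, ?_⟩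
  rw [ha.modular_div hy hτ]
  have key : ∀ {a : ENNReal} {s : ℝ}, 1 ≤ s → a ≤ ENNReal.ofReal δ →
      (ENNReal.ofReal (2 * δ)⁻¹ * a) ^ s ≤ 2⁻¹ := fun {a s} hs h => by
    have h3 : ENNReal.ofReal (2 * δ)⁻¹ * a ≤ 2⁻¹ := by
      rw [ofReal_inv_mul_le_iff hτ, ENNReal.ofReal_mul two_pos.le, mul_right_comm,
        ENNReal.ofReal_ofNat, ENNReal.mul_inv_cancel two_ne_zero ENNReal.ofNat_ne_top, one_mul]
      exact h
    calc (ENNReal.ofReal (2 * δ)⁻¹ * a) ^ s ≤ (2⁻¹ : ENNReal) ^ s :=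
          ENNReal.rpow_le_rpow h3 (by linarith)
      _ ≤ (2⁻¹ : ENNReal) ^ (1 : ℝ) :=
          ENNReal.rpow_le_rpow_of_exponent_ge (ENNReal.inv_le_one.2 one_le_two) hs
      _ = 2⁻¹ := ENNReal.rpow_one _
  calc _ ≤ (2⁻¹ + 2⁻¹ : ENNReal) := add_le_add (key ha.one_lt_p.le h1) (key ha.one_lt_q.le h2)
    _ = 1 := ENNReal.inv_two_add_inv_two

/-! ### Identification of the two descriptions of `W_0^{1,H}` -/

theorem eLpNorm_norm_comp {H : Type*} [NormedAddCommGroup H] {f : E n → ℝ} {g : E n → H}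
    {m : Measure (E n)} (h : ∀ᵐ z ∂m, f z = ‖g z‖) (s : ENNReal) :
    eLpNorm f s m = eLpNorm g s m :=
  eLpNorm_congr_norm_ae (by filter_upwards [h] with z hz; rw [hz, norm_norm])

/-- Limits of test functions belong to `W_0^{1,H}(Ω)` as it is defined by the Luxemburg norm. -/
theorem IsW0.memW01H (ha : Admissible Ω p q r η) {u : E n → ℝ} {g : E n → E n}
    (h : IsW0 Ω p q η u g) : MemW01H Ω p q η u := by
  have hac := weighted_absolutelyContinuous (Ω := Ω) (η := η)
  have hw : ∀ {u : E n → ℝ} {g : E n → E n}, IsW0 Ω p q η u g →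
      weakGrad Ω u =ᵐ[volume.restrict Ω] g := fun h =>
    weakGrad_ae_eq ha.isOpen (h.hasWeakGradient ha)
  refine ⟨⟨ha.memLH_iff.2 ⟨h.memLp ha, h.memLp_q ha⟩, ⟨g, h.hasWeakGradient ha⟩,
    ha.memLH_iff.2 ⟨?_, ?_⟩⟩, ?_⟩
  · exact ((memLp_congr_ae (hw h)).2 (h.memLp_grad ha)).norm
  · exact ((memLp_congr_ae (hac.ae_le (hw h))).2 (h.memLp_gradw ha)).norm
  · intro ε hε
    obtain ⟨φ, hφ⟩ := h.exists_approx
    have hd : ∀ k, IsW0 Ω p q η (u - φ k) (g - gradient (φ k)) := fun k =>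
      h.sub ha (IsW0.of_test (hφ.test k))
    -- the term `∫ η |u - φ|^q` is controlled by the gradients through the Sobolev inequality
    obtain ⟨C, hC⟩ := ha.exists_sobolev_test ha.one_lt_q.le (ha.q_lt_r.trans ha.r_lt).le
    have hgrad := tendsto_eLpNorm_sub_comm (f := fun k => gradient (φ k)) (g := fun _ => g)
      hφ.grad
    have hgradw := tendsto_eLpNorm_sub_comm (f := fun k => gradient (φ k)) (g := fun _ => g)
      hφ.gradw
    have hfn := tendsto_eLpNorm_sub_comm (f := φ) (g := fun _ => u) hφ.fn
    have hq : Tendsto (fun k => eLpNorm (u - φ k) (ENNReal.ofReal q) (volume.restrict Ω)) atTop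
        (𝓝 0) := by
      have h1 := ENNReal.Tendsto.const_mul hgrad (Or.inr (ENNReal.coe_ne_top (r := C)))
      rw [mul_zero] at h1
      exact tendsto_of_tendsto_of_tendsto_of_le_of_le tendsto_const_nhds h1 (fun _ => zero_le)
        fun k => (hd k).sobolev ha hC
    have hqw := ha.tendsto_weighted ENNReal.ofReal_ne_top hq
    have hδ : 0 < ENNReal.ofReal (ε / 5) := ENNReal.ofReal_pos.2 (by positivity)
    obtain ⟨k, h1, h2, h3, h4⟩ := ((hfn.eventually_lt_const hδ).and
      ((hqw.eventually_lt_const hδ).and ((hgrad.eventually_lt_const hδ).and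
        (hgradw.eventually_lt_const hδ)))).exists
    refine ⟨φ k, hφ.test k, ?_⟩
    have hwk := hw (hd k)
    have e1 := ha.luxemburgNorm_le (hd k).aesm (by positivity) h1.le h2.le
    have e2 := ha.luxemburgNorm_le (y := fun z => ‖weakGrad Ω (u - φ k) z‖)
      ((hd k).aesm_grad.congr hwk.symm).norm (δ := ε / 5) (by positivity)
      (by
        rw [eLpNorm_norm_comp (g := g - gradient (φ k))
          (by filter_upwards [hwk] with z hz; rw [hz])]
        exact h3.le)
      (by
        rw [eLpNorm_norm_comp (g := g - gradient (φ k))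
          (by filter_upwards [hac.ae_le hwk] with z hz; rw [hz])]
        exact h4.le)
    rw [normW1H]
    linarith

theorem IsW0.weakGrad_ae_eq (ha : Admissible Ω p q r η) {u : E n → ℝ} {g : E n → E n}
    (h : IsW0 Ω p q η u g) : weakGrad Ω u =ᵐ[volume.restrict Ω] g :=
  DoublePhase.weakGrad_ae_eq ha.isOpen (h.hasWeakGradient ha)

theorem HasWeakGradient.sub_test (ha : Admissible Ω p q r η) {u : E n → ℝ} {g : E n → E n}
    (h : HasWeakGradient Ω u g) (hu : Integrable u (volume.restrict Ω))
    (hg : Integrable g (volume.restrict Ω)) {φ : E n → ℝ} (hφ : IsTestFunction Ω φ) :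
    HasWeakGradient Ω (u - φ) (g - gradient φ) := by
  have := ha.isFiniteMeasure
  have h1 : Integrable φ (volume.restrict Ω) := memLp_one_iff_integrable.1 hφ.memLp
  have h2 : Integrable (gradient φ) (volume.restrict Ω) :=
    memLp_one_iff_integrable.1 hφ.memLp_gradient
  refine ⟨IntegrableOn.locallyIntegrableOn (hu.sub h1),
    IntegrableOn.locallyIntegrableOn (hg.sub h2), fun ψ hψ => ?_⟩
  obtain ⟨c1, hc1⟩ := hψ.compact.exists_bound_of_continuous hψ.smooth.continuous
  obtain ⟨c2, hc2⟩ := hψ.hasCompactSupport_gradient.exists_bound_of_continuous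
    hψ.continuous_gradient
  have i1 : ∀ {u : E n → ℝ}, Integrable u (volume.restrict Ω) →
      Integrable (fun z => u z • gradient ψ z) (volume.restrict Ω) := fun hu =>
    hu.smul_bdd c2 hψ.continuous_gradient.aestronglyMeasurable (.of_forall hc2)
  have i2 : ∀ {g : E n → E n}, Integrable g (volume.restrict Ω) →
      Integrable (fun z => ψ z • g z) (volume.restrict Ω) := fun hg =>
    hg.bdd_smul c1 hψ.smooth.continuous.aestronglyMeasurable (.of_forall hc1)
  have e1 : ∀ z, (u - φ) z • gradient ψ z = u z • gradient ψ z - φ z • gradient ψ z :=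
    fun z => sub_smul _ _ _
  have e2 : ∀ z, ψ z • (g - gradient φ) z = ψ z • g z - ψ z • gradient φ z :=
    fun z => smul_sub _ _ _
  simp_rw [e1, e2]
  rw [integral_sub (i1 hu) (i1 h1), integral_sub (i2 hg) (i2 h2), h.integral_eq ψ hψ,
    hφ.integral_gradient hψ]
  abel

/-- Functions in `W_0^{1,H}(Ω)` are limits of test functions, and their gradients converge to the
weak gradient. -/
theorem MemW01H.isW0 (ha : Admissible Ω p q r η) {u : E n → ℝ} (h : MemW01H Ω p q η u) :
    IsW0 Ω p q η u (weakGrad Ω u) := by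
  have := ha.isFiniteMeasure
  have := ha.isFiniteMeasure_weighted
  obtain ⟨⟨hu, hex, hg⟩, happ⟩ := h
  have hac := weighted_absolutelyContinuous (Ω := Ω) (η := η)
  have hwg := hasWeakGradient_weakGrad hex
  have hgm : AEStronglyMeasurable (weakGrad Ω u) (volume.restrict Ω) :=
    hwg.locInt_grad.aestronglyMeasurable
  obtain ⟨hu1, -⟩ := ha.memLH_iff.1 hu
  obtain ⟨hg1, hg2⟩ := ha.memLH_iff.1 hg
  have hg1' : MemLp (weakGrad Ω u) (ENNReal.ofReal p) (volume.restrict Ω) :=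
    (memLp_norm_iff hgm).1 hg1
  have hg2' : MemLp (weakGrad Ω u) (ENNReal.ofReal q) (weighted Ω η) :=
    (memLp_norm_iff (hgm.mono_ac hac)).1 hg2
  have hui : Integrable u (volume.restrict Ω) :=
    memLp_one_iff_integrable.1 (hu1.mono_exponent ha.one_le_ofReal_p)
  have hgi : Integrable (weakGrad Ω u) (volume.restrict Ω) :=
    memLp_one_iff_integrable.1 (hg1'.mono_exponent ha.one_le_ofReal_p)
  choose φ hφ hlt using fun k : ℕ => happ (1 / (k + 1)) (by positivity)
  have hz : Tendsto (fun k : ℕ => ENNReal.ofReal (1 / ((k : ℝ) + 1))) atTop (𝓝 0) := by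
    have := (ENNReal.continuous_ofReal.tendsto 0).comp
      (tendsto_one_div_add_atTop_nhds_zero_nat (𝕜 := ℝ))
    simpa [Function.comp_def] using this
  have sq : ∀ {f : ℕ → ENNReal}, (∀ k : ℕ, f k ≤ ENNReal.ofReal (1 / ((k : ℝ) + 1))) →
      Tendsto f atTop (𝓝 0) := fun hf =>
    tendsto_of_tendsto_of_tendsto_of_le_of_le tendsto_const_nhds hz (fun _ => zero_le) hf
  have hw : ∀ k, weakGrad Ω (u - φ k) =ᵐ[volume.restrict Ω] weakGrad Ω u - gradient (φ k) :=
    fun k => DoublePhase.weakGrad_ae_eq ha.isOpen (hwg.sub_test ha hui hgi (hφ k))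
  have h1 : ∀ k, MemLp (weakGrad Ω u - gradient (φ k)) (ENNReal.ofReal p)
      (volume.restrict Ω) := fun k => hg1'.sub (hφ k).memLp_gradient
  have h2 : ∀ k, MemLp (weakGrad Ω u - gradient (φ k)) (ENNReal.ofReal q)
      (weighted Ω η) := fun k => hg2'.sub (hφ k).memLp_gradient
  have hb : ∀ k : ℕ, eLpNorm (φ k - u) (ENNReal.ofReal p) (volume.restrict Ω) ≤
        ENNReal.ofReal (1 / ((k : ℝ) + 1)) ∧
      eLpNorm (gradient (φ k) - weakGrad Ω u) (ENNReal.ofReal p) (volume.restrict Ω) ≤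
        ENNReal.ofReal (1 / ((k : ℝ) + 1)) ∧
      eLpNorm (gradient (φ k) - weakGrad Ω u) (ENNReal.ofReal q) (weighted Ω η) ≤
        ENNReal.ofReal (1 / ((k : ℝ) + 1)) := fun k => by
    have hk := hlt k
    rw [normW1H] at hk
    have n1 := luxemburgNorm_nonneg (Ω := Ω) (p := p) (q := q) (η := η) (u - φ k)
    have n2 := luxemburgNorm_nonneg (Ω := Ω) (p := p) (q := q) (η := η)
      (fun z => ‖weakGrad Ω (u - φ k) z‖)
    obtain ⟨a1, -⟩ := ha.eLpNorm_le_of_luxemburgNorm_lt (ha.memLH_iff.2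
      ⟨hu1.sub (hφ k).memLp, (ha.memLH_iff.1 hu).2.sub (hφ k).memLp⟩)
      (show luxemburgNorm Ω p q η (u - φ k) < 1 / (k + 1) by linarith)
    obtain ⟨b1, b2⟩ := ha.eLpNorm_le_of_luxemburgNorm_lt (ha.memLH_iff.2
      ⟨((memLp_congr_ae (hw k)).2 (h1 k)).norm,
        ((memLp_congr_ae (hac.ae_le (hw k))).2 (h2 k)).norm⟩)
      (show luxemburgNorm Ω p q η (fun z => ‖weakGrad Ω (u - φ k) z‖) < 1 / (k + 1) by linarith)
    rw [eLpNorm_norm_comp (g := weakGrad Ω u - gradient (φ k))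
      (by filter_upwards [hw k] with z hz; rw [hz])] at b1
    rw [eLpNorm_norm_comp (g := weakGrad Ω u - gradient (φ k))
      (by filter_upwards [hac.ae_le (hw k)] with z hz; rw [hz])] at b2
    rw [eLpNorm_sub_comm] at a1 b1 b2
    exact ⟨a1, b1, b2⟩
  exact ⟨hu1.1, hgm, φ, hφ, sq fun k => (hb k).1, sq fun k => (hb k).2.1, sq fun k => (hb k).2.2⟩

/-- The vector space `W_0^{1,H}(Ω)`, as a space of functions that are not identified when they agree
almost everywhere. -/
noncomputable def Admissible.W0 (ha : Admissible Ω p q r η) : Submodule ℝ (E n → ℝ) where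
  carrier := {u | MemW01H Ω p q η u}
  add_mem' := fun hu hv => ((hu.isW0 ha).add ha (hv.isW0 ha)).memW01H ha
  zero_mem' := (IsW0.of_test IsTestFunction.zero).memW01H ha
  smul_mem' := fun c _ hu => ((hu.isW0 ha).smul c).memW01H ha

/-! ### Compactness of the embedding of `W_0^{1,H}` into `L^r` -/

variable {n : ℕ} {Ω : Set (E n)} {p q r : ℝ} {η : E n → ℝ}

theorem IsTestFunction.lintegral_translate_sub_le {φ : E n → ℝ} (hφ : IsTestFunction Ω φ)
    (h : E n) :
    ∫⁻ x, ‖φ (x + h) - φ x‖ₑ ≤ ‖h‖ₑ * ∫⁻ x, ‖fderiv ℝ φ x‖ₑ := by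
  have hc : Continuous (fderiv ℝ φ) := hφ.smooth.continuous_fderiv (by simp)
  have hpt : ∀ x, ‖φ (x + h) - φ x‖ₑ ≤
      ∫⁻ t in Ioc (0 : ℝ) 1, ‖h‖ₑ * ‖fderiv ℝ φ (x + t • h)‖ₑ := fun x => by
    have hd : ∀ t ∈ uIcc (0 : ℝ) 1, HasDerivAt (fun t : ℝ => φ (x + t • h))
        (fderiv ℝ φ (x + t • h) h) t := fun t _ => by
      have h1 : HasDerivAt (fun t : ℝ => x + t • h) h t := by
        simpa using ((hasDerivAt_id t).smul_const h).const_add x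
      exact (hφ.differentiable _).hasFDerivAt.comp_hasDerivAt t h1
    have hcont : Continuous (fun t : ℝ => fderiv ℝ φ (x + t • h) h) :=
      (hc.comp (continuous_const.add (continuous_id.smul continuous_const))).clm_apply
        continuous_const
    have e := intervalIntegral.integral_eq_sub_of_hasDerivAt hd (hcont.intervalIntegrable _ _)
    simp only [one_smul, zero_smul, add_zero] at e
    rw [← e, intervalIntegral.integral_of_le zero_le_one]
    refine (enorm_integral_le_lintegral_enorm _).trans (lintegral_mono fun t => ?_)
    show ‖fderiv ℝ φ (x + t • h) h‖ₑ ≤ ‖h‖ₑ * ‖fderiv ℝ φ (x + t • h)‖ₑ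
    rw [mul_comm]
    exact ContinuousLinearMap.le_opENorm _ _
  calc ∫⁻ x, ‖φ (x + h) - φ x‖ₑ
      ≤ ∫⁻ x, ∫⁻ t in Ioc (0 : ℝ) 1, ‖h‖ₑ * ‖fderiv ℝ φ (x + t • h)‖ₑ := lintegral_mono hpt
    _ = ∫⁻ t in Ioc (0 : ℝ) 1, ∫⁻ x, ‖h‖ₑ * ‖fderiv ℝ φ (x + t • h)‖ₑ := by
        refine lintegral_lintegral_swap (Measurable.aemeasurable ?_)
        have h1 : Continuous (fun z : E n × ℝ => fderiv ℝ φ (z.1 + z.2 • h)) :=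
          hc.comp (continuous_fst.add (continuous_snd.smul continuous_const))
        exact (h1.enorm.measurable).const_mul _
    _ = ∫⁻ _ in Ioc (0 : ℝ) 1, ‖h‖ₑ * ∫⁻ x, ‖fderiv ℝ φ x‖ₑ := by
        refine lintegral_congr fun t => ?_
        rw [lintegral_const_mul' _ _ enorm_ne_top,
          lintegral_add_right_eq_self (fun x => ‖fderiv ℝ φ x‖ₑ) (t • h)]
    _ = ‖h‖ₑ * ∫⁻ x, ‖fderiv ℝ φ x‖ₑ := by simp

/-- The integral of `φ` over the ball of radius `δ` about `x`. It is not divided by the volume of the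
ball, which keeps the estimates in extended nonnegative reals free of divisions. -/
noncomputable def ballIntegral (δ : ℝ) (φ : E n → ℝ) (x : E n) : ℝ :=
  ∫ h in Metric.ball (0 : E n) δ, φ (x + h)

theorem IsTestFunction.integrable_translate {φ : E n → ℝ} (hφ : IsTestFunction Ω φ) (x : E n)
    (s : Set (E n)) : IntegrableOn (fun h => φ (x + h)) s := by
  have : Integrable φ := hφ.smooth.continuous.integrable_of_hasCompactSupport hφ.compact
  exact (this.comp_add_left x).integrableOn

theorem IsTestFunction.enorm_ballIntegral_sub_le {φ : E n → ℝ} (hφ : IsTestFunction Ω φ) (δ : ℝ)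
    (x x' : E n) : ‖ballIntegral δ φ x - ballIntegral δ φ x'‖ₑ ≤
      ‖x - x'‖ₑ * ∫⁻ x, ‖fderiv ℝ φ x‖ₑ := by
  rw [ballIntegral, ballIntegral, ← integral_sub (hφ.integrable_translate x _)
    (hφ.integrable_translate x' _)]
  refine (enorm_integral_le_lintegral_enorm _).trans ((setLIntegral_le_lintegral _ _).trans ?_)
  have e : ∀ h, ‖φ (x + h) - φ (x' + h)‖ₑ = ‖φ ((x' + h) + (x - x')) - φ (x' + h)‖ₑ := fun h => by
    congr 3; abel
  simp_rw [e]
  rw [lintegral_add_left_eq_self (fun y => ‖φ (y + (x - x')) - φ y‖ₑ) x']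
  exact hφ.lintegral_translate_sub_le _

theorem enorm_ballIntegral_le (φ : E n → ℝ) (δ : ℝ) (x : E n) :
    ‖ballIntegral δ φ x‖ₑ ≤ ∫⁻ x, ‖φ x‖ₑ := by
  refine (enorm_integral_le_lintegral_enorm _).trans ((setLIntegral_le_lintegral _ _).trans ?_)
  rw [lintegral_add_left_eq_self (fun y => ‖φ y‖ₑ) x]

/-- The average over a ball of radius `δ` differs from the function by at most `δ ‖∇φ‖_1` in `L^1`;
both sides are multiplied by the volume of the ball. -/
theorem IsTestFunction.lintegral_sub_ballIntegral_le {φ : E n → ℝ} (hφ : IsTestFunction Ω φ)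
    (δ : ℝ) :
    ∫⁻ x, ‖(volume (Metric.ball (0 : E n) δ)).toReal * φ x - ballIntegral δ φ x‖ₑ ≤
      volume (Metric.ball (0 : E n) δ) * (ENNReal.ofReal δ * ∫⁻ x, ‖fderiv ℝ φ x‖ₑ) := by
  have hpt : ∀ x, ‖(volume (Metric.ball (0 : E n) δ)).toReal * φ x - ballIntegral δ φ x‖ₑ ≤
      ∫⁻ h in Metric.ball (0 : E n) δ, ‖φ (x + h) - φ x‖ₑ := fun x => by
    have e : ballIntegral δ φ x - (volume (Metric.ball (0 : E n) δ)).toReal * φ x =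
        ∫ h in Metric.ball (0 : E n) δ, (φ (x + h) - φ x) := by
      rw [integral_sub (hφ.integrable_translate x _) (integrableOn_const
        (Metric.isBounded_ball.measure_lt_top.ne)), setIntegral_const, smul_eq_mul]
      rfl
    rw [← enorm_neg, neg_sub, e]
    exact enorm_integral_le_lintegral_enorm _
  calc _ ≤ ∫⁻ x, ∫⁻ h in Metric.ball (0 : E n) δ, ‖φ (x + h) - φ x‖ₑ := lintegral_mono hpt
    _ = ∫⁻ h in Metric.ball (0 : E n) δ, ∫⁻ x, ‖φ (x + h) - φ x‖ₑ := by
        refine lintegral_lintegral_swap (Measurable.aemeasurable ?_)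
        have hc := hφ.smooth.continuous
        exact ((hc.comp (continuous_fst.add continuous_snd)).sub
          (hc.comp continuous_fst)).enorm.measurable
    _ ≤ ∫⁻ _ in Metric.ball (0 : E n) δ, ENNReal.ofReal δ * ∫⁻ x, ‖fderiv ℝ φ x‖ₑ := by
        refine setLIntegral_mono measurable_const fun h hh => ?_
        refine (hφ.lintegral_translate_sub_le h).trans ?_
        gcongr
        rw [mem_ball_zero_iff] at hh
        rw [← ofReal_norm]
        exact ENNReal.ofReal_le_ofReal hh.le
    _ = _ := by rw [setLIntegral_const, mul_comm]

/-- A sequence of test functions bounded in `W^{1,1}` has finite `L^1`-nets: replace the functions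
by their integrals over small balls and apply the Arzelà–Ascoli theorem. -/
theorem exists_finite_net {φ : ℕ → E n → ℝ} (hφ : ∀ k, IsTestFunction Ω (φ k))
    (hΩ : Bornology.IsBounded Ω) {M : NNReal} (h1 : ∀ k, ∫⁻ x, ‖φ k x‖ₑ ≤ M)
    (h2 : ∀ k, ∫⁻ x, ‖fderiv ℝ (φ k) x‖ₑ ≤ M) {ε : ℝ} (hε : 0 < ε) :
    ∃ I : Set ℕ, I.Finite ∧ ∀ k, ∃ i ∈ I, ∫⁻ x in Ω, ‖φ k x - φ i x‖ₑ < ENNReal.ofReal ε := by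
  obtain ⟨ρ, hρ⟩ := hΩ.subset_closedBall (0 : E n)
  set K := Metric.closedBall (0 : E n) ρ with hK
  have : CompactSpace K := isCompact_iff_compactSpace.1 (isCompact_closedBall 0 ρ)
  -- a radius for which averaging changes each function by at most `ε / 4`
  set δ : ℝ := ε / (4 * (M + 1)) with hδ
  have hM : (0 : ℝ) ≤ M := M.2
  have hδ0 : 0 < δ := by positivity
  set v : ℝ := (volume (Metric.ball (0 : E n) δ)).toReal with hv
  have hVtop : volume (Metric.ball (0 : E n) δ) ≠ ⊤ := Metric.isBounded_ball.measure_lt_top.ne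
  have hv0 : 0 < v := ENNReal.toReal_pos (Metric.measure_ball_pos _ _ hδ0).ne' hVtop
  have hV : volume (Metric.ball (0 : E n) δ) = ENNReal.ofReal v := (ENNReal.ofReal_toReal hVtop).symm
  set w : ℝ := (volume Ω).toReal with hw
  have hW : volume Ω = ENNReal.ofReal w := (ENNReal.ofReal_toReal hΩ.measure_lt_top.ne).symm
  have hw0 : 0 ≤ w := ENNReal.toReal_nonneg
  have hlip : ∀ k x x', |ballIntegral δ (φ k) x - ballIntegral δ (φ k) x'| ≤ M * ‖x - x'‖ :=
    fun k x x' => by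
      have h3 := ((hφ k).enorm_ballIntegral_sub_le δ x x').trans (mul_le_mul_right (h2 k) _)
      have h4 := ENNReal.toReal_mono (ENNReal.mul_ne_top enorm_ne_top ENNReal.coe_ne_top) h3
      rw [ENNReal.toReal_mul, toReal_enorm, toReal_enorm, ENNReal.coe_toReal] at h4
      rw [mul_comm]
      exact h4
  have hbd : ∀ k x, |ballIntegral δ (φ k) x| ≤ M := fun k x => by
    have h3 := (enorm_ballIntegral_le (φ k) δ x).trans (h1 k)
    have h4 := ENNReal.toReal_mono ENNReal.coe_ne_top h3
    rwa [toReal_enorm, ENNReal.coe_toReal] at h4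
  have hcont : ∀ k, Continuous (ballIntegral δ (φ k)) := fun k =>
    (LipschitzWith.of_dist_le_mul (K := M) fun x y => by
      rw [Real.dist_eq, dist_eq_norm]; exact hlip k x y).continuous
  let T : ℕ → BoundedContinuousFunction K ℝ := fun k =>
    BoundedContinuousFunction.mkOfCompact ⟨fun x : K => ballIntegral δ (φ k) x,
      (hcont k).comp continuous_subtype_val⟩
  have hcomp : IsCompact (closure (range T)) := by
    refine BoundedContinuousFunction.arzela_ascoli (Icc (-(M : ℝ)) M) isCompact_Icc _ ?_ ?_
    · rintro f x ⟨k, rfl⟩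
      exact abs_le.1 (hbd k x)
    · refine Metric.equicontinuous_of_continuity_modulus (fun t => M * t) ?_ _ ?_
      · have : Continuous (fun t : ℝ => (M : ℝ) * t) := continuous_const.mul continuous_id
        simpa using this.tendsto 0
      · rintro x y ⟨f, k, rfl⟩
        rw [Real.dist_eq, Subtype.dist_eq, dist_eq_norm]
        exact hlip k x y
  have htb : TotallyBounded (range T) := hcomp.totallyBounded.subset subset_closure
  set θ : ℝ := ε * v / (4 * (w + 1)) with hθ
  have hθ0 : 0 < θ := by positivity
  obtain ⟨t, hts, htf, hcov⟩ := Metric.finite_approx_of_totallyBounded htb θ hθ0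
  obtain ⟨I, hIf, hIt⟩ : ∃ I : Set ℕ, I.Finite ∧ t ⊆ T '' I := by
    have hts' : ∀ y ∈ t, ∃ k, T k = y := fun y hy => hts hy
    choose! f hf using hts'
    exact ⟨f '' t, htf.image f, fun y hy => ⟨f y, mem_image_of_mem f hy, hf y hy⟩⟩
  refine ⟨I, hIf, fun k => ?_⟩
  have hk := hcov ⟨k, rfl⟩
  simp only [mem_iUnion] at hk
  obtain ⟨y, hyt, hy⟩ := hk
  obtain ⟨i, hi, rfl⟩ := hIt hyt
  refine ⟨i, hi, ?_⟩
  have hTd : ∀ x ∈ Ω, |ballIntegral δ (φ k) x - ballIntegral δ (φ i) x| ≤ θ := fun x hx => by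
    have h3 := (BoundedContinuousFunction.dist_coe_le_dist (f := T k) (g := T i) ⟨x, hρ hx⟩)
    exact h3.trans hy.le
  have hmain : ENNReal.ofReal v * ∫⁻ x in Ω, ‖φ k x - φ i x‖ₑ ≤
      ENNReal.ofReal v * ENNReal.ofReal (3 / 4 * ε) := by
    have hm : ∀ j, Measurable (fun x => ‖v * φ j x - ballIntegral δ (φ j) x‖ₑ) := fun j =>
      ((continuous_const.mul (hφ j).smooth.continuous).sub (hcont j)).enorm.measurable
    calc ENNReal.ofReal v * ∫⁻ x in Ω, ‖φ k x - φ i x‖ₑ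
        = ∫⁻ x in Ω, ‖v * (φ k x - φ i x)‖ₑ := by
          rw [← lintegral_const_mul' _ _ ENNReal.ofReal_ne_top]
          refine lintegral_congr fun x => ?_
          rw [enorm_mul, Real.enorm_of_nonneg hv0.le]
      _ ≤ ∫⁻ x in Ω, (‖v * φ k x - ballIntegral δ (φ k) x‖ₑ + ENNReal.ofReal θ
            + ‖v * φ i x - ballIntegral δ (φ i) x‖ₑ) := by
          refine setLIntegral_mono (((hm k).add_const _).add (hm i)) fun x hx => ?_
          have e : v * (φ k x - φ i x) = (v * φ k x - ballIntegral δ (φ k) x)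
            + (ballIntegral δ (φ k) x - ballIntegral δ (φ i) x)
            - (v * φ i x - ballIntegral δ (φ i) x) := by ring
          rw [e]
          refine (enorm_sub_le).trans ?_
          gcongr
          refine (enorm_add_le _ _).trans ?_
          gcongr
          rw [← ofReal_norm]
          exact ENNReal.ofReal_le_ofReal (hTd x hx)
      _ = (∫⁻ x in Ω, ‖v * φ k x - ballIntegral δ (φ k) x‖ₑ) + ENNReal.ofReal θ * volume Ω
            + ∫⁻ x in Ω, ‖v * φ i x - ballIntegral δ (φ i) x‖ₑ := by
          rw [lintegral_add_right _ (hm i), lintegral_add_left (hm k), setLIntegral_const]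
      _ ≤ ENNReal.ofReal v * (ENNReal.ofReal δ * M) + ENNReal.ofReal θ * ENNReal.ofReal w
            + ENNReal.ofReal v * (ENNReal.ofReal δ * M) := by
          have hj : ∀ j, ∫⁻ x in Ω, ‖v * φ j x - ballIntegral δ (φ j) x‖ₑ ≤
              ENNReal.ofReal v * (ENNReal.ofReal δ * M) := fun j => by
            refine (setLIntegral_le_lintegral _ _).trans
              (((hφ j).lintegral_sub_ballIntegral_le δ).trans ?_)
            rw [hV]
            gcongr
            exact h2 j
          rw [hW]
          gcongr
          · exact hj k
          · exact hj i
      _ ≤ ENNReal.ofReal v * ENNReal.ofReal (3 / 4 * ε) := by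
          have eM : (M : ENNReal) = ENNReal.ofReal M := (ENNReal.ofReal_coe_nnreal).symm
          rw [eM, ← ENNReal.ofReal_mul hδ0.le, ← ENNReal.ofReal_mul hv0.le,
            ← ENNReal.ofReal_mul hθ0.le, ← ENNReal.ofReal_mul hv0.le,
            ← ENNReal.ofReal_add (by positivity) (by positivity),
            ← ENNReal.ofReal_add (by positivity) (by positivity)]
          refine ENNReal.ofReal_le_ofReal ?_
          have h3 : δ * M ≤ ε / 4 := by
            rw [hδ, div_mul_eq_mul_div, div_le_div_iff₀ (by positivity) (by norm_num)]
            nlinarith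
          have h4 : θ * w ≤ ε * v / 4 := by
            rw [hθ, div_mul_eq_mul_div, div_le_div_iff₀ (by positivity) (by norm_num)]
            have : 0 < ε * v := by positivity
            nlinarith
          nlinarith
  have hvne : ENNReal.ofReal v ≠ 0 := (ENNReal.ofReal_pos.2 hv0).ne'
  refine ((ENNReal.mul_le_mul_iff_right hvne ENNReal.ofReal_ne_top).1 hmain).trans_lt ?_
  exact (ENNReal.ofReal_lt_ofReal_iff hε).2 (by linarith)

/-- Sequences of test functions bounded in `W^{1,1}` are relatively compact in `L^1(Ω)`. -/
theorem exists_subseq_tendsto_L1 {φ : ℕ → E n → ℝ} (hφ : ∀ k, IsTestFunction Ω (φ k))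
    (hΩ : Bornology.IsBounded Ω) {M : NNReal} (h1 : ∀ k, ∫⁻ x, ‖φ k x‖ₑ ≤ M)
    (h2 : ∀ k, ∫⁻ x, ‖fderiv ℝ (φ k) x‖ₑ ≤ M) :
    ∃ (ns : ℕ → ℕ) (u : E n → ℝ), StrictMono ns ∧ MemLp u 1 (volume.restrict Ω) ∧
      Tendsto (fun k => eLpNorm (φ (ns k) - u) 1 (volume.restrict Ω)) atTop (𝓝 0) := by
  have hm : ∀ k, MemLp (φ k) 1 (volume.restrict Ω) := fun k => (hφ k).memLp
  have htb : TotallyBounded (range fun k => (hm k).toLp (φ k)) := by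
    refine EMetric.totallyBounded_iff.2 fun ε hε => ?_
    obtain ⟨ε', hε'0, hε'⟩ : ∃ ε' : ℝ, 0 < ε' ∧ ENNReal.ofReal ε' ≤ ε := by
      rcases eq_or_ne ε ⊤ with rfl | hne
      · exact ⟨1, one_pos, le_top⟩
      · exact ⟨ε.toReal, ENNReal.toReal_pos hε.ne' hne, ENNReal.ofReal_toReal_le⟩
    obtain ⟨I, hI, hnet⟩ := exists_finite_net hφ hΩ h1 h2 hε'0
    refine ⟨(fun k => (hm k).toLp (φ k)) '' I, hI.image _, ?_⟩
    rintro _ ⟨k, rfl⟩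
    obtain ⟨i, hi, hlt⟩ := hnet k
    simp only [mem_iUnion]
    refine ⟨_, mem_image_of_mem _ hi, ?_⟩
    rw [Metric.mem_eball, Lp.edist_toLp_toLp, eLpNorm_one_eq_lintegral_enorm]
    exact hlt.trans_le hε'
  have hcomp : IsCompact (closure (range fun k => (hm k).toLp (φ k))) :=
    htb.closure.isCompact_of_isClosed isClosed_closure
  obtain ⟨u, -, ns, hns, hlim⟩ := hcomp.tendsto_subseq
    (x := fun k => (hm k).toLp (φ k)) fun k => subset_closure ⟨k, rfl⟩
  refine ⟨ns, u, hns, Lp.memLp u, ?_⟩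
  rw [Lp.tendsto_Lp_iff_tendsto_eLpNorm'] at hlim
  refine hlim.congr fun k => eLpNorm_congr_ae ?_
  exact (hm _).coeFn_toLp.sub (ae_eq_refl _)

/-- Young's inequality for the interpolation of `x^r` between `x` and `x^s`. -/
theorem exists_rpow_interpolation {r s : ℝ} (hr : 1 < r) (hrs : r < s) {ε : ℝ} (hε : 0 < ε) :
    ∃ N : ℝ, 0 ≤ N ∧ ∀ x : ℝ, 0 ≤ x → x ^ r ≤ ε * x ^ s + N * x := by
  -- the point beyond which `x^r ≤ ε x^s`
  set T : ℝ := ε ^ (-(s - r)⁻¹) with hT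
  have hT0 : 0 < T := Real.rpow_pos_of_pos hε _
  have hTr : T ^ (r - s) = ε := by
    rw [hT, ← Real.rpow_mul hε.le]
    have : -(s - r)⁻¹ * (r - s) = 1 := by
      have : s - r ≠ 0 := by linarith
      field_simp; ring
    rw [this, Real.rpow_one]
  refine ⟨T ^ (r - 1), Real.rpow_nonneg hT0.le _, fun x hx => ?_⟩
  rcases hx.eq_or_lt with rfl | hx0
  · rw [Real.zero_rpow (by linarith), Real.zero_rpow (by linarith)]; simp
  have hs0 : 0 ≤ ε * x ^ s := mul_nonneg hε.le (Real.rpow_nonneg hx _)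
  rcases le_or_gt x T with hxT | hxT
  · have h1 : x ^ r = x ^ (r - 1) * x := by
      rw [← Real.rpow_add_one hx0.ne']; congr 1; ring
    have h2 := Real.rpow_le_rpow hx hxT (by linarith : 0 ≤ r - 1)
    have h3 := mul_le_mul_of_nonneg_right h2 hx
    linarith
  · have h1 : x ^ r = x ^ (r - s) * x ^ s := by
      rw [← Real.rpow_add hx0]; congr 1; ring
    have h2 := Real.rpow_le_rpow_of_nonpos hT0 hxT.le (by linarith : r - s ≤ 0)
    rw [hTr] at h2
    have h3 := mul_le_mul_of_nonneg_right h2 (Real.rpow_nonneg hx s)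
    have h4 : 0 ≤ T ^ (r - 1) * x := mul_nonneg (Real.rpow_nonneg hT0.le _) hx
    linarith

/-- Interpolation between `L^1` and `L^s`: a sequence bounded in `L^s` that tends to `0` in `L^1`
tends to `0` in `L^r` for `1 < r < s`. -/
theorem tendsto_eLpNorm_of_interpolation {X : Type*} [MeasurableSpace X] {m : Measure X}
    [IsFiniteMeasure m]
    {ι : Type*} {l : Filter ι} {r s : ℝ} (hr : 1 < r) (hrs : r < s) {f : ι → X → ℝ}
    (hf : ∀ i, MemLp (f i) (ENNReal.ofReal s) m) {M : NNReal}
    (hM : ∀ i, eLpNorm (f i) (ENNReal.ofReal s) m ≤ M)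
    (h : Tendsto (fun i => eLpNorm (f i) 1 m) l (𝓝 0)) :
    Tendsto (fun i => eLpNorm (f i) (ENNReal.ofReal r) m) l (𝓝 0) := by
  have hs0 : 0 < s := by linarith
  have hfr : ∀ i, MemLp (f i) (ENNReal.ofReal r) m := fun i =>
    (hf i).mono_exponent (ENNReal.ofReal_le_ofReal hrs.le)
  have hf1 : ∀ i, MemLp (f i) (ENNReal.ofReal 1) m := fun i =>
    (hf i).mono_exponent (ENNReal.ofReal_le_ofReal (by linarith))
  rw [← ENNReal.ofReal_one, tendsto_eLpNorm_zero_iff one_pos hf1] at h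
  rw [tendsto_eLpNorm_zero_iff (by linarith) hfr]
  refine Metric.tendsto_nhds.2 fun ε hε => ?_
  have hM0 : (0 : ℝ) ≤ (M : ℝ) ^ s := Real.rpow_nonneg M.2 _
  obtain ⟨N, hN0, hN⟩ := exists_rpow_interpolation hr hrs
    (show 0 < ε / 2 / ((M : ℝ) ^ s + 1) by positivity)
  have h2 : ∀ᶠ i in l, ∫ x, ‖f i x‖ ^ (1 : ℝ) ∂m < ε / 2 / (N + 1) :=
    h.eventually_lt_const (by positivity)
  filter_upwards [h2] with i hi
  have h0 : 0 ≤ ∫ x, ‖f i x‖ ^ r ∂m :=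
    integral_nonneg fun x => Real.rpow_nonneg (norm_nonneg _) _
  have h10 : 0 ≤ ∫ x, ‖f i x‖ ^ (1 : ℝ) ∂m :=
    integral_nonneg fun x => Real.rpow_nonneg (norm_nonneg _) _
  rw [Real.dist_eq, sub_zero, abs_of_nonneg h0]
  have hs : ∫ x, ‖f i x‖ ^ s ∂m ≤ (M : ℝ) ^ s := by
    rw [integral_norm_rpow_eq hs0 (hf i)]
    exact Real.rpow_le_rpow ENNReal.toReal_nonneg
      (ENNReal.toReal_mono ENNReal.coe_ne_top (hM i)) hs0.le
  have h3 : ∫ x, ‖f i x‖ ^ r ∂m ≤ ε / 2 / ((M : ℝ) ^ s + 1) * ∫ x, ‖f i x‖ ^ s ∂m +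
      N * ∫ x, ‖f i x‖ ^ (1 : ℝ) ∂m := by
    have i1 := integrable_norm_rpow' hs0 (hf i)
    have i2 := integrable_norm_rpow' one_pos (hf1 i)
    rw [← integral_const_mul, ← integral_const_mul, ← integral_add (i1.const_mul _)
      (i2.const_mul _)]
    refine integral_mono (integrable_norm_rpow' (by linarith) (hfr i))
      ((i1.const_mul _).add (i2.const_mul _)) fun x => ?_
    have := hN ‖f i x‖ (norm_nonneg _)
    simpa using this
  have h4 : ε / 2 / ((M : ℝ) ^ s + 1) * ∫ x, ‖f i x‖ ^ s ∂m ≤ ε / 2 := by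
    rw [div_mul_eq_mul_div, div_le_iff₀ (by positivity)]
    gcongr
    linarith
  have h5 : N * ∫ x, ‖f i x‖ ^ (1 : ℝ) ∂m < ε / 2 := by
    rw [lt_div_iff₀ (by positivity)] at hi
    nlinarith
  linarith

variable {n : ℕ} {Ω : Set (E n)} {p q r : ℝ} {η : E n → ℝ}

theorem IsTestFunction.lintegral_enorm (φ : E n → ℝ) (hφ : IsTestFunction Ω φ) :
    ∫⁻ x, ‖φ x‖ₑ = eLpNorm φ 1 (volume.restrict Ω) := by
  rw [eLpNorm_restrict_eq_of_support_subset ((subset_tsupport _).trans hφ.support_subset),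
    eLpNorm_one_eq_lintegral_enorm]

theorem IsTestFunction.lintegral_enorm_fderiv (φ : E n → ℝ) (hφ : IsTestFunction Ω φ) :
    ∫⁻ x, ‖fderiv ℝ φ x‖ₑ = eLpNorm (gradient φ) 1 (volume.restrict Ω) := by
  rw [eLpNorm_restrict_eq_of_support_subset hφ.support_gradient, eLpNorm_one_eq_lintegral_enorm]
  refine lintegral_congr fun x => ?_
  rw [gradient, LinearIsometryEquiv.enorm_map]

/-- Rellich–Kondrachov for test functions, with a subcritical exponent. -/
theorem Admissible.exists_subseq_test (ha : Admissible Ω p q r η) {φ : ℕ → E n → ℝ}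
    (hφ : ∀ k, IsTestFunction Ω (φ k)) {M : NNReal}
    (hM : ∀ k, eLpNorm (gradient (φ k)) (ENNReal.ofReal p) (volume.restrict Ω) ≤ M) :
    ∃ (ns : ℕ → ℕ) (u : E n → ℝ), StrictMono ns ∧ MemLp u (ENNReal.ofReal r) (volume.restrict Ω) ∧
      Tendsto (fun k => eLpNorm (φ (ns k) - u) (ENNReal.ofReal r) (volume.restrict Ω))
        atTop (𝓝 0) := by
  have := ha.isFiniteMeasure
  have hrs := ha.r_lt
  have hr := ha.one_lt_r
  obtain ⟨C₁, hC₁⟩ := ha.exists_sobolev_test le_rfl (hr.trans hrs).le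
  obtain ⟨C₂, hC₂⟩ := ha.exists_sobolev_test (hr.trans hrs).le le_rfl
  rw [ENNReal.ofReal_one] at hC₁
  set v : NNReal := ((volume.restrict Ω) univ ^
    (1 / (1 : ENNReal).toReal - 1 / (ENNReal.ofReal p).toReal)).toNNReal with hv
  have hvtop : (volume.restrict Ω) univ ^
    (1 / (1 : ENNReal).toReal - 1 / (ENNReal.ofReal p).toReal) ≠ ⊤ := by
    refine ENNReal.rpow_ne_top_of_nonneg ?_ (measure_ne_top _ _)
    rw [ENNReal.toReal_one, ENNReal.toReal_ofReal ha.p_pos.le]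
    exact sub_nonneg.2 (one_div_le_one_div_of_le one_pos ha.one_lt_p.le)
  have h1 : ∀ k, ∫⁻ x, ‖φ k x‖ₑ ≤ ((C₁ * M + M * v : NNReal) : ENNReal) := fun k => by
    rw [(hφ k).lintegral_enorm]
    refine (hC₁ _ (hφ k)).trans ?_
    push_cast
    exact (mul_le_mul_right (hM k) _).trans le_self_add
  have h2 : ∀ k, ∫⁻ x, ‖fderiv ℝ (φ k) x‖ₑ ≤ ((C₁ * M + M * v : NNReal) : ENNReal) := fun k => by
    rw [(hφ k).lintegral_enorm_fderiv]
    refine (eLpNorm_le_eLpNorm_mul_rpow_measure_univ ha.one_le_ofReal_p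
      (hφ k).continuous_gradient.aestronglyMeasurable).trans ?_
    push_cast
    rw [hv, ENNReal.coe_toNNReal hvtop]
    exact (mul_le_mul_left (hM k) _).trans le_add_self
  obtain ⟨ns, u, hns, hu, hlim⟩ := exists_subseq_tendsto_L1 hφ ha.isBounded h1 h2
  have hcauchy : Tendsto (fun k : ℕ × ℕ => eLpNorm (φ (ns k.1) - φ (ns k.2)) 1
      (volume.restrict Ω)) atTop (𝓝 0) := by
    have hm : ∀ k, AEStronglyMeasurable (φ k) (volume.restrict Ω) := fun k =>
      (hφ k).smooth.continuous.aestronglyMeasurable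
    rw [← prod_atTop_atTop_eq]
    exact tendsto_eLpNorm_sub_zero_trans le_rfl (f := fun k : ℕ × ℕ => φ (ns k.1))
      (g := fun _ => u) (h := fun k => φ (ns k.2)) (fun k => hm _) (fun _ => hu.1) (fun k => hm _)
      (hlim.comp tendsto_fst) (tendsto_eLpNorm_sub_comm (hlim.comp tendsto_snd))
  have hcauchy_r := tendsto_eLpNorm_of_interpolation (M := C₂ * M + C₂ * M) hr hrs
    (fun k : ℕ × ℕ => ((hφ (ns k.1)).sub (hφ (ns k.2))).memLp) (fun k => by
      have h3 : ∀ j, eLpNorm (φ j) (ENNReal.ofReal (criticalExponent n p))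
          (volume.restrict Ω) ≤ C₂ * M := fun j =>
        (hC₂ _ (hφ j)).trans (mul_le_mul_right (hM j) _)
      refine (eLpNorm_sub_le (hφ _).smooth.continuous.aestronglyMeasurable
        (hφ _).smooth.continuous.aestronglyMeasurable ?_).trans ?_
      · rw [← ENNReal.ofReal_one]
        exact ENNReal.ofReal_le_ofReal (hr.trans hrs).le
      · push_cast
        exact add_le_add (h3 _) (h3 _)) hcauchy
  obtain ⟨u', hu', hlim'⟩ := exists_eLpNorm_limit ha.one_le_ofReal_r
    (fun k => (hφ (ns k)).memLp) hcauchy_r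
  exact ⟨ns, u', hns, hu', hlim'⟩

theorem Approximates.exists_near {φ : ℕ → E n → ℝ} {u : E n → ℝ} {g : E n → E n}
    (h : Approximates Ω p q η φ u g) {ε : ENNReal} (hε : 0 < ε) :
    ∃ ψ, IsTestFunction Ω ψ ∧
      eLpNorm (gradient ψ - g) (ENNReal.ofReal p) (volume.restrict Ω) ≤ ε := by
  obtain ⟨k, hk⟩ := (h.grad.eventually_lt_const hε).exists
  exact ⟨φ k, h.test k, hk.le⟩

/-- Rellich–Kondrachov in `W_0^{1,H}(Ω)`. -/
theorem IsW0.exists_subseq (ha : Admissible Ω p q r η) {w : ℕ → E n → ℝ} {G : ℕ → E n → E n}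
    (h : ∀ k, IsW0 Ω p q η (w k) (G k)) {M : NNReal}
    (hM : ∀ k, eLpNorm (G k) (ENNReal.ofReal p) (volume.restrict Ω) ≤ M) :
    ∃ (ns : ℕ → ℕ) (u : E n → ℝ), StrictMono ns ∧ MemLp u (ENNReal.ofReal r) (volume.restrict Ω) ∧
      Tendsto (fun k => eLpNorm (w (ns k) - u) (ENNReal.ofReal r) (volume.restrict Ω))
        atTop (𝓝 0) := by
  have hφ : ∀ k : ℕ, ∃ ψ, IsTestFunction Ω ψ ∧
      eLpNorm (gradient ψ - G k) (ENNReal.ofReal p) (volume.restrict Ω) ≤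
        ENNReal.ofReal (1 / (k + 1)) := fun k => by
    obtain ⟨φ, hφ⟩ := (h k).exists_approx
    exact hφ.exists_near (ENNReal.ofReal_pos.2 (by positivity))
  choose φ hφ hφG using hφ
  have hgm : ∀ k, AEStronglyMeasurable (gradient (φ k)) (volume.restrict Ω) := fun k =>
    (hφ k).continuous_gradient.aestronglyMeasurable
  obtain ⟨ns, u, hns, hu, hlim⟩ := ha.exists_subseq_test hφ (M := 1 + M) fun k => by
    have e : gradient (φ k) = (gradient (φ k) - G k) + G k := by abel
    rw [e]
    refine (eLpNorm_add_le ((hgm k).sub (h k).aesm_grad) (h k).aesm_grad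
      ha.one_le_ofReal_p).trans ?_
    push_cast
    refine add_le_add ((hφG k).trans ?_) (hM k)
    rw [← ENNReal.ofReal_one]
    refine ENNReal.ofReal_le_ofReal ?_
    rw [div_le_one (by positivity)]
    linarith [(Nat.cast_nonneg k : (0 : ℝ) ≤ k)]
  refine ⟨ns, u, hns, hu, ?_⟩
  obtain ⟨C, hC⟩ := ha.exists_sobolev_test ha.one_lt_r.le ha.r_lt.le
  have hlim2 : Tendsto (fun k => eLpNorm (w k - φ k) (ENNReal.ofReal r) (volume.restrict Ω))
      atTop (𝓝 0) := by
    have hz : Tendsto (fun k : ℕ => (C : ENNReal) * ENNReal.ofReal (1 / ((k : ℝ) + 1))) atTop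
        (𝓝 0) := by
      have h1 := ENNReal.tendsto_ofReal (tendsto_one_div_add_atTop_nhds_zero_nat (𝕜 := ℝ))
      rw [ENNReal.ofReal_zero] at h1
      simpa using ENNReal.Tendsto.const_mul h1 (Or.inr (ENNReal.coe_ne_top (r := C)))
    refine tendsto_of_tendsto_of_tendsto_of_le_of_le tendsto_const_nhds hz (fun _ => zero_le)
      fun k => ?_
    refine (IsW0.sobolev ha hC ((h k).sub ha (IsW0.of_test (hφ k)))).trans ?_
    rw [eLpNorm_sub_comm]
    exact mul_le_mul_right (hφG k) _
  exact tendsto_eLpNorm_sub_zero_trans ha.one_le_ofReal_r (f := fun k => w (ns k))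
    (g := fun k => φ (ns k)) (h := fun _ => u) (fun k => (h _).aesm)
    (fun k => (hφ _).smooth.continuous.aestronglyMeasurable) (fun _ => hu.1)
    (hlim2.comp hns.tendsto_atTop) hlim

/-! ### Absolute values -/

/-- A smooth approximation of the absolute value, vanishing at `0`. -/
noncomputable def smoothAbs (ε x : ℝ) : ℝ := √(x ^ 2 + ε ^ 2) - ε

/-- The derivative of `smoothAbs ε`; for `ε = 0` this is the sign. -/
noncomputable def smoothSign (ε x : ℝ) : ℝ := x / √(x ^ 2 + ε ^ 2)

theorem abs_smoothSign_le (ε x : ℝ) : |smoothSign ε x| ≤ 1 := by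
  rw [smoothSign, abs_div, abs_of_nonneg (Real.sqrt_nonneg _)]
  exact div_le_one_of_le₀ (Real.abs_le_sqrt (by nlinarith [sq_nonneg ε])) (Real.sqrt_nonneg _)

theorem contDiff_smoothAbs {ε : ℝ} (hε : 0 < ε) : ContDiff ℝ ∞ (smoothAbs ε) :=
  ((((contDiff_id (𝕜 := ℝ) (E := ℝ)).pow 2).add contDiff_const).sqrt
    fun x => (by simp only [id]; positivity)).sub contDiff_const

theorem hasDerivAt_smoothAbs {ε : ℝ} (hε : 0 < ε) (x : ℝ) :
    HasDerivAt (smoothAbs ε) (smoothSign ε x) x := by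
  have h1 : HasDerivAt (fun x : ℝ => x ^ 2 + ε ^ 2) (2 * x) x := by
    simpa using (hasDerivAt_pow 2 x).add_const (ε ^ 2)
  have h2 := (h1.sqrt (by positivity)).sub_const ε
  rw [mul_div_mul_left _ _ two_ne_zero] at h2
  exact h2

theorem smoothAbs_zero {ε : ℝ} (hε : 0 < ε) : smoothAbs ε 0 = 0 := by
  rw [smoothAbs, zero_pow two_ne_zero, zero_add, Real.sqrt_sq hε.le, sub_self]

theorem abs_smoothAbs_sub_le {ε : ℝ} (hε : 0 < ε) (x y : ℝ) :
    |smoothAbs ε x - smoothAbs ε y| ≤ |x - y| := by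
  have := Convex.norm_image_sub_le_of_norm_hasDerivWithin_le (f := smoothAbs ε)
    (f' := smoothSign ε) (s := univ) (C := 1)
    (fun x _ => (hasDerivAt_smoothAbs hε x).hasDerivWithinAt)
    (fun x _ => abs_smoothSign_le ε x) convex_univ (mem_univ y) (mem_univ x)
  simpa using this

theorem abs_smoothAbs_sub_abs_le {ε : ℝ} (hε : 0 < ε) (x : ℝ) :
    |(smoothAbs ε x - |x|)| ≤ ε := by
  have h1 : |x| ≤ √(x ^ 2 + ε ^ 2) := Real.abs_le_sqrt (by nlinarith [sq_nonneg ε])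
  have h2 : √(x ^ 2 + ε ^ 2) ≤ |x| + ε := by
    refine Real.sqrt_le_iff.2 ⟨by positivity, ?_⟩
    nlinarith [sq_abs x, mul_nonneg (abs_nonneg x) hε.le]
  rw [smoothAbs, abs_le]
  constructor <;> linarith

theorem continuous_smoothSign {ε : ℝ} (hε : 0 < ε) : Continuous (smoothSign ε) :=
  continuous_id.div (Real.continuous_sqrt.comp (by fun_prop)) fun x => by positivity

theorem measurable_smoothSign (ε : ℝ) : Measurable (smoothSign ε) :=
  measurable_id.div (Real.continuous_sqrt.measurable.comp (by fun_prop))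

theorem tendsto_smoothSign {ε : ℕ → ℝ} (hε : Tendsto ε atTop (𝓝 0)) (x : ℝ) :
    Tendsto (fun k => smoothSign (ε k) x) atTop (𝓝 (smoothSign 0 x)) := by
  rcases eq_or_ne x 0 with rfl | hx
  · simp [smoothSign]
  · refine Tendsto.div tendsto_const_nhds ?_ ?_
    · exact (Real.continuous_sqrt.tendsto _).comp ((hε.pow 2).const_add (x ^ 2))
    · have : 0 < x ^ 2 + (0 : ℝ) ^ 2 := by positivity
      exact (Real.sqrt_pos.2 this).ne'

variable {n : ℕ} {Ω : Set (E n)} {p q r : ℝ} {η : E n → ℝ}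

theorem IsTestFunction.smoothAbs {φ : E n → ℝ} (h : IsTestFunction Ω φ) {ε : ℝ} (hε : 0 < ε) :
    IsTestFunction Ω (fun x => smoothAbs ε (φ x)) := by
  refine ⟨(contDiff_smoothAbs hε).comp h.smooth, h.compact.comp_left (smoothAbs_zero hε), ?_⟩
  refine (closure_mono ?_).trans h.support_subset
  exact Function.support_comp_subset (smoothAbs_zero hε) φ

theorem IsTestFunction.gradient_smoothAbs {φ : E n → ℝ} (h : IsTestFunction Ω φ) {ε : ℝ}
    (hε : 0 < ε) (x : E n) :
    gradient (fun x => DoublePhase.smoothAbs ε (φ x)) x =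
      smoothSign ε (φ x) • gradient φ x := by
  have h1 := (hasDerivAt_smoothAbs hε (φ x)).comp_hasFDerivAt x
    (h.differentiable x).hasFDerivAt
  have h2 : fderiv ℝ (fun x => DoublePhase.smoothAbs ε (φ x)) x =
    smoothSign ε (φ x) • fderiv ℝ φ x := h1.fderiv
  rw [gradient, h2, map_smul, gradient]

section

variable {X : Type*} [MeasurableSpace X] {m : Measure X} {H : Type*} [NormedAddCommGroup H]
  [NormedSpace ℝ H]

/-- If `G_k → g` in `L^p` and `c_k → c` a.e. with `|c_k| ≤ 1`, then `c_k G_k → c g` in `L^p`. -/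
theorem tendsto_eLpNorm_smul_sub_smul {p : ℝ} (hp : 1 ≤ p) {c : ℕ → X → ℝ}
    {c' : X → ℝ} {G : ℕ → X → H} {g : X → H} (hc : ∀ k, AEStronglyMeasurable (c k) m)
    (hc' : AEStronglyMeasurable c' m) (hG : ∀ k, AEStronglyMeasurable (G k) m)
    (hg : MemLp g (ENNReal.ofReal p) m)
    (hb : ∀ k x, |c k x| ≤ 1) (hb' : ∀ x, |c' x| ≤ 1)
    (hae : ∀ᵐ x ∂m, Tendsto (fun k => c k x) atTop (𝓝 (c' x)))
    (hlim : Tendsto (fun k => eLpNorm (G k - g) (ENNReal.ofReal p) m) atTop (𝓝 0)) :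
    Tendsto (fun k => eLpNorm ((fun x => c k x • G k x) - fun x => c' x • g x)
      (ENNReal.ofReal p) m) atTop (𝓝 0) := by
  refine tendsto_eLpNorm_sub_zero_trans (by rwa [ENNReal.one_le_ofReal])
    (g := fun k x => c k x • g x) (fun k => (hc k).smul (hG k)) (fun k => (hc k).smul hg.1)
    (fun _ => hc'.smul hg.1) ?_
    (tendsto_eLpNorm_smul_sub (by linarith) hc hc' hg hb hb' hae)
  refine tendsto_of_tendsto_of_tendsto_of_le_of_le tendsto_const_nhds hlim (fun _ => zero_le)
    fun k => eLpNorm_mono fun x => ?_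
  simp only [Pi.sub_apply]
  rw [← smul_sub, norm_smul, Real.norm_eq_abs]
  exact mul_le_of_le_one_left (norm_nonneg _) (hb k x)

end

theorem IsW0.smoothAbs (ha : Admissible Ω p q r η) {u : E n → ℝ} {g : E n → E n}
    (h : IsW0 Ω p q η u g) {ε : ℝ} (hε : 0 < ε) :
    IsW0 Ω p q η (fun x => DoublePhase.smoothAbs ε (u x))
      (fun x => smoothSign ε (u x) • g x) := by
  obtain ⟨φ, hφ⟩ := h.exists_approx
  obtain ⟨ns, hns, hae⟩ := exists_subseq_ae_tendsto (ENNReal.ofReal_pos.2 ha.p_pos).ne'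
    (fun k => (hφ.test k).smooth.continuous.aestronglyMeasurable) h.aesm hφ.fn
  have hcu : AEStronglyMeasurable (fun x => smoothSign ε (u x)) (volume.restrict Ω) :=
    (continuous_smoothSign hε).comp_aestronglyMeasurable h.aesm
  have hcφ : ∀ k, Continuous (fun x => smoothSign ε (φ k x)) := fun k =>
    (continuous_smoothSign hε).comp (hφ.test k).smooth.continuous
  have hlim : ∀ᵐ x ∂volume.restrict Ω,
      Tendsto (fun k => smoothSign ε (φ (ns k) x)) atTop (𝓝 (smoothSign ε (u x))) := by
    filter_upwards [hae] with x hx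
    exact ((continuous_smoothSign hε).tendsto _).comp hx
  have hgr : ∀ k, gradient (fun x => DoublePhase.smoothAbs ε (φ k x)) =
      fun x => smoothSign ε (φ k x) • gradient (φ k) x := fun k =>
    funext fun x => (hφ.test k).gradient_smoothAbs hε x
  refine IsW0.of_tendsto ha (fun k => IsW0.of_test ((hφ.test (ns k)).smoothAbs hε))
    ((contDiff_smoothAbs hε).continuous.comp_aestronglyMeasurable h.aesm)
    (hcu.smul h.aesm_grad) ?_ ?_ ?_
  · refine tendsto_of_tendsto_of_tendsto_of_le_of_le tendsto_const_nhds
      (hφ.fn.comp hns.tendsto_atTop) (fun _ => zero_le) fun k => eLpNorm_mono fun x => ?_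
    exact abs_smoothAbs_sub_le hε _ _
  · simp only [hgr]
    exact tendsto_eLpNorm_smul_sub_smul ha.one_lt_p.le
      (fun k => (hcφ _).aestronglyMeasurable) hcu
      (fun k => (hφ.test _).continuous_gradient.aestronglyMeasurable) (h.memLp_grad ha)
      (fun _ _ => abs_smoothSign_le _ _) (fun _ => abs_smoothSign_le _ _) hlim
      (hφ.grad.comp hns.tendsto_atTop)
  · simp only [hgr]
    exact tendsto_eLpNorm_smul_sub_smul ha.one_lt_q.le
      (fun k => (hcφ _).aestronglyMeasurable) (hcu.mono_ac weighted_absolutelyContinuous)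
      (fun k => (hφ.test _).continuous_gradient.aestronglyMeasurable) (h.memLp_gradw ha)
      (fun _ _ => abs_smoothSign_le _ _) (fun _ => abs_smoothSign_le _ _)
      (weighted_absolutelyContinuous.ae_le hlim) (hφ.gradw.comp hns.tendsto_atTop)

/-- `W_0^{1,H}(Ω)` is closed under `u ↦ |u|`, with `∇|u| = sign(u) ∇u`. -/
theorem IsW0.abs (ha : Admissible Ω p q r η) {u : E n → ℝ} {g : E n → E n}
    (h : IsW0 Ω p q η u g) :
    IsW0 Ω p q η (fun x => |u x|) (fun x => smoothSign 0 (u x) • g x) := by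
  have := ha.isFiniteMeasure
  have hε : ∀ k : ℕ, (0 : ℝ) < 1 / ((k : ℝ) + 1) := fun k => by positivity
  have hz := tendsto_one_div_add_atTop_nhds_zero_nat (𝕜 := ℝ)
  have hc : ∀ ε, AEStronglyMeasurable (fun x => smoothSign ε (u x)) (volume.restrict Ω) :=
    fun ε => ((measurable_smoothSign ε).comp_aemeasurable h.aesm.aemeasurable).aestronglyMeasurable
  refine IsW0.of_tendsto ha (fun k : ℕ => h.smoothAbs ha (hε k)) h.aesm.norm
    ((hc 0).smul h.aesm_grad) ?_ ?_ ?_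
  · have h1 : Tendsto (fun k : ℕ => (volume.restrict Ω) univ ^ (ENNReal.ofReal p).toReal⁻¹ *
        ENNReal.ofReal (1 / ((k : ℝ) + 1))) atTop (𝓝 0) := by
      have h2 := ENNReal.tendsto_ofReal hz
      rw [ENNReal.ofReal_zero] at h2
      have := ENNReal.Tendsto.const_mul (a := (volume.restrict Ω) univ ^
        (ENNReal.ofReal p).toReal⁻¹) h2 (Or.inr (ENNReal.rpow_ne_top_of_nonneg
          (inv_nonneg.2 ENNReal.toReal_nonneg) (measure_ne_top _ _)))
      simpa using this
    refine tendsto_of_tendsto_of_tendsto_of_le_of_le tendsto_const_nhds h1 (fun _ => zero_le)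
      fun k => eLpNorm_le_of_ae_bound (.of_forall fun x => ?_)
    exact abs_smoothAbs_sub_abs_le (hε k) _
  · exact tendsto_eLpNorm_smul_sub ha.p_pos (fun k => hc _) (hc 0) (h.memLp_grad ha)
      (fun _ _ => abs_smoothSign_le _ _) (fun _ => abs_smoothSign_le _ _)
      (.of_forall fun x => tendsto_smoothSign hz _)
  · exact tendsto_eLpNorm_smul_sub ha.q_pos
      (fun k => (hc _).mono_ac weighted_absolutelyContinuous)
      ((hc 0).mono_ac weighted_absolutelyContinuous) (h.memLp_gradw ha)
      (fun _ _ => abs_smoothSign_le _ _) (fun _ => abs_smoothSign_le _ _)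
      (.of_forall fun x => tendsto_smoothSign hz _)

variable {n : ℕ} {Ω : Set (E n)} {p q r : ℝ} {η : E n → ℝ}

/-! ### Dirichlet integrals of the two phases -/

/-- The Dirichlet integral `∫ |∇u|^s dm`. -/
noncomputable def dirichlet (Ω : Set (E n)) (m : Measure (E n)) (s : ℝ) (u : E n → ℝ) : ℝ :=
  ∫ z, ‖weakGrad Ω u z‖ ^ s ∂m

/-- An exponent `s` and a measure `m` for which the gradients of functions in `W_0^{1,H}(Ω)` are
in `L^s(m)`. The two cases of interest are the two phases, `(p, dz)` and `(q, η dz)`. -/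
structure IsPhase (Ω : Set (E n)) (p q : ℝ) (η : E n → ℝ) (m : Measure (E n)) (s : ℝ) : Prop where
  one_lt : 1 < s
  ac : m ≪ volume.restrict Ω
  memLp : ∀ {u g}, IsW0 Ω p q η u g → MemLp g (ENNReal.ofReal s) m

theorem Admissible.isPhase_p (ha : Admissible Ω p q r η) :
    IsPhase Ω p q η (volume.restrict Ω) p :=
  ⟨ha.one_lt_p, Measure.AbsolutelyContinuous.rfl, fun h => h.memLp_grad ha⟩

theorem Admissible.isPhase_q (ha : Admissible Ω p q r η) : IsPhase Ω p q η (weighted Ω η) q :=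
  ⟨ha.one_lt_q, weighted_absolutelyContinuous, fun h => h.memLp_gradw ha⟩

namespace IsPhase

variable {m : Measure (E n)} {s : ℝ} {u v h : E n → ℝ} {g : E n → E n}

theorem pos (H : IsPhase Ω p q η m s) : 0 < s := zero_lt_one.trans H.one_lt

theorem dirichlet_eq (ha : Admissible Ω p q r η) (H : IsPhase Ω p q η m s)
    (hu : IsW0 Ω p q η u g) : dirichlet Ω m s u = ∫ z, ‖g z‖ ^ s ∂m := by
  refine integral_congr_ae ?_
  filter_upwards [H.ac.ae_le (hu.weakGrad_ae_eq ha)] with z hz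
  rw [hz]

theorem dirichlet_smul (ha : Admissible Ω p q r η) (H : IsPhase Ω p q η m s)
    (hu : MemW01H Ω p q η u) {t : ℝ} (ht : 0 < t) :
    dirichlet Ω m s (t • u) = t ^ s * dirichlet Ω m s u := by
  rw [H.dirichlet_eq ha ((hu.isW0 ha).smul t), dirichlet, ← integral_const_mul]
  refine integral_congr_ae (.of_forall fun z => ?_)
  simp only [Pi.smul_apply]
  rw [norm_smul, Real.norm_of_nonneg ht.le, Real.mul_rpow ht.le (norm_nonneg _)]

theorem dirichlet_mid (ha : Admissible Ω p q r η) (H : IsPhase Ω p q η m s)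
    (hu : MemW01H Ω p q η u) (hv : MemW01H Ω p q η v) :
    dirichlet Ω m s (mid u v) =
      ∫ z, ‖(1 / 2 : ℝ) • (weakGrad Ω u z + weakGrad Ω v z)‖ ^ s ∂m :=
  H.dirichlet_eq ha (((hu.isW0 ha).add ha (hv.isW0 ha)).smul (1 / 2))

theorem dirichlet_mid_le (ha : Admissible Ω p q r η) (H : IsPhase Ω p q η m s)
    (hu : MemW01H Ω p q η u) (hv : MemW01H Ω p q η v) :
    dirichlet Ω m s (mid u v) ≤ (dirichlet Ω m s u + dirichlet Ω m s v) / 2 := by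
  have h1 := H.memLp (hu.isW0 ha)
  have h2 := H.memLp (hv.isW0 ha)
  rw [H.dirichlet_mid ha hu hv, dirichlet, dirichlet,
    ← integral_add (integrable_norm_rpow' H.pos h1) (integrable_norm_rpow' H.pos h2),
    ← integral_div]
  refine integral_mono (integrable_norm_rpow' H.pos ((h1.add h2).const_smul (1 / 2 : ℝ)))
    (((integrable_norm_rpow' H.pos h1).add (integrable_norm_rpow' H.pos h2)).div_const 2) fun z => ?_
  exact norm_mid_rpow_le H.one_lt.le _ _

theorem dirichlet_nonneg (m : Measure (E n)) (s : ℝ) (u : E n → ℝ) : 0 ≤ dirichlet Ω m s u :=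
  integral_nonneg fun _ => Real.rpow_nonneg (norm_nonneg _) _

theorem dirichlet_abs_le (ha : Admissible Ω p q r η) (H : IsPhase Ω p q η m s)
    (hu : MemW01H Ω p q η u) : dirichlet Ω m s (fun z => |u z|) ≤ dirichlet Ω m s u := by
  have h := (hu.isW0 ha).abs ha
  rw [H.dirichlet_eq ha h]
  refine integral_mono (integrable_norm_rpow' H.pos (H.memLp h))
    (integrable_norm_rpow' H.pos (H.memLp (hu.isW0 ha))) fun z => ?_
  refine Real.rpow_le_rpow (norm_nonneg _) ?_ H.pos.le
  rw [norm_smul, Real.norm_eq_abs]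
  exact mul_le_of_le_one_left (norm_nonneg _) (abs_smoothSign_le _ _)

theorem tendsto_dirichlet_of_sub (ha : Admissible Ω p q r η) (H : IsPhase Ω p q η m s)
    {ι : Type*} {l : Filter ι} {w : ι → E n → ℝ} {G : ι → E n → E n}
    (hw : ∀ i, IsW0 Ω p q η (w i) (G i)) (hu : IsW0 Ω p q η u g)
    (hlim : Tendsto (fun i => eLpNorm (G i - g) (ENNReal.ofReal s) m) l (𝓝 0)) :
    Tendsto (fun i => dirichlet Ω m s (w i)) l (𝓝 (dirichlet Ω m s u)) := by
  rw [H.dirichlet_eq ha hu]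
  simp_rw [fun i => H.dirichlet_eq ha (hw i)]
  exact tendsto_integral_norm_rpow H.one_lt.le (fun i => H.memLp (hw i)) (H.memLp hu) hlim

/-- Vanishing convexity defects force the gradients to converge strongly. -/
theorem tendsto_grad_of_defect (ha : Admissible Ω p q r η) (H : IsPhase Ω p q η m s)
    {ι : Type*} {l : Filter ι} {v w : ι → E n → ℝ} (hv : ∀ i, MemW01H Ω p q η (v i))
    (hw : ∀ i, MemW01H Ω p q η (w i)) {M : ℝ} (hvM : ∀ i, dirichlet Ω m s (v i) ≤ M)
    (hwM : ∀ i, dirichlet Ω m s (w i) ≤ M)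
    (hlim : Tendsto (fun i => (dirichlet Ω m s (v i) + dirichlet Ω m s (w i)) / 2
      - dirichlet Ω m s (mid (v i) (w i))) l (𝓝 0)) :
    Tendsto (fun i => eLpNorm (weakGrad Ω (v i) - weakGrad Ω (w i)) (ENNReal.ofReal s) m) l
      (𝓝 0) := by
  refine tendsto_eLpNorm_sub_of_defect H.one_lt (fun i => H.memLp ((hv i).isW0 ha))
    (fun i => H.memLp ((hw i).isW0 ha)) hvM hwM (hlim.congr fun i => ?_)
  rw [H.dirichlet_mid ha (hv i) (hw i)]
  rfl

end IsPhase

theorem tendsto_eLpNorm_add_smul_sub {X : Type*} [MeasurableSpace X] {m : Measure X} {H : Type*}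
    [NormedAddCommGroup H] [NormedSpace ℝ H] {s : ENNReal} (f : X → H) {h : X → H}
    (hh : MemLp h s m) :
    Tendsto (fun t : ℝ => eLpNorm ((f + t • h) - f) s m) (𝓝 0) (𝓝 0) := by
  have h1 : Tendsto (fun t : ℝ => ‖t‖ₑ * eLpNorm h s m) (𝓝 0) (𝓝 0) := by
    have h2 : Tendsto (fun t : ℝ => ‖t‖ₑ) (𝓝 0) (𝓝 0) := by
      simpa using (continuous_enorm (E := ℝ)).tendsto 0
    simpa using ENNReal.Tendsto.mul_const h2 (Or.inr hh.2.ne)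
  refine h1.congr fun t => ?_
  rw [add_sub_cancel_left, eLpNorm_const_smul]

theorem IsPhase.tendsto_dirichlet (ha : Admissible Ω p q r η) {m : Measure (E n)} {s : ℝ}
    (H : IsPhase Ω p q η m s) {u h : E n → ℝ}
    (hu : MemW01H Ω p q η u) (hh : MemW01H Ω p q η h) :
    Tendsto (fun t : ℝ => dirichlet Ω m s (u + t • h)) (𝓝 0) (𝓝 (dirichlet Ω m s u)) :=
  H.tendsto_dirichlet_of_sub ha (fun t => (hu.isW0 ha).add ha ((hh.isW0 ha).smul t))
    (hu.isW0 ha) (tendsto_eLpNorm_add_smul_sub _ (H.memLp (hh.isW0 ha)))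

/-- The Sobolev inequality in integral form, for all exponents `0 < s ≤ p^*`. -/
theorem Admissible.exists_integral_le (ha : Admissible Ω p q r η) {s : ℝ} (hs : 0 < s)
    (hsc : s ≤ criticalExponent n p) :
    ∃ C : ℝ, 0 < C ∧ ∀ u, MemW01H Ω p q η u →
      Integrable (fun z => |u z| ^ s) (volume.restrict Ω) ∧
      ∫ z in Ω, |u z| ^ s ≤ C * dirichlet Ω (volume.restrict Ω) p u ^ (s / p) := by
  have := ha.isFiniteMeasure
  have hc : max 1 s ≤ criticalExponent n p := max_le (ha.one_lt_r.trans ha.r_lt).le hsc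
  obtain ⟨C, hC⟩ := ha.exists_sobolev_test (le_max_left 1 s) hc
  have hle : ENNReal.ofReal s ≤ ENNReal.ofReal (max 1 s) :=
    ENNReal.ofReal_le_ofReal (le_max_right _ _)
  set v : ENNReal := (volume.restrict Ω) univ ^ (1 / (ENNReal.ofReal s).toReal -
      1 / (ENNReal.ofReal (max 1 s)).toReal) with hv
  have hvtop : v ≠ ⊤ := by
    refine ENNReal.rpow_ne_top_of_nonneg ?_ (measure_ne_top _ _)
    rw [ENNReal.toReal_ofReal hs.le, ENNReal.toReal_ofReal (hs.le.trans (le_max_right _ _))]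
    exact sub_nonneg.2 (one_div_le_one_div_of_le hs (le_max_right _ _))
  refine ⟨((C : ℝ) * v.toReal + 1) ^ s, Real.rpow_pos_of_pos (by positivity) _, fun u hu => ?_⟩
  have h1 := (hu.isW0 ha).memLp_of_le ha (le_max_left 1 s) hc
  have h2 : MemLp u (ENNReal.ofReal s) (volume.restrict Ω) := h1.mono_exponent hle
  refine ⟨integrable_norm_rpow' hs h2, ?_⟩
  have e1 := integral_norm_rpow_eq hs h2
  have e2 := integral_norm_rpow_eq ha.p_pos ((hu.isW0 ha).memLp_grad ha)
  rw [dirichlet, e2, ← Real.rpow_mul ENNReal.toReal_nonneg, mul_div_cancel₀ _ ha.p_pos.ne',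
    ← Real.mul_rpow (by positivity) ENNReal.toReal_nonneg]
  refine e1.trans_le (Real.rpow_le_rpow ENNReal.toReal_nonneg ?_ hs.le)
  have h3 : eLpNorm u (ENNReal.ofReal s) (volume.restrict Ω) ≤
      C * eLpNorm (weakGrad Ω u) (ENNReal.ofReal p) (volume.restrict Ω) * v :=
    (eLpNorm_le_eLpNorm_mul_rpow_measure_univ hle h2.1).trans
      (mul_le_mul_left (IsW0.sobolev ha hC (hu.isW0 ha)) _)
  have h4 := ENNReal.toReal_mono (ENNReal.mul_ne_top (ENNReal.mul_ne_top ENNReal.coe_ne_top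
    ((hu.isW0 ha).memLp_grad ha).2.ne) hvtop) h3
  rw [ENNReal.toReal_mul, ENNReal.toReal_mul, ENNReal.coe_toReal] at h4
  have h5 : 0 ≤ (eLpNorm (weakGrad Ω u) (ENNReal.ofReal p) (volume.restrict Ω)).toReal :=
    ENNReal.toReal_nonneg
  linarith

theorem Admissible.exists_test_pos (ha : Admissible Ω p q r η) :
    ∃ φ : E n → ℝ, IsTestFunction Ω φ ∧ (∀ x, 0 ≤ φ x) ∧
      0 < volume.restrict Ω (Function.support φ) := by
  obtain ⟨x, hx⟩ := ha.nonempty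
  obtain ⟨φ, h1, h2, h3, h4, h5⟩ := exists_contDiff_tsupport_subset (n := ⊤)
    (ha.isOpen.mem_nhds hx)
  refine ⟨φ, ⟨h3, h2, h1⟩, fun x => (h4 ⟨x, rfl⟩).1, ?_⟩
  have ho : IsOpen (Function.support φ) := h3.continuous.isOpen_support
  rw [Measure.restrict_apply ho.measurableSet,
    inter_eq_left.2 ((subset_tsupport φ).trans h1)]
  exact ho.measure_pos _ ⟨x, by rw [Function.mem_support, h5]; exact one_ne_zero⟩

/-! ### The energy of the system as a fibered system -/

/-- The hypotheses on the data of the system. -/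
structure SystemData {n : ℕ} (Ω : Set (E n)) (p q ν κ₁ κ₂ : ℝ) (η a₁ a₂ : E n → ℝ) : Prop where
  adm : Admissible Ω p q ((κ₁ + 1) + (κ₂ + 1)) η
  ν_pos : 0 < ν
  ν_lt : ν < 1
  q_lt₁ : q < κ₁ + 1
  q_lt₂ : q < κ₂ + 1
  memLp₁ : MemLp a₁ ⊤ (volume.restrict Ω)
  pos₁ : ∀ᵐ z ∂volume.restrict Ω, 0 < a₁ z
  memLp₂ : MemLp a₂ ⊤ (volume.restrict Ω)
  pos₂ : ∀ᵐ z ∂volume.restrict Ω, 0 < a₂ z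

/-- The sublinear functional `∫_Ω a |u|^α`. -/
noncomputable def sublinear {n : ℕ} (Ω : Set (E n)) (a : E n → ℝ) (α : ℝ) (u : E n → ℝ) : ℝ :=
  ∫ z in Ω, a z * |u z| ^ α

/-- The coupling functional `∫_Ω |u|^a |v|^b`. -/
noncomputable def coupling {n : ℕ} (Ω : Set (E n)) (a b : ℝ) (u v : E n → ℝ) : ℝ :=
  ∫ z in Ω, |u z| ^ a * |v z| ^ b

section

variable {n : ℕ} {Ω : Set (E n)} {p q r α : ℝ} {η a : E n → ℝ}

theorem sublinear_smul (Ω : Set (E n)) (a : E n → ℝ) (α : ℝ) (u : E n → ℝ) {t : ℝ} (ht : 0 < t) :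
    sublinear Ω a α (t • u) = t ^ α * sublinear Ω a α u := by
  rw [sublinear, sublinear, ← integral_const_mul]
  refine integral_congr_ae (.of_forall fun z => ?_)
  simp only [Pi.smul_apply, smul_eq_mul]
  rw [abs_mul, abs_of_pos ht, Real.mul_rpow ht.le (abs_nonneg _)]
  ring

theorem coupling_smul (Ω : Set (E n)) (a b : ℝ) (u v : E n → ℝ) {t : ℝ} (ht : 0 < t) :
    coupling Ω a b (t • u) (t • v) = t ^ (a + b) * coupling Ω a b u v := by
  rw [coupling, coupling, ← integral_const_mul]
  refine integral_congr_ae (.of_forall fun z => ?_)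
  simp only [Pi.smul_apply, smul_eq_mul]
  rw [abs_mul, abs_mul, abs_of_pos ht, Real.mul_rpow ht.le (abs_nonneg _),
    Real.mul_rpow ht.le (abs_nonneg _), Real.rpow_add ht]
  ring

theorem coupling_nonneg (Ω : Set (E n)) (a b : ℝ) (u v : E n → ℝ) : 0 ≤ coupling Ω a b u v :=
  integral_nonneg fun _ => mul_nonneg (Real.rpow_nonneg (abs_nonneg _) _)
    (Real.rpow_nonneg (abs_nonneg _) _)

theorem sublinear_nonneg (hpos : ∀ᵐ z ∂volume.restrict Ω, 0 < a z) (α : ℝ) (u : E n → ℝ) :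
    0 ≤ sublinear Ω a α u :=
  integral_nonneg_of_ae (by
    filter_upwards [hpos] with z hz
    exact mul_nonneg hz.le (Real.rpow_nonneg (abs_nonneg _) _))

theorem Admissible.integrable_sublinear (hA : Admissible Ω p q r η) (h0 : 0 < α) (h1 : α ≤ 1)
    (ha : MemLp a ⊤ (volume.restrict Ω)) {u : E n → ℝ}
    (hu : MemLp u 1 (volume.restrict Ω)) :
    Integrable (fun z => a z * |u z| ^ α) (volume.restrict Ω) := by
  have := hA.isFiniteMeasure
  exact (tendsto_integral_sublinear (l := (atTop : Filter ℕ)) h0 h1 ha (f := fun _ => u)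
    (fun _ => hu) hu (by simp)).2.1

theorem Admissible.tendsto_sublinear (hA : Admissible Ω p q r η) (h0 : 0 < α) (h1 : α ≤ 1)
    (ha : MemLp a ⊤ (volume.restrict Ω)) {ι : Type*} {l : Filter ι} {f : ι → E n → ℝ}
    {u : E n → ℝ} (hf : ∀ i, MemLp (f i) (ENNReal.ofReal r) (volume.restrict Ω))
    (hu : MemLp u (ENNReal.ofReal r) (volume.restrict Ω))
    (h : Tendsto (fun i => eLpNorm (f i - u) (ENNReal.ofReal r) (volume.restrict Ω)) l (𝓝 0)) :
    Tendsto (fun i => sublinear Ω a α (f i)) l (𝓝 (sublinear Ω a α u)) := by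
  have := hA.isFiniteMeasure
  exact (tendsto_integral_sublinear h0 h1 ha
    (fun i => (hf i).mono_exponent hA.one_le_ofReal_r) (hu.mono_exponent hA.one_le_ofReal_r)
    (tendsto_eLpNorm_of_exponent_le hA.one_le_ofReal_r one_ne_zero ENNReal.ofReal_ne_top
      (fun i => ((hf i).sub hu).1) h)).2.2

theorem Admissible.exists_sublinear_le (hA : Admissible Ω p q r η) (h0 : 0 < α) (h1 : α ≤ 1)
    (ha : MemLp a ⊤ (volume.restrict Ω)) :
    ∃ C : ℝ, 0 < C ∧ ∀ u, MemW01H Ω p q η u →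
      sublinear Ω a α u ≤ C * dirichlet Ω (volume.restrict Ω) p u ^ (α / p) := by
  obtain ⟨C, hC, h⟩ := hA.exists_integral_le h0 (h1.trans (hA.one_lt_r.trans hA.r_lt).le)
  set N : ℝ := (eLpNorm a ⊤ (volume.restrict Ω)).toReal + 1 with hN
  have hN0 : 0 < N := add_pos_of_nonneg_of_pos ENNReal.toReal_nonneg one_pos
  refine ⟨N * C, mul_pos hN0 hC, fun u hu => ?_⟩
  obtain ⟨hi, hle⟩ := h u hu
  have hb : ∀ᵐ z ∂volume.restrict Ω, a z ≤ N := by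
    filter_upwards [ae_le_eLpNormEssSup (f := a) (μ := volume.restrict Ω)] with z hz
    rw [← eLpNorm_exponent_top] at hz
    have h2 := ENNReal.toReal_mono ha.2.ne hz
    rw [toReal_enorm, Real.norm_eq_abs] at h2
    linarith [le_abs_self (a z)]
  calc sublinear Ω a α u ≤ ∫ z in Ω, N * |u z| ^ α := by
        refine integral_mono_ae (hA.integrable_sublinear h0 h1 ha ((hu.isW0 hA).memLp_one hA))
          (hi.const_mul N) ?_
        filter_upwards [hb] with z hz
        exact mul_le_mul_of_nonneg_right hz (Real.rpow_nonneg (abs_nonneg _) _)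
    _ = N * ∫ z in Ω, |u z| ^ α := integral_const_mul _ _
    _ ≤ N * C * dirichlet Ω (volume.restrict Ω) p u ^ (α / p) := by
        rw [mul_assoc]
        exact mul_le_mul_of_nonneg_left hle hN0.le

theorem rpow_mul_rpow_le {a b x y : ℝ} (ha : 0 ≤ a) (hb : 0 ≤ b) (hx : 0 ≤ x) (hy : 0 ≤ y) :
    x ^ a * y ^ b ≤ x ^ (a + b) + y ^ (a + b) := by
  have h1 := Real.rpow_nonneg hx (a + b)
  have h2 := Real.rpow_nonneg hy (a + b)
  rcases le_total x y with h | h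
  · have := mul_le_mul_of_nonneg_right (Real.rpow_le_rpow hx h ha) (Real.rpow_nonneg hy b)
    rw [← Real.rpow_add_of_nonneg hy ha hb] at this
    linarith
  · have := mul_le_mul_of_nonneg_left (Real.rpow_le_rpow hy h hb) (Real.rpow_nonneg hx a)
    rw [← Real.rpow_add_of_nonneg hx ha hb] at this
    linarith

theorem integrable_coupling {a b : ℝ} (h0 : 0 < a) (h1 : 0 < b)
    (hab : 1 ≤ a + b) {u v : E n → ℝ}
    (hu : MemLp u (ENNReal.ofReal (a + b)) (volume.restrict Ω))
    (hv : MemLp v (ENNReal.ofReal (a + b)) (volume.restrict Ω)) :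
    Integrable (fun z => |u z| ^ a * |v z| ^ b) (volume.restrict Ω) :=
  (tendsto_integral_coupling (l := (atTop : Filter ℕ)) h0 h1 hab (f := fun _ => u)
    (g := fun _ => v) (fun _ => hu) (fun _ => hv) hu hv (by simp) (by simp)).2.1

theorem exists_coupling_le {a b : ℝ} (hA : Admissible Ω p q (a + b) η) (h0 : 0 < a) (h1 : 0 < b) :
    ∃ C : ℝ, 0 < C ∧ ∀ u v, MemW01H Ω p q η u → MemW01H Ω p q η v →
      coupling Ω a b u v ≤ C * (dirichlet Ω (volume.restrict Ω) p u ^ ((a + b) / p) +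
        dirichlet Ω (volume.restrict Ω) p v ^ ((a + b) / p)) := by
  obtain ⟨C, hC, h⟩ := hA.exists_integral_le hA.r_pos hA.r_lt.le
  refine ⟨C, hC, fun u v hu hv => ?_⟩
  obtain ⟨hi, hle⟩ := h u hu
  obtain ⟨hi', hle'⟩ := h v hv
  calc coupling Ω a b u v ≤ ∫ z in Ω, (|u z| ^ (a + b) + |v z| ^ (a + b)) :=
        integral_mono (integrable_coupling h0 h1 hA.one_lt_r.le ((hu.isW0 hA).memLp_r hA)
          ((hv.isW0 hA).memLp_r hA)) (hi.add hi')
          fun z => rpow_mul_rpow_le h0.le h1.le (abs_nonneg _) (abs_nonneg _)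
    _ = (∫ z in Ω, |u z| ^ (a + b)) + ∫ z in Ω, |v z| ^ (a + b) := integral_add hi hi'
    _ ≤ _ := by rw [mul_add]; exact add_le_add hle hle'

theorem sublinear_pos_of_coupling_pos (hA : Admissible Ω p q r η) (h0 : 0 < α) (h1 : α ≤ 1)
    (ha : MemLp a ⊤ (volume.restrict Ω)) (hpos : ∀ᵐ z ∂volume.restrict Ω, 0 < a z)
    {b c : ℝ} (hb : 0 < b) {u v : E n → ℝ} (hu : MemLp u 1 (volume.restrict Ω))
    (h : 0 < coupling Ω b c u v) : 0 < sublinear Ω a α u := by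
  refine lt_of_le_of_ne (sublinear_nonneg hpos α u) fun h2 => ?_
  have h3 := (integral_eq_zero_iff_of_nonneg_ae (by
    filter_upwards [hpos] with z hz
    exact mul_nonneg hz.le (Real.rpow_nonneg (abs_nonneg _) _))
    (hA.integrable_sublinear h0 h1 ha hu)).1 h2.symm
  have h4 : coupling Ω b c u v = 0 := by
    refine integral_eq_zero_of_ae ?_
    filter_upwards [h3, hpos] with z hz hz'
    have : |u z| = 0 := by
      by_contra hne
      have : 0 < |u z| := lt_of_le_of_ne (abs_nonneg _) (Ne.symm hne)
      exact (mul_pos hz' (Real.rpow_pos_of_pos this α)).ne' hz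
    simp only [Pi.zero_apply]
    rw [this, Real.zero_rpow hb.ne', zero_mul]
  linarith

theorem tendsto_mid {w : ℕ → E n → ℝ} {u : E n → ℝ} {s : ENNReal} (hs : 1 ≤ s)
    {m : Measure (E n)} (hw : ∀ k, AEStronglyMeasurable (w k) m) (hu : AEStronglyMeasurable u m)
    (h : Tendsto (fun k => eLpNorm (w k - u) s m) atTop (𝓝 0)) :
    Tendsto (fun k : ℕ × ℕ => eLpNorm (mid (w k.1) (w k.2) - u) s m) atTop (𝓝 0) := by
  have h2 : Tendsto (fun k : ℕ × ℕ => eLpNorm (w k.1 - u) s m + eLpNorm (w k.2 - u) s m) atTop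
      (𝓝 0) := by
    rw [← prod_atTop_atTop_eq]
    simpa using (h.comp tendsto_fst).add (h.comp tendsto_snd)
  refine tendsto_of_tendsto_of_tendsto_of_le_of_le tendsto_const_nhds h2 (fun _ => zero_le)
    fun k => ?_
  have e : mid (w k.1) (w k.2) - u = (1 / 2 : ℝ) • ((w k.1 - u) + (w k.2 - u)) := by
    rw [mid]; module
  rw [e, eLpNorm_const_smul]
  refine le_trans ?_ (eLpNorm_add_le ((hw _).sub hu) ((hw _).sub hu) hs)
  refine mul_le_of_le_one_left zero_le ?_
  rw [Real.enorm_of_nonneg (by norm_num)]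
  exact ENNReal.ofReal_le_one.2 (by norm_num)

theorem Admissible.exists_subseq (hA : Admissible Ω p q r η) {w : ℕ → E n → ℝ} (hw : ∀ k, MemW01H Ω p q η (w k)) {M : ℝ}
    (hM : ∀ k, dirichlet Ω (volume.restrict Ω) p (w k) ≤ M) :
    ∃ (ns : ℕ → ℕ) (u : E n → ℝ), StrictMono ns ∧
      MemLp u (ENNReal.ofReal r) (volume.restrict Ω) ∧
      Tendsto (fun k => eLpNorm (w (ns k) - u) (ENNReal.ofReal r)
        (volume.restrict Ω)) atTop (𝓝 0) := by
  refine IsW0.exists_subseq hA (fun k => (hw k).isW0 hA) (M := (M ^ p⁻¹).toNNReal)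
    fun k => ?_
  have hm := ((hw k).isW0 hA).memLp_grad hA
  have h0 : 0 ≤ dirichlet Ω (volume.restrict Ω) p (w k) := IsPhase.dirichlet_nonneg _ _ _
  have h1 := Real.rpow_le_rpow h0 (hM k) (inv_nonneg.2 hA.p_pos.le)
  rw [dirichlet, integral_norm_rpow_eq hA.p_pos hm, ← Real.rpow_mul ENNReal.toReal_nonneg,
    mul_inv_cancel₀ hA.p_pos.ne', Real.rpow_one] at h1
  rw [← ENNReal.ofReal_toReal hm.2.ne]
  exact ENNReal.ofReal_le_ofReal h1

theorem Admissible.exists_limit (hA : Admissible Ω p q r η) {w : ℕ → E n → ℝ} {u : E n → ℝ} (hw : ∀ k, MemW01H Ω p q η (w k))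
    (hu : MemLp u (ENNReal.ofReal r) (volume.restrict Ω))
    (h : Tendsto (fun k => eLpNorm (w k - u) (ENNReal.ofReal r)
        (volume.restrict Ω)) atTop (𝓝 0))
    (h1 : Tendsto (fun k : ℕ × ℕ => eLpNorm (weakGrad Ω (w k.1) - weakGrad Ω (w k.2))
      (ENNReal.ofReal p) (volume.restrict Ω)) atTop (𝓝 0))
    (h2 : Tendsto (fun k : ℕ × ℕ => eLpNorm (weakGrad Ω (w k.1) - weakGrad Ω (w k.2))
      (ENNReal.ofReal q) (weighted Ω η)) atTop (𝓝 0)) :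
    MemW01H Ω p q η u ∧
      Tendsto (fun k => dirichlet Ω (volume.restrict Ω) p (w k)) atTop
        (𝓝 (dirichlet Ω (volume.restrict Ω) p u)) ∧
      Tendsto (fun k => dirichlet Ω (weighted Ω η) q (w k)) atTop
        (𝓝 (dirichlet Ω (weighted Ω η) q u)) := by
  have := hA.isFiniteMeasure
  have hlim := tendsto_eLpNorm_of_exponent_le
    (ENNReal.ofReal_le_ofReal (hA.p_lt_q.trans hA.q_lt_r).le)
    (ENNReal.ofReal_pos.2 hA.p_pos).ne' ENNReal.ofReal_ne_top
    (fun k => ((hw k).isW0 hA).aesm.sub hu.1) h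
  obtain ⟨g, hg, l1, l2⟩ := IsW0.exists_limit hA (fun k => (hw k).isW0 hA) hu.1 hlim h1 h2
  exact ⟨hg.memW01H hA,
    hA.isPhase_p.tendsto_dirichlet_of_sub hA (fun k => (hw k).isW0 hA) hg l1,
    hA.isPhase_q.tendsto_dirichlet_of_sub hA (fun k => (hw k).isW0 hA) hg l2⟩

end

namespace SystemData

variable {n : ℕ} {Ω : Set (E n)} {p q ν κ₁ κ₂ : ℝ} {η a₁ a₂ : E n → ℝ}

/-- The space of pairs of functions in `W_0^{1,H}(Ω)`. -/
abbrev Pair (d : SystemData Ω p q ν κ₁ κ₂ η a₁ a₂) : Type := d.adm.W0 × d.adm.W0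

variable (d : SystemData Ω p q ν κ₁ κ₂ η a₁ a₂)

theorem α_pos (d : SystemData Ω p q ν κ₁ κ₂ η a₁ a₂) : 0 < 1 - ν := by linarith [d.ν_lt]
theorem α_lt (d : SystemData Ω p q ν κ₁ κ₂ η a₁ a₂) : 1 - ν < 1 := by linarith [d.ν_pos]
theorem κ₁_pos (d : SystemData Ω p q ν κ₁ κ₂ η a₁ a₂) : 0 < κ₁ := by linarith [d.q_lt₁, d.adm.one_lt_q]
theorem κ₂_pos (d : SystemData Ω p q ν κ₁ κ₂ η a₁ a₂) : 0 < κ₂ := by linarith [d.q_lt₂, d.adm.one_lt_q]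

/-- The pointwise absolute value of a pair. -/
noncomputable def absPair (y : d.Pair) : d.Pair :=
  (⟨fun z => |(y.1 : E n → ℝ) z|, ((MemW01H.isW0 d.adm y.1.2).abs d.adm).memW01H d.adm⟩,
   ⟨fun z => |(y.2 : E n → ℝ) z|, ((MemW01H.isW0 d.adm y.2.2).abs d.adm).memW01H d.adm⟩)

/-- The sum of the Dirichlet integrals of the two components. -/
noncomputable def dirichletPair (m : Measure (E n)) (s : ℝ) (y : d.Pair) : ℝ :=
  dirichlet Ω m s y.1 + dirichlet Ω m s y.2

/-- The sum of the sublinear functionals of the two components, the term of the energy with a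
singular derivative. -/
noncomputable def sublinearPair (y : d.Pair) : ℝ :=
  sublinear Ω a₁ (1 - ν) y.1 + sublinear Ω a₂ (1 - ν) y.2

/-- The coupling term of a pair. -/
noncomputable def couplingPair (y : d.Pair) : ℝ := coupling Ω (κ₁ + 1) (κ₂ + 1) y.1 y.2

theorem dirichlet_le_pair_fst (m : Measure (E n)) (s : ℝ) (y : d.Pair) :
    dirichlet Ω m s y.1 ≤ d.dirichletPair m s y :=
  le_add_of_nonneg_right (IsPhase.dirichlet_nonneg _ _ _)

theorem dirichlet_le_pair_snd (m : Measure (E n)) (s : ℝ) (y : d.Pair) :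
    dirichlet Ω m s y.2 ≤ d.dirichletPair m s y :=
  le_add_of_nonneg_left (IsPhase.dirichlet_nonneg _ _ _)

theorem exists_sublinearPair_le : ∃ C : ℝ, 0 < C ∧ ∀ y : d.Pair,
    d.sublinearPair y ≤ C * d.dirichletPair (volume.restrict Ω) p y ^ ((1 - ν) / p) := by
  obtain ⟨C₁, hC₁, h₁⟩ := d.adm.exists_sublinear_le d.α_pos d.α_lt.le d.memLp₁
  obtain ⟨C₂, hC₂, h₂⟩ := d.adm.exists_sublinear_le d.α_pos d.α_lt.le d.memLp₂
  have hα : 0 ≤ (1 - ν) / p := div_nonneg d.α_pos.le d.adm.p_pos.le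
  refine ⟨C₁ + C₂, by positivity, fun y => ?_⟩
  rw [add_mul]
  refine add_le_add ((h₁ _ y.1.2).trans (mul_le_mul_of_nonneg_left ?_ hC₁.le))
    ((h₂ _ y.2.2).trans (mul_le_mul_of_nonneg_left ?_ hC₂.le))
  · exact Real.rpow_le_rpow (IsPhase.dirichlet_nonneg _ _ _) (d.dirichlet_le_pair_fst _ _ y) hα
  · exact Real.rpow_le_rpow (IsPhase.dirichlet_nonneg _ _ _) (d.dirichlet_le_pair_snd _ _ y) hα

theorem exists_couplingPair_le : ∃ C : ℝ, 0 < C ∧ ∀ y : d.Pair,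
    d.couplingPair y ≤
      C * d.dirichletPair (volume.restrict Ω) p y ^ (((κ₁ + 1) + (κ₂ + 1)) / p) := by
  obtain ⟨C, hC, h⟩ := exists_coupling_le d.adm (by linarith [d.κ₁_pos]) (by linarith [d.κ₂_pos])
  have hr : 0 ≤ ((κ₁ + 1) + (κ₂ + 1)) / p := div_nonneg d.adm.r_pos.le d.adm.p_pos.le
  refine ⟨C * 2, by positivity, fun y => (h _ _ y.1.2 y.2.2).trans ?_⟩
  rw [mul_assoc, two_mul]
  refine mul_le_mul_of_nonneg_left (add_le_add ?_ ?_) hC.le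
  · exact Real.rpow_le_rpow (IsPhase.dirichlet_nonneg _ _ _) (d.dirichlet_le_pair_fst _ _ y) hr
  · exact Real.rpow_le_rpow (IsPhase.dirichlet_nonneg _ _ _) (d.dirichlet_le_pair_snd _ _ y) hr

theorem tendsto_pair (d : SystemData Ω p q ν κ₁ κ₂ η a₁ a₂) {ι : Type*} {l : Filter ι} {f g : ι → E n → ℝ} {u v : E n → ℝ}
    (hf : ∀ i, MemW01H Ω p q η (f i)) (hg : ∀ i, MemW01H Ω p q η (g i))
    (hu : MemLp u (ENNReal.ofReal ((κ₁ + 1) + (κ₂ + 1))) (volume.restrict Ω))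
    (hv : MemLp v (ENNReal.ofReal ((κ₁ + 1) + (κ₂ + 1))) (volume.restrict Ω))
    (h : Tendsto (fun i => eLpNorm (f i - u) (ENNReal.ofReal ((κ₁ + 1) + (κ₂ + 1)))
      (volume.restrict Ω)) l (𝓝 0))
    (h' : Tendsto (fun i => eLpNorm (g i - v) (ENNReal.ofReal ((κ₁ + 1) + (κ₂ + 1)))
      (volume.restrict Ω)) l (𝓝 0)) :
    Tendsto (fun i => sublinear Ω a₁ (1 - ν) (f i) + sublinear Ω a₂ (1 - ν) (g i)) l
      (𝓝 (sublinear Ω a₁ (1 - ν) u + sublinear Ω a₂ (1 - ν) v)) ∧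
    Tendsto (fun i => coupling Ω (κ₁ + 1) (κ₂ + 1) (f i) (g i)) l
      (𝓝 (coupling Ω (κ₁ + 1) (κ₂ + 1) u v)) := by
  have hf' := fun i => ((hf i).isW0 d.adm).memLp_r d.adm
  have hg' := fun i => ((hg i).isW0 d.adm).memLp_r d.adm
  exact ⟨(d.adm.tendsto_sublinear d.α_pos d.α_lt.le d.memLp₁ hf' hu h).add
      (d.adm.tendsto_sublinear d.α_pos d.α_lt.le d.memLp₂ hg' hv h'),
    (tendsto_integral_coupling (by linarith [d.κ₁_pos]) (by linarith [d.κ₂_pos])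
      d.adm.one_lt_r.le hf' hg' hu hv h h').2.2⟩

theorem tendsto_pair_line (y h : d.Pair) :
    Tendsto (fun s : ℝ => d.sublinearPair (y + s • h)) (𝓝 0) (𝓝 (d.sublinearPair y)) ∧
    Tendsto (fun s : ℝ => d.couplingPair (y + s • h)) (𝓝 0) (𝓝 (d.couplingPair y)) := by
  have hr := fun u : d.adm.W0 => (MemW01H.isW0 d.adm u.2).memLp_r d.adm
  exact d.tendsto_pair (fun s => (y + s • h).1.2) (fun s => (y + s • h).2.2) (hr y.1) (hr y.2)
    (tendsto_eLpNorm_add_smul_sub _ (hr h.1)) (tendsto_eLpNorm_add_smul_sub _ (hr h.2))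

theorem exists_couplingPair_pos : ∃ y : d.Pair, 0 < d.couplingPair y := by
  obtain ⟨φ, hφ, h0, hpos⟩ := d.adm.exists_test_pos
  have := d.adm.isFiniteMeasure
  have hW := IsW0.of_test (p := p) (q := q) (η := η) hφ
  have hmem := hW.memW01H d.adm
  refine ⟨(⟨φ, hmem⟩, ⟨φ, hmem⟩), ?_⟩
  have hr := hW.memLp_r d.adm
  refine (integral_pos_iff_support_of_nonneg (fun z => mul_nonneg
    (Real.rpow_nonneg (abs_nonneg _) _) (Real.rpow_nonneg (abs_nonneg _) _))
    (integrable_coupling (by linarith [d.κ₁_pos]) (by linarith [d.κ₂_pos])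
      d.adm.one_lt_r.le hr hr)).2 (hpos.trans_le (measure_mono fun z hz => ?_))
  have : 0 < |φ z| := abs_pos.2 hz
  exact (mul_pos (Real.rpow_pos_of_pos this _) (Real.rpow_pos_of_pos this _)).ne'

theorem dirichletPair_mid_le {m : Measure (E n)} {s : ℝ} (H : IsPhase Ω p q η m s)
    (y z : d.Pair) :
    d.dirichletPair m s (mid y z) ≤ (d.dirichletPair m s y + d.dirichletPair m s z) / 2 := by
  have h1 := H.dirichlet_mid_le d.adm y.1.2 z.1.2
  have h2 := H.dirichlet_mid_le d.adm y.2.2 z.2.2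
  have e : d.dirichletPair m s (mid y z) =
    dirichlet Ω m s (mid (y.1 : E n → ℝ) z.1) + dirichlet Ω m s (mid (y.2 : E n → ℝ) z.2) := rfl
  rw [e, dirichletPair, dirichletPair]
  linarith

/-- Vanishing convexity defects of pairs force both gradients to be Cauchy. -/
theorem tendsto_grad_of_defect {m : Measure (E n)} {s : ℝ} (H : IsPhase Ω p q η m s)
    {u : ℕ → d.Pair} {M : ℝ} (hM : ∀ k, d.dirichletPair m s (u k) ≤ M)
    (h : Tendsto (fun k : ℕ × ℕ => (d.dirichletPair m s (u k.1) + d.dirichletPair m s (u k.2)) / 2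
      - d.dirichletPair m s (mid (u k.1) (u k.2))) atTop (𝓝 0)) :
    Tendsto (fun k : ℕ × ℕ => eLpNorm (weakGrad Ω (u k.1).1 - weakGrad Ω (u k.2).1)
      (ENNReal.ofReal s) m) atTop (𝓝 0) ∧
    Tendsto (fun k : ℕ × ℕ => eLpNorm (weakGrad Ω (u k.1).2 - weakGrad Ω (u k.2).2)
      (ENNReal.ofReal s) m) atTop (𝓝 0) := by
  have e : ∀ y z : d.Pair, d.dirichletPair m s (mid y z) =
    dirichlet Ω m s (mid (y.1 : E n → ℝ) z.1) + dirichlet Ω m s (mid (y.2 : E n → ℝ) z.2) :=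
    fun _ _ => rfl
  constructor
  · refine H.tendsto_grad_of_defect d.adm (M := M) (fun k : ℕ × ℕ => (u k.1).1.2)
      (fun k => (u k.2).1.2) (fun k => (d.dirichlet_le_pair_fst _ _ _).trans (hM k.1))
      (fun k => (d.dirichlet_le_pair_fst _ _ _).trans (hM k.2))
      (tendsto_of_tendsto_of_tendsto_of_le_of_le tendsto_const_nhds h (fun k => ?_) fun k => ?_)
    · simp only
      linarith [H.dirichlet_mid_le d.adm (u k.1).1.2 (u k.2).1.2]
    · have h2 := H.dirichlet_mid_le d.adm (u k.1).2.2 (u k.2).2.2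
      rw [e, dirichletPair, dirichletPair]
      linarith
  · refine H.tendsto_grad_of_defect d.adm (M := M) (fun k : ℕ × ℕ => (u k.1).2.2)
      (fun k => (u k.2).2.2) (fun k => (d.dirichlet_le_pair_snd _ _ _).trans (hM k.1))
      (fun k => (d.dirichlet_le_pair_snd _ _ _).trans (hM k.2))
      (tendsto_of_tendsto_of_tendsto_of_le_of_le tendsto_const_nhds h (fun k => ?_) fun k => ?_)
    · simp only
      linarith [H.dirichlet_mid_le d.adm (u k.1).2.2 (u k.2).2.2]
    · have h2 := H.dirichlet_mid_le d.adm (u k.1).1.2 (u k.2).1.2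
      rw [e, dirichletPair, dirichletPair]
      linarith

/-- The compactness property of the energy: by Rellich–Kondrachov a subsequence converges in `L^r`,
which determines the limits of the sublinear and coupling terms at midpoints; when the convexity
defects of the Dirichlet integrals vanish, the gradients are Cauchy. -/
theorem compact (u : ℕ → d.Pair) (M : ℝ) (hA : ∀ k, d.dirichletPair (volume.restrict Ω) p (u k) ≤ M)
    (hB : ∀ k, d.dirichletPair (weighted Ω η) q (u k) ≤ M) :
    ∃ φ : ℕ → ℕ, StrictMono φ ∧ ∃ s k : ℝ,
      Tendsto (fun m : ℕ × ℕ => d.sublinearPair (mid (u (φ m.1)) (u (φ m.2)))) atTop (𝓝 s) ∧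
      Tendsto (fun m : ℕ × ℕ => d.couplingPair (mid (u (φ m.1)) (u (φ m.2)))) atTop (𝓝 k) ∧
      (Tendsto (fun m : ℕ × ℕ => (d.dirichletPair (volume.restrict Ω) p (u (φ m.1))
          + d.dirichletPair (volume.restrict Ω) p (u (φ m.2))) / 2
          - d.dirichletPair (volume.restrict Ω) p (mid (u (φ m.1)) (u (φ m.2)))) atTop (𝓝 0) →
       Tendsto (fun m : ℕ × ℕ => (d.dirichletPair (weighted Ω η) q (u (φ m.1))
          + d.dirichletPair (weighted Ω η) q (u (φ m.2))) / 2
          - d.dirichletPair (weighted Ω η) q (mid (u (φ m.1)) (u (φ m.2)))) atTop (𝓝 0) →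
       ∃ y, Tendsto (fun i => d.dirichletPair (volume.restrict Ω) p (u (φ i))) atTop
          (𝓝 (d.dirichletPair (volume.restrict Ω) p y)) ∧
        Tendsto (fun i => d.dirichletPair (weighted Ω η) q (u (φ i))) atTop
          (𝓝 (d.dirichletPair (weighted Ω η) q y)) ∧ d.sublinearPair y = s ∧
        d.couplingPair y = k) := by
  obtain ⟨n₁, v₁, hn₁, hv₁, l₁⟩ := d.adm.exists_subseq (fun k => (u k).1.2)
    fun k => (d.dirichlet_le_pair_fst _ _ _).trans (hA k)
  obtain ⟨n₂, v₂, hn₂, hv₂, l₂⟩ := d.adm.exists_subseq (fun k => (u (n₁ k)).2.2)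
    fun k => (d.dirichlet_le_pair_snd _ _ _).trans (hA (n₁ k))
  have l₁' : Tendsto (fun k => eLpNorm (((u (n₁ (n₂ k))).1 : E n → ℝ) - v₁)
      (ENNReal.ofReal ((κ₁ + 1) + (κ₂ + 1))) (volume.restrict Ω)) atTop (𝓝 0) :=
    l₁.comp hn₂.tendsto_atTop
  have hm₁ : ∀ k, AEStronglyMeasurable ((u (n₁ (n₂ k))).1 : E n → ℝ) (volume.restrict Ω) :=
    fun k => (MemW01H.isW0 d.adm (u _).1.2).aesm
  have hm₂ : ∀ k, AEStronglyMeasurable ((u (n₁ (n₂ k))).2 : E n → ℝ) (volume.restrict Ω) :=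
    fun k => (MemW01H.isW0 d.adm (u _).2.2).aesm
  have hmid : ∀ y z : d.Pair, MemW01H Ω p q η (mid (y.1 : E n → ℝ) z.1) ∧
      MemW01H Ω p q η (mid (y.2 : E n → ℝ) z.2) := fun y z => ⟨(mid y z).1.2, (mid y z).2.2⟩
  have hS : ∀ y z : d.Pair, d.sublinearPair (mid y z) =
      sublinear Ω a₁ (1 - ν) (mid (y.1 : E n → ℝ) z.1) +
        sublinear Ω a₂ (1 - ν) (mid (y.2 : E n → ℝ) z.2) := fun _ _ => rfl
  have hK : ∀ y z : d.Pair, d.couplingPair (mid y z) = coupling Ω (κ₁ + 1) (κ₂ + 1)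
      (mid (y.1 : E n → ℝ) z.1) (mid (y.2 : E n → ℝ) z.2) := fun _ _ => rfl
  have c₁ := tendsto_mid d.adm.one_le_ofReal_r hm₁ hv₁.1 l₁'
  have c₂ := tendsto_mid d.adm.one_le_ofReal_r hm₂ hv₂.1 l₂
  obtain ⟨t₁, t₂⟩ := d.tendsto_pair
    (f := fun m : ℕ × ℕ => mid ((u (n₁ (n₂ m.1))).1 : E n → ℝ) (u (n₁ (n₂ m.2))).1)
    (g := fun m : ℕ × ℕ => mid ((u (n₁ (n₂ m.1))).2 : E n → ℝ) (u (n₁ (n₂ m.2))).2)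
    (fun m => (hmid _ _).1) (fun m => (hmid _ _).2) hv₁ hv₂ c₁ c₂
  simp only [hS, hK]
  refine ⟨fun k => n₁ (n₂ k), hn₁.comp hn₂, _, _, t₁, t₂, fun d₁ d₂ => ?_⟩
  obtain ⟨p₁, p₂⟩ := d.tendsto_grad_of_defect d.adm.isPhase_p (u := fun k => u (n₁ (n₂ k)))
    (fun k => hA _) d₁
  obtain ⟨q₁, q₂⟩ := d.tendsto_grad_of_defect d.adm.isPhase_q (u := fun k => u (n₁ (n₂ k)))
    (fun k => hB _) d₂
  obtain ⟨w₁, A₁, B₁⟩ := d.adm.exists_limit (fun k => (u (n₁ (n₂ k))).1.2) hv₁ l₁' p₁ q₁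
  obtain ⟨w₂, A₂, B₂⟩ := d.adm.exists_limit (fun k => (u (n₁ (n₂ k))).2.2) hv₂ l₂ p₂ q₂
  refine ⟨(⟨v₁, w₁⟩, ⟨v₂, w₂⟩), ?_, ?_, rfl, rfl⟩
  · exact A₁.add A₂
  · exact B₁.add B₂

theorem sublinearPair_pos (y : d.Pair) (h : 0 < d.couplingPair y) : 0 < d.sublinearPair y :=
  add_pos_of_pos_of_nonneg
    (sublinear_pos_of_coupling_pos d.adm d.α_pos d.α_lt.le d.memLp₁ d.pos₁
      (by linarith [d.κ₁_pos]) ((MemW01H.isW0 d.adm y.1.2).memLp_one d.adm) h)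
    (sublinear_nonneg d.pos₂ _ _)

/-- The energy of the system in the abstract setting of the Nehari method. -/
noncomputable def toFibered : FiberedSystem d.Pair where
  A := d.dirichletPair (volume.restrict Ω) p
  B := d.dirichletPair (weighted Ω η) q
  S := d.sublinearPair
  K := d.couplingPair
  p := p
  q := q
  α := 1 - ν
  r := (κ₁ + 1) + (κ₂ + 1)
  C₁ := d.exists_sublinearPair_le.choose
  C₂ := d.exists_couplingPair_le.choose
  α_pos := d.α_pos
  α_lt := d.α_lt
  one_lt_p := d.adm.one_lt_p
  p_lt_q := d.adm.p_lt_q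
  q_lt_r := d.adm.q_lt_r
  C₁_pos := d.exists_sublinearPair_le.choose_spec.1
  C₂_pos := d.exists_couplingPair_le.choose_spec.1
  A_nonneg y := add_nonneg (IsPhase.dirichlet_nonneg _ _ _) (IsPhase.dirichlet_nonneg _ _ _)
  B_nonneg y := add_nonneg (IsPhase.dirichlet_nonneg _ _ _) (IsPhase.dirichlet_nonneg _ _ _)
  S_nonneg y := add_nonneg (sublinear_nonneg d.pos₁ _ _) (sublinear_nonneg d.pos₂ _ _)
  K_nonneg y := coupling_nonneg _ _ _ _ _
  A_smul t y ht := by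
    rw [dirichletPair, dirichletPair, mul_add]
    exact congrArg₂ (· + ·) (d.adm.isPhase_p.dirichlet_smul d.adm y.1.2 ht)
      (d.adm.isPhase_p.dirichlet_smul d.adm y.2.2 ht)
  B_smul t y ht := by
    rw [dirichletPair, dirichletPair, mul_add]
    exact congrArg₂ (· + ·) (d.adm.isPhase_q.dirichlet_smul d.adm y.1.2 ht)
      (d.adm.isPhase_q.dirichlet_smul d.adm y.2.2 ht)
  S_smul t y ht := by
    rw [sublinearPair, sublinearPair, mul_add]
    exact congrArg₂ (· + ·) (sublinear_smul _ _ _ _ ht) (sublinear_smul _ _ _ _ ht)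
  K_smul t y ht := coupling_smul _ _ _ _ _ ht
  S_le := d.exists_sublinearPair_le.choose_spec.2
  K_le := d.exists_couplingPair_le.choose_spec.2
  S_pos_of_K_pos := d.sublinearPair_pos
  A_mid := d.dirichletPair_mid_le d.adm.isPhase_p
  B_mid := d.dirichletPair_mid_le d.adm.isPhase_q
  exists_K_pos := d.exists_couplingPair_pos
  tendsto_A y h := (d.adm.isPhase_p.tendsto_dirichlet d.adm y.1.2 h.1.2).add
    (d.adm.isPhase_p.tendsto_dirichlet d.adm y.2.2 h.2.2)
  tendsto_B y h := (d.adm.isPhase_q.tendsto_dirichlet d.adm y.1.2 h.1.2).add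
    (d.adm.isPhase_q.tendsto_dirichlet d.adm y.2.2 h.2.2)
  tendsto_S y h := (d.tendsto_pair_line y h).1
  tendsto_K y h := (d.tendsto_pair_line y h).2
  compact := d.compact
  absV := d.absPair
  A_abs y := add_le_add (d.adm.isPhase_p.dirichlet_abs_le d.adm y.1.2)
    (d.adm.isPhase_p.dirichlet_abs_le d.adm y.2.2)
  B_abs y := add_le_add (d.adm.isPhase_q.dirichlet_abs_le d.adm y.1.2)
    (d.adm.isPhase_q.dirichlet_abs_le d.adm y.2.2)
  S_abs y := by
    simp only [sublinearPair, sublinear, absPair, abs_abs]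
  K_abs y := by
    simp only [couplingPair, coupling, absPair, abs_abs]

end SystemData

/-! ### Directional derivatives -/

theorem rpow_sub_two_mul_self {p x : ℝ} (hp : 1 < p) (hx : 0 ≤ x) :
    x ^ (p - 2) * x = x ^ (p - 1) := by
  rcases hx.eq_or_lt with rfl | hx
  · rw [mul_zero, Real.zero_rpow (by linarith)]
  · rw [← Real.rpow_add_one hx.ne']; congr 1; ring

section

variable {X : Type*} [MeasurableSpace X] {m : Measure X}

/-- The directional derivative of `∫ ‖g‖^p`. -/
theorem hasDerivAt_integral_norm_rpow {H : Type*} [NormedAddCommGroup H] [InnerProductSpace ℝ H]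
    {p : ℝ} (hp : 1 < p) {g h : X → H} (hg : MemLp g (ENNReal.ofReal p) m)
    (hh : MemLp h (ENNReal.ofReal p) m) :
    HasDerivAt (fun s : ℝ => ∫ z, ‖g z + s • h z‖ ^ p ∂m)
      (p * ∫ z, ‖g z‖ ^ (p - 2) * inner ℝ (g z) (h z) ∂m) 0 := by
  have hp0 : 0 < p := by linarith
  have hderiv : ∀ z (s : ℝ), HasDerivAt (fun s : ℝ => ‖g z + s • h z‖ ^ p)
      (p * ‖g z + s • h z‖ ^ (p - 2) * inner ℝ (g z + s • h z) (h z)) s := fun z s => by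
    have h1 : HasDerivAt (fun s : ℝ => g z + s • h z) (h z) s := by
      simpa using ((hasDerivAt_id s).smul_const (h z)).const_add (g z)
    exact (hasFDerivAt_norm_rpow _ hp).comp_hasDerivAt s h1
  have hM : Integrable (fun z => p * (‖g z‖ + ‖h z‖) ^ p) m := by
    have := (integrable_norm_rpow' hp0 (hg.norm.add hh.norm)).const_mul p
    refine this.congr (.of_forall fun z => ?_)
    simp only [Pi.add_apply]
    rw [Real.norm_of_nonneg (by positivity)]
  have hmeas : ∀ s : ℝ, AEStronglyMeasurable (fun z => ‖g z + s • h z‖ ^ p) m := fun s =>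
    (integrable_norm_rpow' hp0 (hg.add (hh.const_smul s))).1
  have hF' : AEStronglyMeasurable (fun z => p * ‖g z + (0 : ℝ) • h z‖ ^ (p - 2) *
      inner ℝ (g z + (0 : ℝ) • h z) (h z)) m := by
    simp only [zero_smul, add_zero]
    exact ((hg.1.norm.aemeasurable.pow_const _).const_mul p).aestronglyMeasurable.mul
      (hg.1.inner hh.1)
  have key := (hasDerivAt_integral_of_dominated_loc_of_deriv_le (μ := m)
    (F := fun (s : ℝ) z => ‖g z + s • h z‖ ^ p) (x₀ := 0)
    (bound := fun z => p * (‖g z‖ + ‖h z‖) ^ p)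
    (Metric.ball_mem_nhds (0 : ℝ) one_pos) (.of_forall hmeas)
    (by
      have := integrable_norm_rpow' hp0 (hg.add (hh.const_smul (0 : ℝ)))
      exact this) hF'
    (.of_forall fun z s hs => ?_) hM (.of_forall fun z s _ => hderiv z s)).2
  · refine key.congr_deriv ?_
    rw [← integral_const_mul]
    refine integral_congr_ae (.of_forall fun z => ?_)
    simp only [zero_smul, add_zero]
    ring
  · have hs1 : |s| ≤ 1 := by
      rw [mem_ball_zero_iff, Real.norm_eq_abs] at hs
      exact hs.le
    set x := g z + s • h z with hx
    set M := ‖g z‖ + ‖h z‖ with hMz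
    have hM0 : 0 ≤ M := by positivity
    have hxM : ‖x‖ ≤ M := by
      refine (norm_add_le _ _).trans (add_le_add le_rfl ?_)
      rw [norm_smul, Real.norm_eq_abs]
      exact mul_le_of_le_one_left (norm_nonneg _) hs1
    have hhM : ‖h z‖ ≤ M := le_add_of_nonneg_left (norm_nonneg _)
    calc ‖p * ‖x‖ ^ (p - 2) * inner ℝ x (h z)‖
        = p * ‖x‖ ^ (p - 2) * ‖(inner ℝ x (h z) : ℝ)‖ := by
          rw [norm_mul, Real.norm_of_nonneg (by positivity)]
      _ ≤ p * ‖x‖ ^ (p - 2) * (‖x‖ * ‖h z‖) := by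
          gcongr; exact norm_inner_le_norm _ _
      _ = p * (‖x‖ ^ (p - 1) * ‖h z‖) := by
          rw [← rpow_sub_two_mul_self hp (norm_nonneg x)]; ring
      _ ≤ p * (M ^ (p - 1) * M) := by
          gcongr
      _ = p * M ^ p := by
          rw [← rpow_sub_two_mul_self hp hM0, mul_assoc, ← pow_two]
          congr 1
          rcases hM0.eq_or_lt with h0 | h0
          · rw [← h0, Real.zero_rpow hp0.ne']; simp
          · rw [← Real.rpow_natCast, ← Real.rpow_add h0]; congr 1; norm_num

/-- The directional derivative of `∫ |u|^a |v|^b`. -/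
theorem hasDerivAt_integral_coupling {a b : ℝ} (ha : 1 < a) (hb : 1 < b)
    {u v h k : X → ℝ} (hu : MemLp u (ENNReal.ofReal (a + b)) m)
    (hv : MemLp v (ENNReal.ofReal (a + b)) m) (hh : MemLp h (ENNReal.ofReal (a + b)) m)
    (hk : MemLp k (ENNReal.ofReal (a + b)) m) :
    HasDerivAt (fun s : ℝ => ∫ z, |u z + s * h z| ^ a * |v z + s * k z| ^ b ∂m)
      (a * (∫ z, |u z| ^ (a - 2) * u z * |v z| ^ b * h z ∂m) +
        b * ∫ z, |u z| ^ a * (|v z| ^ (b - 2) * v z) * k z ∂m) 0 := by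
  have hr : 0 < a + b := by linarith
  have hderiv : ∀ z (s : ℝ), HasDerivAt (fun s : ℝ => |u z + s * h z| ^ a * |v z + s * k z| ^ b)
      (a * |u z + s * h z| ^ (a - 2) * (u z + s * h z) * h z * |v z + s * k z| ^ b +
        |u z + s * h z| ^ a * (b * |v z + s * k z| ^ (b - 2) * (v z + s * k z) * k z)) s :=
    fun z s => by
      have h1 : ∀ x y : ℝ, HasDerivAt (fun s : ℝ => x + s * y) y s := fun x y => by
        simpa using ((hasDerivAt_id s).mul_const y).const_add x
      exact ((hasDerivAt_abs_rpow _ ha).comp s (h1 (u z) (h z))).mul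
        ((hasDerivAt_abs_rpow _ hb).comp s (h1 (v z) (k z)))
  set M : X → ℝ := fun z => |u z| + |h z| + |v z| + |k z| with hM
  have hM0 : ∀ z, 0 ≤ M z := fun z => by positivity
  have hMi : Integrable (fun z => M z ^ (a + b)) m := by
    have := integrable_norm_rpow' hr (((hu.norm.add hh.norm).add hv.norm).add hk.norm)
    refine this.congr (.of_forall fun z => ?_)
    simp only [Pi.add_apply, Real.norm_eq_abs]
    rw [abs_of_nonneg (hM0 z)]
  have hbound : ∀ {a b : ℝ}, 1 < a → 0 ≤ b → ∀ {x y w M : ℝ}, |x| ≤ M → |y| ≤ M → |w| ≤ M →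
      |(|x| ^ (a - 2) * x * |y| ^ b * w)| ≤ M ^ (a + b) := fun {a b} ha hb {x y w M} hx hy hw => by
    have hM0 : 0 ≤ M := (abs_nonneg x).trans hx
    have e : |(|x| ^ (a - 2) * x * |y| ^ b * w)| = |x| ^ (a - 1) * |y| ^ b * |w| := by
      rw [abs_mul, abs_mul, abs_mul, abs_of_nonneg (Real.rpow_nonneg (abs_nonneg x) _),
        abs_of_nonneg (Real.rpow_nonneg (abs_nonneg y) _), rpow_sub_two_mul_self ha (abs_nonneg x)]
    rw [e]
    calc |x| ^ (a - 1) * |y| ^ b * |w| ≤ M ^ (a - 1) * M ^ b * M ^ (1 : ℝ) := by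
          rw [Real.rpow_one]
          have := Real.rpow_le_rpow (abs_nonneg x) hx (by linarith : 0 ≤ a - 1)
          have := Real.rpow_le_rpow (abs_nonneg y) hy hb
          gcongr
      _ = M ^ (a + b) := by
          rw [← Real.rpow_add_of_nonneg hM0 (by linarith) hb,
            ← Real.rpow_add_of_nonneg hM0 (by linarith) zero_le_one]
          congr 1; ring
  have hle : ∀ z, |u z| ≤ M z ∧ |v z| ≤ M z ∧ |h z| ≤ M z ∧ |k z| ≤ M z := fun z => by
    have h1 := abs_nonneg (u z); have h2 := abs_nonneg (v z)
    have h3 := abs_nonneg (h z); have h4 := abs_nonneg (k z)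
    simp only [hM]
    refine ⟨?_, ?_, ?_, ?_⟩ <;> linarith
  have hi1 : Integrable (fun z => |u z| ^ (a - 2) * u z * |v z| ^ b * h z) m := by
    refine hMi.mono' ?_ (.of_forall fun z => hbound ha (by linarith) (hle z).1 (hle z).2.1
      (hle z).2.2.1)
    exact ((((hu.1.norm.aemeasurable.pow_const _).mul hu.1.aemeasurable).mul
      (hv.1.norm.aemeasurable.pow_const _)).mul hh.1.aemeasurable).aestronglyMeasurable
  have hi2 : Integrable (fun z => |u z| ^ a * (|v z| ^ (b - 2) * v z) * k z) m := by
    refine hMi.mono' ?_ (.of_forall fun z => ?_)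
    · exact (((hu.1.norm.aemeasurable.pow_const _).mul ((hv.1.norm.aemeasurable.pow_const _).mul
        hv.1.aemeasurable)).mul hk.1.aemeasurable).aestronglyMeasurable
    · have := hbound (a := b) (b := a) hb (by linarith) (hle z).2.1 (hle z).1 (hle z).2.2.2
      rw [add_comm b a] at this
      refine le_trans (le_of_eq ?_) this
      rw [Real.norm_eq_abs]; congr 1; ring
  have hsm : ∀ {f g : X → ℝ}, MemLp f (ENNReal.ofReal (a + b)) m →
      MemLp g (ENNReal.ofReal (a + b)) m → ∀ s : ℝ,
      AEMeasurable (fun z => |f z + s * g z|) m := fun hf hg s =>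
    (hf.1.add (hg.1.const_mul s)).norm.aemeasurable
  have key := (hasDerivAt_integral_of_dominated_loc_of_deriv_le (μ := m)
    (F := fun (s : ℝ) z => |u z + s * h z| ^ a * |v z + s * k z| ^ b) (x₀ := 0)
    (F' := fun (s : ℝ) z =>
      a * |u z + s * h z| ^ (a - 2) * (u z + s * h z) * h z * |v z + s * k z| ^ b +
        |u z + s * h z| ^ a * (b * |v z + s * k z| ^ (b - 2) * (v z + s * k z) * k z))
    (bound := fun z => (a + b) * M z ^ (a + b))
    (Metric.ball_mem_nhds (0 : ℝ) one_pos)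
    (.of_forall fun s => (((hsm hu hh s).pow_const a).mul
      ((hsm hv hk s).pow_const b)).aestronglyMeasurable) ?_ ?_
    (.of_forall fun z s hs => ?_) (hMi.const_mul _) (.of_forall fun z s _ => hderiv z s)).2
  · refine key.congr_deriv ?_
    rw [← integral_const_mul, ← integral_const_mul, ← integral_add (hi1.const_mul a)
      (hi2.const_mul b)]
    refine integral_congr_ae (.of_forall fun z => ?_)
    simp only [zero_mul, add_zero]
    ring
  · simp only [zero_mul, add_zero]
    exact (tendsto_integral_coupling (l := (atTop : Filter ℕ)) (by linarith) (by linarith)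
      (by linarith) (f := fun _ => u)
      (g := fun _ => v) (fun _ => hu) (fun _ => hv) hu hv (by simp) (by simp)).2.1
  · have := ((hi1.const_mul a).add (hi2.const_mul b)).1
    refine this.congr (.of_forall fun z => ?_)
    simp only [zero_mul, add_zero, Pi.add_apply]
    ring
  · have hs1 : |s| ≤ 1 := by
      rw [mem_ball_zero_iff, Real.norm_eq_abs] at hs
      exact hs.le
    have hx : |u z + s * h z| ≤ M z := by
      refine (abs_add_le _ _).trans ?_
      rw [abs_mul]
      have h2 := abs_nonneg (v z); have h4 := abs_nonneg (k z)
      have := mul_le_of_le_one_left (abs_nonneg (h z)) hs1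
      simp only [hM]; linarith
    have hy : |v z + s * k z| ≤ M z := by
      refine (abs_add_le _ _).trans ?_
      rw [abs_mul]
      have h2 := abs_nonneg (u z); have h4 := abs_nonneg (h z)
      have := mul_le_of_le_one_left (abs_nonneg (k z)) hs1
      simp only [hM]; linarith
    have b1 := hbound ha (by linarith : 0 ≤ b) hx hy (hle z).2.2.1
    have b2 := hbound (a := b) (b := a) hb (by linarith) hy hx (hle z).2.2.2
    rw [add_comm b a] at b2
    set x := u z + s * h z
    set y := v z + s * k z
    have e : a * |x| ^ (a - 2) * x * h z * |y| ^ b + |x| ^ a * (b * |y| ^ (b - 2) * y * k z) =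
      a * (|x| ^ (a - 2) * x * |y| ^ b * h z) + b * (|y| ^ (b - 2) * y * |x| ^ a * k z) := by ring
    rw [e, Real.norm_eq_abs]
    refine (abs_add_le _ _).trans ?_
    rw [abs_mul, abs_mul b, abs_of_pos (by linarith : 0 < a), abs_of_pos (by linarith : 0 < b),
      add_mul]
    exact add_le_add (mul_le_mul_of_nonneg_left b1 (by linarith))
      (mul_le_mul_of_nonneg_left b2 (by linarith))

theorem abs_rpow_sub_le_of_pos {α : ℝ} (h0 : 0 < α) (h1 : α ≤ 1) {y : ℝ} (hy : 0 < y) (x : ℝ) :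
    |(|x| ^ α - y ^ α)| ≤ y ^ (α - 1) * |x - y| := by
  have hyα : 0 < y ^ (α - 1) := Real.rpow_pos_of_pos hy _
  have e1 : y ^ α = y ^ (α - 1) * y := by
    rw [← Real.rpow_add_one hy.ne']; congr 1; ring
  have hτ : |x| ^ α = y ^ α * (|x| / y) ^ α := by
    rw [← Real.mul_rpow hy.le (by positivity), mul_div_cancel₀ _ hy.ne']
  have hyα' : 0 < y ^ α := Real.rpow_pos_of_pos hy _
  have hd : |(|x| - y)| ≤ |x - y| := by
    have := abs_abs_sub_abs_le_abs_sub x y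
    rwa [abs_of_pos hy] at this
  have h2 : |(|x| ^ α - y ^ α)| ≤ y ^ α * |(|x| / y - 1)| := by
    rw [hτ, ← mul_sub_one, abs_mul, abs_of_pos hyα']
    refine mul_le_mul_of_nonneg_left ?_ hyα'.le
    have ht : 0 ≤ |x| / y := by positivity
    generalize |x| / y = τ at ht
    rcases le_total τ 1 with h | h
    · have h3 := Real.rpow_le_one ht h h0.le
      have h4 := Real.rpow_le_rpow_of_exponent_ge' ht h h0.le h1
      rw [Real.rpow_one] at h4
      rw [abs_of_nonpos (by linarith), abs_of_nonpos (by linarith)]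
      linarith
    · have h3 := Real.one_le_rpow h h0.le
      have h4 := Real.rpow_le_rpow_of_exponent_le h h1
      rw [Real.rpow_one] at h4
      rw [abs_of_nonneg (by linarith), abs_of_nonneg (by linarith)]
      linarith
  refine h2.trans ?_
  have e2 : |x| / y - 1 = (|x| - y) / y := by field_simp
  rw [e2, abs_div, abs_of_pos hy, e1, mul_assoc, mul_div_cancel₀ _ hy.ne']
  exact mul_le_mul_of_nonneg_left hd hyα.le

theorem tendsto_slope_abs_rpow {α x : ℝ} (hx : 0 < x) (y : ℝ) :
    Tendsto (fun s : ℝ => s⁻¹ * (|x + s * y| ^ α - |x| ^ α)) (𝓝[≠] 0)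
      (𝓝 (α * x ^ (α - 1) * y)) := by
  have h1 : HasDerivAt (fun s : ℝ => x + s * y) y 0 := by
    simpa using ((hasDerivAt_id (0 : ℝ)).mul_const y).const_add x
  have e : x + 0 * y = x := by ring
  have h2 : HasDerivAt (fun x : ℝ => |x| ^ α) (α * x ^ (α - 1)) (x + 0 * y) := by
    rw [e]
    refine (Real.hasDerivAt_rpow_const (Or.inl hx.ne')).congr_of_eventuallyEq ?_
    filter_upwards [lt_mem_nhds hx] with z hz
    rw [abs_of_pos hz]
  have h3 := hasDerivAt_iff_tendsto_slope_zero.1 (h2.comp (0 : ℝ) h1)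
  refine h3.congr fun s => ?_
  simp

/-- The directional derivative of `∫ a |u|^α` at a positive `u`, when the expected derivative is
integrable. -/
theorem hasDerivAt_integral_sublinear {α : ℝ} (h0 : 0 < α) (h1 : α ≤ 1) {a u h : X → ℝ}
    (hpos : ∀ᵐ z ∂m, 0 < u z)
    (hi : ∀ s : ℝ, Integrable (fun z => a z * |u z + s * h z| ^ α) m)
    (hint : Integrable (fun z => a z * u z ^ (α - 1) * h z) m) :
    HasDerivAt (fun s : ℝ => ∫ z, a z * |u z + s * h z| ^ α ∂m)
      (α * ∫ z, a z * u z ^ (α - 1) * h z ∂m) 0 := by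
  rw [hasDerivAt_iff_tendsto_slope_zero]
  have e : ∀ s : ℝ, s⁻¹ • ((∫ z, a z * |u z + (0 + s) * h z| ^ α ∂m)
      - ∫ z, a z * |u z + 0 * h z| ^ α ∂m) =
      ∫ z, a z * (s⁻¹ * (|u z + s * h z| ^ α - |u z| ^ α)) ∂m := fun s => by
    have h00 := hi 0
    simp only [zero_mul, add_zero] at h00
    simp only [zero_add, zero_mul, add_zero]
    rw [← integral_sub (hi s) h00, smul_eq_mul, ← integral_const_mul]
    refine integral_congr_ae (.of_forall fun z => ?_)
    simp only
    ring
  simp_rw [e]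
  rw [← integral_const_mul]
  have h00 := hi 0
  simp only [zero_mul, add_zero] at h00
  refine tendsto_integral_filter_of_dominated_convergence
    (fun z => |a z * u z ^ (α - 1) * h z|) (.of_forall fun s => ?_) ?_ hint.abs ?_
  · have := (((hi s).sub h00).const_mul s⁻¹).1
    refine this.congr (.of_forall fun z => ?_)
    simp only [Pi.sub_apply]
    ring
  · filter_upwards [self_mem_nhdsWithin] with s hs
    filter_upwards [hpos] with z hz
    have h2 := abs_rpow_sub_le_of_pos h0 h1 hz (u z + s * h z)
    rw [add_sub_cancel_left, abs_mul] at h2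
    have hs' : 0 < |s| := abs_pos.2 hs
    rw [Real.norm_eq_abs, abs_mul, abs_mul, abs_mul, abs_mul, abs_inv, mul_assoc, abs_of_pos hz]
    refine mul_le_mul_of_nonneg_left ?_ (abs_nonneg _)
    rw [abs_of_pos (Real.rpow_pos_of_pos hz _), inv_mul_le_iff₀ hs']
    linarith
  · filter_upwards [hpos] with z hz
    have := (tendsto_slope_abs_rpow (α := α) hz (h z)).const_mul (a z)
    refine this.trans_eq ?_
    congr 1; ring

end

/-- If a combination of increments `∑ t^{c_i} (f_i(s) - f_i(0))` can be made nonnegative, for all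
small `s` of both signs, by a factor `t` close to `1`, then the derivatives of the `f_i` sum to
zero. -/
theorem sum_deriv_eq_zero {ι : Type*} [Fintype ι] {c f' : ι → ℝ} {f : ι → ℝ → ℝ}
    (hf : ∀ i, HasDerivAt (f i) (f' i) 0)
    (h : ∀ δ : ℝ, 0 < δ → ∀ᶠ s in 𝓝 (0 : ℝ), ∃ t : ℝ, 1 - δ < t ∧ t < 1 + δ ∧
      0 ≤ ∑ i, t ^ c i * (f i s - f i 0)) : ∑ i, f' i = 0 := by
  have hslope : Tendsto (fun (s : ℝ) i => s⁻¹ * (f i s - f i 0)) (𝓝[≠] 0) (𝓝 f') :=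
    tendsto_pi_nhds.2 fun i => by
      simpa using hasDerivAt_iff_tendsto_slope_zero.1 (hf i)
  have hΦ : ContinuousAt (fun x : ℝ × (ι → ℝ) => ∑ i, x.1 ^ c i * x.2 i) (1, f') := by
    refine tendsto_finsetSum _ fun i _ => ?_
    refine ContinuousAt.mul ?_ ?_
    · exact continuousAt_fst.rpow_const (Or.inl one_ne_zero)
    · exact ((continuous_apply i).comp continuous_snd).continuousAt
  have hval : ∑ i, (1 : ℝ) ^ c i * f' i = ∑ i, f' i := by simp
  -- near `(1, 0)` the increments have the sign of `s` times the sum of the derivatives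
  have hev : ∀ (S U : Set ℝ), (∀ x ∈ S, x ≠ 0) → (𝓝[S] (0 : ℝ)).NeBot → U ∈ 𝓝 (∑ i, f' i) →
      ∃ᶠ s in 𝓝[S] (0 : ℝ), ∃ t : ℝ,
      (∑ i, t ^ c i * (s⁻¹ * (f i s - f i 0)) ∈ U ∧ 0 ≤ ∑ i, t ^ c i * (f i s - f i 0)) := by
    intro S U hS hne hU
    rw [← hval] at hU
    obtain ⟨T, hT, W, hW, hTW⟩ := mem_nhds_prod_iff.1 (hΦ hU)
    obtain ⟨δ, hδ, hball⟩ := Metric.mem_nhds_iff.1 hT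
    have h1 := (h δ hδ).filter_mono (nhdsWithin_le_nhds (s := S))
    have h2 := (hslope.mono_left (nhdsWithin_mono 0 hS)) hW
    refine (h1.and h2).frequently.mono ?_
    rintro s ⟨⟨t, ht1, ht2, ht⟩, hs⟩
    have ht3 : t ∈ T := hball (by
      rw [Metric.mem_ball, Real.dist_eq, abs_lt]
      constructor <;> linarith)
    have h3 : (t, fun i => s⁻¹ * (f i s - f i 0)) ∈ T ×ˢ W := ⟨ht3, hs⟩
    exact ⟨t, hTW h3, ht⟩
  have hmul : ∀ s t : ℝ, ∑ i, t ^ c i * (s⁻¹ * (f i s - f i 0)) =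
      s⁻¹ * ∑ i, t ^ c i * (f i s - f i 0) := fun s t => by
    rw [Finset.mul_sum]; exact Finset.sum_congr rfl fun i _ => by ring
  -- a nonzero sum contradicts the hypothesis for `s` of one of the two signs
  rcases lt_trichotomy (∑ i, f' i) 0 with hneg | hz | hp
  · exfalso
    obtain ⟨s, ⟨t, ht, ht'⟩, hs⟩ := ((hev (Ioi 0) _ (fun x (hx : 0 < x) => hx.ne')
      inferInstance (Iio_mem_nhds hneg)).and_eventually
      self_mem_nhdsWithin).exists
    rw [hmul] at ht
    exact absurd ht (not_lt.2 (mul_nonneg (inv_nonneg.2 (le_of_lt hs)) ht'))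
  · exact hz
  · exfalso
    obtain ⟨s, ⟨t, ht, ht'⟩, hs⟩ := ((hev (Iio 0) _ (fun x (hx : x < 0) => hx.ne)
      inferInstance (Ioi_mem_nhds hp)).and_eventually
      self_mem_nhdsWithin).exists
    rw [hmul] at ht
    exact absurd ht (not_lt.2 (mul_nonpos_of_nonpos_of_nonneg (inv_nonpos.2 (le_of_lt hs)) ht'))

/-! ### Line-minimal pairs are positive weak solutions -/

section

variable {V : Type*} [AddCommGroup V] [Module ℝ V] (F : FiberedSystem V) {lam : ℝ}

theorem FiberedSystem.IsLineMinimal.exists_factor {y : V} (hy : F.IsLineMinimal lam y) (h : V)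
    {δ : ℝ} (hδ : 0 < δ) (hδ1 : δ < 1) : ∀ᶠ s in 𝓝 (0 : ℝ), ∃ t : ℝ, 1 - δ < t ∧ t < 1 + δ ∧
      t ^ F.α * ((F.S (y + s • h) - F.S y) / F.α) ≤
        t ^ F.p * ((F.A (y + s • h) - F.A y) / F.p) + t ^ F.q * ((F.B (y + s • h) - F.B y) / F.q)
          - lam * (t ^ F.r * (F.K (y + s • h) - F.K y)) := by
  filter_upwards [hy h δ hδ] with s hs
  obtain ⟨t, h1, h2, h3⟩ := hs
  refine ⟨t, h1, h2, ?_⟩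
  have ht : 0 < t := by linarith
  rw [FiberedSystem.J, FiberedSystem.J, F.A_smul t _ ht, F.A_smul t _ ht, F.B_smul t _ ht,
    F.B_smul t _ ht, F.S_smul t _ ht, F.S_smul t _ ht, F.K_smul t _ ht, F.K_smul t _ ht] at h3
  simp only [mul_sub, sub_div, mul_div_assoc] at h3 ⊢
  linarith

theorem exists_increment_bound {f : ℝ → ℝ} {f' : ℝ} (hf : HasDerivAt f f' 0) :
    ∃ C : ℝ, 0 ≤ C ∧ ∀ᶠ s in 𝓝 (0 : ℝ), |f s - f 0| ≤ C * |s| := by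
  obtain ⟨C, hC, h⟩ := hf.differentiableAt.isBigO_sub.exists_nonneg
  refine ⟨C, hC, h.bound.mono fun s hs => ?_⟩
  simpa using hs

/-- Along a direction in which the other terms are differentiable, the sublinear term of a
line-minimal vector has bounded difference quotients from above. -/
theorem FiberedSystem.IsLineMinimal.exists_S_bound {y h : V} (hy : F.IsLineMinimal lam y)
    {A' B' K' : ℝ} (hA : HasDerivAt (fun s : ℝ => F.A (y + s • h)) A' 0)
    (hB : HasDerivAt (fun s : ℝ => F.B (y + s • h)) B' 0)
    (hK : HasDerivAt (fun s : ℝ => F.K (y + s • h)) K' 0) :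
    ∃ C : ℝ, ∀ᶠ s in 𝓝[>] (0 : ℝ), F.S (y + s • h) - F.S y ≤ C * s := by
  obtain ⟨CA, hCA0, hCA⟩ := exists_increment_bound hA
  obtain ⟨CB, hCB0, hCB⟩ := exists_increment_bound hB
  obtain ⟨CK, hCK0, hCK⟩ := exists_increment_bound hK
  have hα := F.α_pos
  have hp := F.p_pos
  have hq := F.q_pos
  set D : ℝ := (3 / 2 : ℝ) ^ F.p * (CA / F.p) + (3 / 2 : ℝ) ^ F.q * (CB / F.q) +
    |lam| * ((3 / 2 : ℝ) ^ F.r * CK) with hD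
  have hD0 : 0 ≤ D := by positivity
  refine ⟨D * F.α / (1 / 2 : ℝ) ^ F.α, ?_⟩
  filter_upwards [(hy.exists_factor F h one_half_pos one_half_lt_one).filter_mono
    nhdsWithin_le_nhds, hCA.filter_mono nhdsWithin_le_nhds, hCB.filter_mono nhdsWithin_le_nhds,
    hCK.filter_mono nhdsWithin_le_nhds, self_mem_nhdsWithin] with s hs hsA hsB hsK hs0
  replace hs0 : 0 < s := hs0
  obtain ⟨t, ht1, ht2, ht⟩ := hs
  have ht0 : 0 < t := by linarith
  simp only [zero_smul, add_zero, abs_of_pos hs0] at hsA hsB hsK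
  have hhalf : 0 < (1 / 2 : ℝ) ^ F.α := Real.rpow_pos_of_pos (by norm_num) _
  rw [div_mul_eq_mul_div, le_div_iff₀ hhalf]
  rcases le_or_gt (F.S (y + s • h) - F.S y) 0 with hle | hgt
  · exact (mul_nonpos_of_nonpos_of_nonneg hle hhalf.le).trans (by positivity)
  · have hpow : ∀ {c : ℝ}, 0 ≤ c → t ^ c ≤ (3 / 2 : ℝ) ^ c := fun hc =>
      Real.rpow_le_rpow ht0.le (by linarith) hc
    have b1 : t ^ F.p * ((F.A (y + s • h) - F.A y) / F.p) ≤
        (3 / 2 : ℝ) ^ F.p * (CA / F.p) * s := by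
      rw [mul_assoc, div_mul_eq_mul_div]
      have h2 := div_le_div_of_nonneg_right ((le_abs_self _).trans hsA) hp.le
      have h3 : 0 ≤ CA * s / F.p := by positivity
      exact (mul_le_mul_of_nonneg_left h2 (Real.rpow_nonneg ht0.le _)).trans
        (mul_le_mul_of_nonneg_right (hpow hp.le) h3)
    have b2 : t ^ F.q * ((F.B (y + s • h) - F.B y) / F.q) ≤
        (3 / 2 : ℝ) ^ F.q * (CB / F.q) * s := by
      rw [mul_assoc, div_mul_eq_mul_div]
      have h2 := div_le_div_of_nonneg_right ((le_abs_self _).trans hsB) hq.le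
      have h3 : 0 ≤ CB * s / F.q := by positivity
      exact (mul_le_mul_of_nonneg_left h2 (Real.rpow_nonneg ht0.le _)).trans
        (mul_le_mul_of_nonneg_right (hpow hq.le) h3)
    have b3 : -(lam * (t ^ F.r * (F.K (y + s • h) - F.K y))) ≤
        |lam| * ((3 / 2 : ℝ) ^ F.r * CK) * s := by
      refine (neg_le_abs _).trans ?_
      rw [abs_mul, abs_mul, abs_of_pos (Real.rpow_pos_of_pos ht0 _), mul_assoc, mul_assoc]
      have := hpow F.r_pos.le
      gcongr
    have b4 : (1 / 2 : ℝ) ^ F.α * ((F.S (y + s • h) - F.S y) / F.α) ≤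
        t ^ F.α * ((F.S (y + s • h) - F.S y) / F.α) := by
      have := Real.rpow_le_rpow (by norm_num : (0 : ℝ) ≤ 1 / 2) (by linarith : 1 / 2 ≤ t) hα.le
      have : 0 ≤ (F.S (y + s • h) - F.S y) / F.α := by positivity
      gcongr
    have b5 : (1 / 2 : ℝ) ^ F.α * ((F.S (y + s • h) - F.S y) / F.α) ≤ D * s := by
      rw [hD]; linarith
    rw [← mul_div_assoc, div_le_iff₀ hα] at b5
    linarith

/-- The Euler–Lagrange equation of a line-minimal vector. -/
theorem FiberedSystem.IsLineMinimal.deriv_eq_zero {y h : V} (hy : F.IsLineMinimal lam y)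
    {A' B' S' K' : ℝ} (hA : HasDerivAt (fun s : ℝ => F.A (y + s • h)) A' 0)
    (hB : HasDerivAt (fun s : ℝ => F.B (y + s • h)) B' 0)
    (hS : HasDerivAt (fun s : ℝ => F.S (y + s • h)) S' 0)
    (hK : HasDerivAt (fun s : ℝ => F.K (y + s • h)) K' 0) :
    A' / F.p + B' / F.q - S' / F.α - lam * K' = 0 := by
  have := sum_deriv_eq_zero (ι := Fin 4) (c := ![F.p, F.q, F.α, F.r])
    (f := ![fun s : ℝ => F.A (y + s • h) / F.p, fun s : ℝ => F.B (y + s • h) / F.q,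
      fun s : ℝ => -(F.S (y + s • h) / F.α), fun s : ℝ => -(lam * F.K (y + s • h))])
    (f' := ![A' / F.p, B' / F.q, -(S' / F.α), -(lam * K')])
    (by
      intro i
      fin_cases i
      · exact hA.div_const _
      · exact hB.div_const _
      · exact (hS.div_const _).neg
      · exact (hK.const_mul _).neg)
    (fun δ hδ => by
      -- the factor has to stay away from `0`
      have hδ' : 0 < min δ (1 / 2) := lt_min hδ one_half_pos
      filter_upwards [hy.exists_factor F h hδ' ((min_le_right _ _).trans_lt one_half_lt_one)]
        with s hs
      obtain ⟨t, h1, h2, h3⟩ := hs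
      have := min_le_left δ (1 / 2)
      refine ⟨t, by linarith, by linarith, ?_⟩
      rw [Fin.sum_univ_four]
      simp only [Matrix.cons_val, zero_smul, add_zero]
      simp only [mul_sub, sub_div] at h3 ⊢
      linarith)
  rw [Fin.sum_univ_four] at this
  simp only [Matrix.cons_val] at this
  linarith

end

section

variable {X : Type*} [MeasurableSpace X] {m : Measure X}

theorem tendsto_singular_quotient {α a h : ℝ} (hα0 : α ≠ 0) (hα : α < 1) (ha : 0 < a)
    (hh : 0 < h) :
    Tendsto (fun s : ℝ => a * (s⁻¹ * (|0 + s * h| ^ α - |(0 : ℝ)| ^ α))) (𝓝[>] 0) atTop := by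
  have h1 : Tendsto (fun s : ℝ => a * h ^ α * (s⁻¹) ^ (1 - α)) (𝓝[>] 0) atTop :=
    Tendsto.const_mul_atTop (mul_pos ha (Real.rpow_pos_of_pos hh _))
      ((tendsto_rpow_atTop (by linarith : 0 < 1 - α)).comp tendsto_inv_nhdsGT_zero)
  refine h1.congr' ?_
  filter_upwards [self_mem_nhdsWithin] with s hs
  replace hs : 0 < s := hs
  rw [zero_add, abs_zero, Real.zero_rpow hα0, sub_zero, abs_of_pos (mul_pos hs hh),
    Real.mul_rpow hs.le hh.le, Real.inv_rpow hs.le, ← Real.rpow_neg hs.le,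
    show -(1 - α) = α + (-1) by ring, Real.rpow_add hs, Real.rpow_neg_one]
  ring

/-- If the difference quotients of `∫ a |u|^α` in the direction `h ≥ 0` stay bounded, then `u > 0`
wherever `h > 0`, and the expected derivative is integrable. This is Fatou's lemma: at points with
`u = 0 < h` the quotients tend to infinity because `α < 1`. -/
theorem pos_and_integrable_of_quotient_bound {α : ℝ} (h0 : 0 < α) (h1 : α < 1) {a u h : X → ℝ}
    (ha : ∀ᵐ z ∂m, 0 < a z) (ham : AEMeasurable a m) (hum : AEMeasurable u m)
    (hhm : AEMeasurable h m) (hu : ∀ z, 0 ≤ u z) (hh : ∀ z, 0 ≤ h z)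
    (hi : ∀ s : ℝ, Integrable (fun z => a z * |u z + s * h z| ^ α) m) {C : ℝ}
    (hC : ∀ᶠ s in 𝓝[>] (0 : ℝ),
      (∫ z, a z * |u z + s * h z| ^ α ∂m) - ∫ z, a z * |u z| ^ α ∂m ≤ C * s) :
    (∀ᵐ z ∂m, 0 < h z → 0 < u z) ∧ Integrable (fun z => a z * u z ^ (α - 1) * h z) m := by
  have h00 := hi 0
  simp only [zero_mul, add_zero] at h00
  set f : ℝ → X → ℝ := fun s z => a z * (s⁻¹ * (|u z + s * h z| ^ α - |u z| ^ α)) with hf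
  have hfi : ∀ s, Integrable (f s) m := fun s => by
    refine (((hi s).sub h00).const_mul s⁻¹).congr (.of_forall fun z => ?_)
    simp only [Pi.sub_apply, hf]
    ring
  have hf0 : ∀ s : ℝ, 0 < s → ∀ᵐ z ∂m, 0 ≤ f s z := fun s hs => by
    filter_upwards [ha] with z hz
    refine mul_nonneg hz.le (mul_nonneg (inv_nonneg.2 hs.le) (sub_nonneg.2 ?_))
    have h2 := mul_nonneg hs.le (hh z)
    rw [abs_of_nonneg (hu z), abs_of_nonneg (add_nonneg (hu z) h2)]
    exact Real.rpow_le_rpow (hu z) (by linarith) h0.le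
  have hfC : ∀ᶠ s in 𝓝[>] (0 : ℝ), ∫⁻ z, ENNReal.ofReal (f s z) ∂m ≤ ENNReal.ofReal C := by
    filter_upwards [hC, self_mem_nhdsWithin] with s hs hs0
    replace hs0 : 0 < s := hs0
    rw [← ofReal_integral_eq_lintegral_ofReal (hfi s) (hf0 s hs0)]
    refine ENNReal.ofReal_le_ofReal ?_
    have e : ∫ z, f s z ∂m =
        s⁻¹ * ((∫ z, a z * |u z + s * h z| ^ α ∂m) - ∫ z, a z * |u z| ^ α ∂m) := by
      rw [← integral_sub (hi s) h00, ← integral_const_mul]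
      refine integral_congr_ae (.of_forall fun z => ?_)
      simp only [hf]
      ring
    rw [e, inv_mul_le_iff₀ hs0]
    linarith
  set ε : ℕ → ℝ := fun k => 1 / ((k : ℝ) + 1) with hεdef
  have hε : Tendsto ε atTop (𝓝[>] 0) :=
    tendsto_nhdsWithin_iff.2 ⟨tendsto_one_div_add_atTop_nhds_zero_nat,
      .of_forall fun k => by simp only [hεdef, mem_Ioi]; positivity⟩
  have hfatou : ∫⁻ z, liminf (fun k => ENNReal.ofReal (f (ε k) z)) atTop ∂m ≤
      ENNReal.ofReal C := by
    refine (lintegral_liminf_le' fun k => (hfi (ε k)).1.aemeasurable.ennreal_ofReal).trans ?_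
    have h2 : ∀ᶠ k in atTop, ∫⁻ z, ENNReal.ofReal (f (ε k) z) ∂m ≤ ENNReal.ofReal C :=
      hε.eventually hfC
    exact (liminf_le_liminf h2).trans_eq (liminf_const _)
  have hlm : AEMeasurable (fun z => ENNReal.ofReal (a z * u z ^ (α - 1) * h z)) m :=
    ((ham.mul (hum.pow_const _)).mul hhm).ennreal_ofReal
  -- where `u = 0` the function `u ^ (α - 1)` has the value `0`, so positivity has to be read off from the
  -- quotients and not from the integrability of the expected derivative
  have hpos : ∀ z, u z = 0 → 0 < h z → 0 < a z →
      liminf (fun k => ENNReal.ofReal (f (ε k) z)) atTop = ⊤ := fun z hz hhz haz => by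
    refine Tendsto.liminf_eq ?_
    have := tendsto_singular_quotient h0.ne' h1 haz hhz
    refine (ENNReal.tendsto_ofReal_atTop.comp (this.comp hε)).congr fun s => ?_
    simp only [Function.comp, hf, hz]
  have hle : ∀ᵐ z ∂m, ENNReal.ofReal α * ENNReal.ofReal (a z * u z ^ (α - 1) * h z) ≤
      liminf (fun k => ENNReal.ofReal (f (ε k) z)) atTop := by
    filter_upwards [ha] with z hz
    rcases (hu z).eq_or_lt with hz0 | hz0
    · rw [← hz0, Real.zero_rpow (by linarith)]
      simp
    · refine le_of_eq ?_
      symm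
      refine Tendsto.liminf_eq ?_
      rw [← ENNReal.ofReal_mul h0.le]
      refine ENNReal.tendsto_ofReal ?_
      have := ((tendsto_slope_abs_rpow (α := α) hz0 (h z)).const_mul (a z)).mono_left
        (nhdsWithin_mono 0 fun x (hx : 0 < x) => hx.ne')
      refine (this.comp hε).trans_eq ?_
      congr 1; ring
  have hfin : ∫⁻ z, ENNReal.ofReal (a z * u z ^ (α - 1) * h z) ∂m < ⊤ := by
    have h2 := (lintegral_mono_ae hle).trans hfatou
    rw [lintegral_const_mul' _ _ ENNReal.ofReal_ne_top] at h2
    by_contra hne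
    rw [not_lt, top_le_iff] at hne
    rw [hne, ENNReal.mul_top (ENNReal.ofReal_pos.2 h0).ne', top_le_iff] at h2
    exact ENNReal.ofReal_ne_top h2
  constructor
  · have hms : ∀ᵐ z ∂m, liminf (fun k => ENNReal.ofReal (f (ε k) z)) atTop < ⊤ := by
      refine ae_lt_top' ?_ (hfatou.trans_lt ENNReal.ofReal_lt_top).ne
      simp_rw [liminf_eq_iSup_iInf_of_nat]
      exact AEMeasurable.iSup fun i => AEMeasurable.biInf _ (to_countable _)
        fun k _ => (hfi (ε k)).1.aemeasurable.ennreal_ofReal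
    filter_upwards [hms, ha] with z hz haz hhz
    refine lt_of_le_of_ne (hu z) fun h2 => ?_
    rw [hpos z h2.symm hhz haz] at hz
    exact lt_irrefl _ hz
  · refine (lintegral_ofReal_ne_top_iff_integrable ?_ ?_).1 hfin.ne
    · exact ((ham.mul (hum.pow_const _)).mul hhm).aestronglyMeasurable
    · filter_upwards [ha] with z hz
      exact mul_nonneg (mul_nonneg hz.le (Real.rpow_nonneg (hu z) _)) (hh z)

end

section

variable {n : ℕ} {Ω : Set (E n)} {p q r : ℝ} {η : E n → ℝ}

theorem IsPhase.hasDerivAt_dirichlet (ha : Admissible Ω p q r η) {m : Measure (E n)} {σ : ℝ}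
    (H : IsPhase Ω p q η m σ) {u h : E n → ℝ} (hu : MemW01H Ω p q η u) (hh : MemW01H Ω p q η h) :
    HasDerivAt (fun s : ℝ => dirichlet Ω m σ (u + s • h))
      (σ * ∫ z, ‖weakGrad Ω u z‖ ^ (σ - 2) * inner ℝ (weakGrad Ω u z) (weakGrad Ω h z) ∂m) 0 := by
  have e : (fun s : ℝ => dirichlet Ω m σ (u + s • h)) =
      fun s => ∫ z, ‖weakGrad Ω u z + s • weakGrad Ω h z‖ ^ σ ∂m := funext fun s =>
    H.dirichlet_eq ha ((hu.isW0 ha).add ha ((hh.isW0 ha).smul s))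
  rw [e]
  exact hasDerivAt_integral_norm_rpow H.one_lt (H.memLp (hu.isW0 ha)) (H.memLp (hh.isW0 ha))

theorem Admissible.integral_weighted (ha : Admissible Ω p q r η) (f : E n → ℝ) :
    ∫ z, f z ∂weighted Ω η = ∫ z in Ω, η z * f z := by
  rw [weighted, integral_withDensity_eq_integral_toReal_smul₀ ha.aemeasurable_ofReal
    (.of_forall fun _ => ENNReal.ofReal_lt_top)]
  refine integral_congr_ae ?_
  filter_upwards [ha.nonneg] with z hz
  rw [ENNReal.toReal_ofReal hz, smul_eq_mul]

/-- Positivity almost everywhere is local, hence can be tested on nonnegative test functions. -/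
theorem Admissible.ae_pos_of_test (ha : Admissible Ω p q r η) {u : E n → ℝ}
    (H : ∀ φ : E n → ℝ, IsTestFunction Ω φ → (∀ z, 0 ≤ φ z) →
      ∀ᵐ z ∂volume.restrict Ω, 0 < φ z → 0 < u z) : ∀ᵐ z ∂volume.restrict Ω, 0 < u z := by
  rw [ae_iff, Measure.restrict_apply' ha.isOpen.measurableSet]
  refine measure_null_of_locally_null _ fun x hx => ?_
  obtain ⟨φ, h1, h2, h3, h4, h5⟩ := exists_contDiff_tsupport_subset (n := ⊤)
    (ha.isOpen.mem_nhds hx.2)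
  have hae := H φ ⟨h3, h2, h1⟩ fun z => (h4 ⟨z, rfl⟩).1
  rw [ae_iff, Measure.restrict_apply' ha.isOpen.measurableSet] at hae
  refine ⟨{z | 0 < φ z} ∩ ({z | ¬ 0 < u z} ∩ Ω), inter_mem (mem_nhdsWithin_of_mem_nhds ?_) self_mem_nhdsWithin, ?_⟩
  · exact (isOpen_lt continuous_const h3.continuous).mem_nhds
      (show 0 < φ x by rw [h5]; exact one_pos)
  · refine measure_mono_null ?_ hae
    rintro z ⟨hz1, hz2, hz3⟩
    exact ⟨fun hz => hz2 (hz hz1), hz3⟩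

end

namespace SystemData

variable {n : ℕ} {Ω : Set (E n)} {p q ν κ₁ κ₂ : ℝ} {η a₁ a₂ : E n → ℝ}
  (d : SystemData Ω p q ν κ₁ κ₂ η a₁ a₂) {lam : ℝ}

theorem hasDerivAt_dirichletPair {m : Measure (E n)} {σ : ℝ} (H : IsPhase Ω p q η m σ)
    (y h : d.Pair) :
    HasDerivAt (fun s : ℝ => d.dirichletPair m σ (y + s • h))
      (σ * (∫ z, ‖weakGrad Ω y.1 z‖ ^ (σ - 2) *
          inner ℝ (weakGrad Ω y.1 z) (weakGrad Ω h.1 z) ∂m) +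
        σ * ∫ z, ‖weakGrad Ω y.2 z‖ ^ (σ - 2) *
          inner ℝ (weakGrad Ω y.2 z) (weakGrad Ω h.2 z) ∂m) 0 :=
  (H.hasDerivAt_dirichlet d.adm y.1.2 h.1.2).add (H.hasDerivAt_dirichlet d.adm y.2.2 h.2.2)

theorem hasDerivAt_couplingPair (y h : d.Pair) :
    HasDerivAt (fun s : ℝ => d.couplingPair (y + s • h))
      ((κ₁ + 1) * (∫ z in Ω, |(y.1 : E n → ℝ) z| ^ (κ₁ + 1 - 2) * (y.1 : E n → ℝ) z *
          |(y.2 : E n → ℝ) z| ^ (κ₂ + 1) * (h.1 : E n → ℝ) z) +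
        (κ₂ + 1) * ∫ z in Ω, |(y.1 : E n → ℝ) z| ^ (κ₁ + 1) *
          (|(y.2 : E n → ℝ) z| ^ (κ₂ + 1 - 2) * (y.2 : E n → ℝ) z) * (h.2 : E n → ℝ) z) 0 := by
  have hr := fun u : d.adm.W0 => (MemW01H.isW0 d.adm u.2).memLp_r d.adm
  exact hasDerivAt_integral_coupling (by linarith [d.κ₁_pos]) (by linarith [d.κ₂_pos])
    (hr y.1) (hr y.2) (hr h.1) (hr h.2)

theorem integrable_sublinear_line {a : E n → ℝ} (d : SystemData Ω p q ν κ₁ κ₂ η a₁ a₂)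
    (ha : MemLp a ⊤ (volume.restrict Ω)) (u h : d.adm.W0) (s : ℝ) :
    Integrable (fun z => a z * |(u : E n → ℝ) z + s * (h : E n → ℝ) z| ^ (1 - ν))
      (volume.restrict Ω) :=
  d.adm.integrable_sublinear d.α_pos d.α_lt.le ha
    ((MemW01H.isW0 d.adm (u + s • h).2).memLp_one d.adm)

theorem pos_and_integrable {a u h : E n → ℝ} (d : SystemData Ω p q ν κ₁ κ₂ η a₁ a₂)
    (ha : MemLp a ⊤ (volume.restrict Ω)) (hpos : ∀ᵐ z ∂volume.restrict Ω, 0 < a z)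
    (hu : MemW01H Ω p q η u) (hh : MemW01H Ω p q η h)
    (hu0 : ∀ z, 0 ≤ u z) (hh0 : ∀ z, 0 ≤ h z)
    {C : ℝ} (hC : ∀ᶠ s in 𝓝[>] (0 : ℝ),
      sublinear Ω a (1 - ν) (u + s • h) - sublinear Ω a (1 - ν) u ≤ C * s) :
    (∀ᵐ z ∂volume.restrict Ω, 0 < h z → 0 < u z) ∧
      Integrable (fun z => a z * u z ^ (1 - ν - 1) * h z) (volume.restrict Ω) :=
  pos_and_integrable_of_quotient_bound d.α_pos d.α_lt hpos ha.1.aemeasurable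
    (hu.isW0 d.adm).aesm.aemeasurable (hh.isW0 d.adm).aesm.aemeasurable hu0 hh0
    (d.integrable_sublinear_line ha ⟨u, hu⟩ ⟨h, hh⟩) hC

theorem exists_sublinear_bound {y : d.Pair} (hy : d.toFibered.IsLineMinimal lam y) (h : d.Pair) :
    ∃ C : ℝ, ∀ᶠ s in 𝓝[>] (0 : ℝ), d.sublinearPair (y + s • h) - d.sublinearPair y ≤ C * s :=
  FiberedSystem.IsLineMinimal.exists_S_bound d.toFibered hy
    (d.hasDerivAt_dirichletPair d.adm.isPhase_p y h)
    (d.hasDerivAt_dirichletPair d.adm.isPhase_q y h) (d.hasDerivAt_couplingPair y h)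

theorem pos_and_integrable_fst {y : d.Pair} (hy : d.toFibered.IsLineMinimal lam y)
    (hy0 : ∀ z, 0 ≤ (y.1 : E n → ℝ) z) {h : E n → ℝ} (hh : MemW01H Ω p q η h)
    (hh0 : ∀ z, 0 ≤ h z) :
    (∀ᵐ z ∂volume.restrict Ω, 0 < h z → 0 < (y.1 : E n → ℝ) z) ∧
      Integrable (fun z => a₁ z * (y.1 : E n → ℝ) z ^ (1 - ν - 1) * h z)
        (volume.restrict Ω) := by
  obtain ⟨C, hC⟩ := d.exists_sublinear_bound hy (⟨h, hh⟩, 0)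
  refine d.pos_and_integrable d.memLp₁ d.pos₁ y.1.2 hh hy0 hh0 (C := C) ?_
  filter_upwards [hC] with s hs
  have e : (y + s • ((⟨h, hh⟩, 0) : d.Pair)).2 = y.2 := by simp
  rw [sublinearPair, sublinearPair, e, add_sub_add_right_eq_sub] at hs
  exact hs

theorem pos_and_integrable_snd {y : d.Pair} (hy : d.toFibered.IsLineMinimal lam y)
    (hy0 : ∀ z, 0 ≤ (y.2 : E n → ℝ) z) {h : E n → ℝ} (hh : MemW01H Ω p q η h)
    (hh0 : ∀ z, 0 ≤ h z) :
    (∀ᵐ z ∂volume.restrict Ω, 0 < h z → 0 < (y.2 : E n → ℝ) z) ∧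
      Integrable (fun z => a₂ z * (y.2 : E n → ℝ) z ^ (1 - ν - 1) * h z)
        (volume.restrict Ω) := by
  obtain ⟨C, hC⟩ := d.exists_sublinear_bound hy (0, ⟨h, hh⟩)
  refine d.pos_and_integrable d.memLp₂ d.pos₂ y.2.2 hh hy0 hh0 (C := C) ?_
  filter_upwards [hC] with s hs
  have e : (y + s • ((0, ⟨h, hh⟩) : d.Pair)).1 = y.1 := by simp
  rw [sublinearPair, sublinearPair, e, add_sub_add_left_eq_sub] at hs
  exact hs

/-- Integrability of the singular term for signed directions follows from that for `|h|`. -/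
theorem integrable_singular {a u : E n → ℝ} (d : SystemData Ω p q ν κ₁ κ₂ η a₁ a₂)
    (ha : MemLp a ⊤ (volume.restrict Ω)) (hu : MemW01H Ω p q η u)
    (H : ∀ h : E n → ℝ, MemW01H Ω p q η h → (∀ z, 0 ≤ h z) →
      Integrable (fun z => a z * u z ^ (1 - ν - 1) * h z) (volume.restrict Ω))
    {h : E n → ℝ} (hh : MemW01H Ω p q η h) :
    Integrable (fun z => a z * u z ^ (1 - ν - 1) * h z) (volume.restrict Ω) := by
  have h1 := H (fun z => |h z|) (((hh.isW0 d.adm).abs d.adm).memW01H d.adm)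
    fun z => abs_nonneg _
  refine h1.mono ?_ (.of_forall fun z => ?_)
  · exact ((ha.1.aemeasurable.mul ((hu.isW0 d.adm).aesm.aemeasurable.pow_const _)).mul
      (hh.isW0 d.adm).aesm.aemeasurable).aestronglyMeasurable
  · rw [norm_mul, norm_mul _ (|h z|), Real.norm_eq_abs (|h z|), abs_abs, Real.norm_eq_abs (h z)]

/-- A nonnegative line-minimal pair is a positive weak solution. -/
theorem isPositiveWeakSolution {y : d.Pair} (hy : d.toFibered.IsLineMinimal lam y)
    (hy₁ : ∀ z, 0 ≤ (y.1 : E n → ℝ) z) (hy₂ : ∀ z, 0 ≤ (y.2 : E n → ℝ) z) :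
    IsPositiveWeakSolution Ω p q ν κ₁ κ₂ η a₁ a₂ lam ((y.1 : E n → ℝ), (y.2 : E n → ℝ)) := by
  have eν : 1 - ν - 1 = -ν := by ring
  have hpos₁ : ∀ᵐ z ∂volume.restrict Ω, 0 < (y.1 : E n → ℝ) z :=
    d.adm.ae_pos_of_test fun φ hφ h0 =>
      (d.pos_and_integrable_fst hy hy₁ ((IsW0.of_test hφ).memW01H d.adm) h0).1
  have hpos₂ : ∀ᵐ z ∂volume.restrict Ω, 0 < (y.2 : E n → ℝ) z :=
    d.adm.ae_pos_of_test fun φ hφ h0 =>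
      (d.pos_and_integrable_snd hy hy₂ ((IsW0.of_test hφ).memW01H d.adm) h0).1
  have hi₁ : ∀ h : E n → ℝ, MemW01H Ω p q η h → Integrable
      (fun z => a₁ z * (y.1 : E n → ℝ) z ^ (1 - ν - 1) * h z) (volume.restrict Ω) := fun h hh =>
    d.integrable_singular d.memLp₁ y.1.2 (fun h hh h0 => (d.pos_and_integrable_fst hy hy₁ hh h0).2)
      hh
  have hi₂ : ∀ h : E n → ℝ, MemW01H Ω p q η h → Integrable
      (fun z => a₂ z * (y.2 : E n → ℝ) z ^ (1 - ν - 1) * h z) (volume.restrict Ω) := fun h hh =>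
    d.integrable_singular d.memLp₂ y.2.2 (fun h hh h0 => (d.pos_and_integrable_snd hy hy₂ hh h0).2)
      hh
  refine ⟨y.1.2, y.2.2, hpos₁, hpos₂, fun h hh => ?_, fun w hw => ?_, fun h w hh hw => ?_⟩
  · have := hi₁ h hh
    rwa [eν] at this
  · have := hi₂ w hw
    rwa [eν] at this
  · have hS : HasDerivAt (fun s : ℝ => d.sublinearPair (y + s • ((⟨h, hh⟩, ⟨w, hw⟩) : d.Pair)))
        ((1 - ν) * (∫ z in Ω, a₁ z * (y.1 : E n → ℝ) z ^ (1 - ν - 1) * h z) +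
          (1 - ν) * ∫ z in Ω, a₂ z * (y.2 : E n → ℝ) z ^ (1 - ν - 1) * w z) 0 :=
      (hasDerivAt_integral_sublinear d.α_pos d.α_lt.le hpos₁
        (d.integrable_sublinear_line d.memLp₁ y.1 ⟨h, hh⟩) (hi₁ h hh)).add
      (hasDerivAt_integral_sublinear d.α_pos d.α_lt.le hpos₂
        (d.integrable_sublinear_line d.memLp₂ y.2 ⟨w, hw⟩) (hi₂ w hw))
    have key := FiberedSystem.IsLineMinimal.deriv_eq_zero d.toFibered hy
      (d.hasDerivAt_dirichletPair d.adm.isPhase_p y (⟨h, hh⟩, ⟨w, hw⟩))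
      (d.hasDerivAt_dirichletPair d.adm.isPhase_q y (⟨h, hh⟩, ⟨w, hw⟩)) hS
      (d.hasDerivAt_couplingPair y (⟨h, hh⟩, ⟨w, hw⟩))
    have e₁ : ∫ z in Ω, |(y.1 : E n → ℝ) z| ^ (κ₁ + 1 - 2) * (y.1 : E n → ℝ) z *
          |(y.2 : E n → ℝ) z| ^ (κ₂ + 1) * h z =
        ∫ z in Ω, |(y.1 : E n → ℝ) z| ^ κ₁ * |(y.2 : E n → ℝ) z| ^ (κ₂ + 1) * h z := by
      refine integral_congr_ae (.of_forall fun z => ?_)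
      have := rpow_sub_two_mul_self (p := κ₁ + 1) (by linarith [d.κ₁_pos]) (hy₁ z)
      simp only [abs_of_nonneg (hy₁ z), this, add_sub_cancel_right]
    have e₂ : ∫ z in Ω, |(y.1 : E n → ℝ) z| ^ (κ₁ + 1) *
          (|(y.2 : E n → ℝ) z| ^ (κ₂ + 1 - 2) * (y.2 : E n → ℝ) z) * w z =
        ∫ z in Ω, |(y.1 : E n → ℝ) z| ^ (κ₁ + 1) * |(y.2 : E n → ℝ) z| ^ κ₂ * w z := by
      refine integral_congr_ae (.of_forall fun z => ?_)
      have := rpow_sub_two_mul_self (p := κ₂ + 1) (by linarith [d.κ₂_pos]) (hy₂ z)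
      simp only [abs_of_nonneg (hy₂ z), this, add_sub_cancel_right]
    have hp := d.adm.p_pos.ne'
    have hq := d.adm.q_pos.ne'
    have hα := d.α_pos.ne'
    simp only [d.adm.integral_weighted, ← mul_assoc] at key
    change (p * _ + p * _) / p + (q * _ + q * _) / q - ((1 - ν) * _ + (1 - ν) * _) / (1 - ν)
      - lam * ((κ₁ + 1) * _ + (κ₂ + 1) * _) = 0 at key
    rw [← mul_add, ← mul_add, ← mul_add, mul_div_cancel_left₀ _ hp, mul_div_cancel_left₀ _ hq,
      mul_div_cancel_left₀ _ hα, eν] at key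
    simp only [mul_assoc] at key e₁ e₂ ⊢
    rw [e₁, e₂] at key
    linarith

end SystemData

/-! ### The energy and the Nehari manifolds of the system -/

theorem iteratedDeriv_two_fib {p q α r A B S L : ℝ} (hp : 0 < p) (hq : 0 < q) (hα : 0 < α)
    (hN : A + B - r * L = S) :
    iteratedDeriv 2 (fib p q α r A B S L) 1 =
      (p - α) * A + (q - α) * B - r * (r - α) * L := by
  have h1 : deriv (fib p q α r A B S L) =ᶠ[𝓝 1]
      fun t => t ^ (α - 1) * (fibSlope p q α r A B L t - S) := by
    filter_upwards [lt_mem_nhds (zero_lt_one : (0 : ℝ) < 1)] with t ht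
    exact (hasDerivAt_fib hp hq hα ht).deriv
  have hpow : ∀ s : ℝ, HasDerivAt (fun x : ℝ => x ^ s) s 1 := fun s => by
    simpa using Real.hasDerivAt_rpow_const (x := 1) (p := s) (Or.inl one_ne_zero)
  have hslope : HasDerivAt (fun t => fibSlope p q α r A B L t - S)
      (A * (p - α) + B * (q - α) - r * L * (r - α)) 1 :=
    ((((hpow _).const_mul A).add ((hpow _).const_mul B)).sub ((hpow _).const_mul (r * L))).sub_const
      S
  have h2 := (hpow (α - 1)).mul hslope
  rw [iteratedDeriv_succ, iteratedDeriv_one, h1.deriv_eq]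
  refine h2.deriv.trans ?_
  have h3 : fibSlope p q α r A B L 1 = A + B - r * L := by
    simp [fibSlope]
  rw [h3, hN, sub_self, Real.one_rpow]
  ring

theorem norm_rpow_sub_two_mul_inner {n : ℕ} {s : ℝ} (hs : s ≠ 0) (v : E n) :
    ‖v‖ ^ (s - 2) * inner ℝ v v = ‖v‖ ^ s := by
  rw [real_inner_self_eq_norm_sq]
  rcases (norm_nonneg v).eq_or_lt with h | h
  · rw [← h, Real.zero_rpow hs]; simp
  · rw [← Real.rpow_natCast, ← Real.rpow_add h]; congr 1; norm_num

theorem abs_rpow_mul_self {s : ℝ} (hs : s ≠ 0) (x : ℝ) : |x| ^ (s - 2) * x * x = |x| ^ s := by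
  rw [mul_assoc, ← abs_mul_abs_self x]
  rcases (abs_nonneg x).eq_or_lt with h | h
  · rw [← h, Real.zero_rpow hs]; simp
  · rw [← pow_two, ← Real.rpow_natCast, ← Real.rpow_add h]; congr 1; norm_num

namespace SystemData

variable {n : ℕ} {Ω : Set (E n)} {p q ν κ₁ κ₂ : ℝ} {η a₁ a₂ : E n → ℝ}
  (d : SystemData Ω p q ν κ₁ κ₂ η a₁ a₂) {lam : ℝ}

/-- The pair of functions underlying a pair of elements of `W_0^{1,H}(Ω)`. -/
def toFun {d : SystemData Ω p q ν κ₁ κ₂ η a₁ a₂} (y : d.Pair) : (E n → ℝ) × (E n → ℝ) :=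
  ((y.1 : E n → ℝ), (y.2 : E n → ℝ))

theorem energy_eq (y : d.Pair) :
    energy Ω p q ν κ₁ κ₂ η a₁ a₂ lam (toFun y) = d.toFibered.J lam y := by
  have hi := fun u : d.adm.W0 => (MemW01H.isW0 d.adm u.2).memLp_one d.adm
  simp only [energy, toFun]
  rw [integral_add (d.adm.integrable_sublinear d.α_pos d.α_lt.le d.memLp₁ (hi y.1))
    (d.adm.integrable_sublinear d.α_pos d.α_lt.le d.memLp₂ (hi y.2)),
    ← d.adm.integral_weighted, ← d.adm.integral_weighted]
  change 1 / p * d.dirichletPair (volume.restrict Ω) p y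
    + 1 / q * d.dirichletPair (weighted Ω η) q y - 1 / (1 - ν) * d.sublinearPair y
    - lam * d.couplingPair y = d.dirichletPair (volume.restrict Ω) p y / p
    + d.dirichletPair (weighted Ω η) q y / q - d.sublinearPair y / (1 - ν)
    - lam * d.couplingPair y
  ring

/-- The derivative of the energy at `y` in the direction `y` is the defect in the Nehari equation. -/
theorem energyDeriv_self (y : d.Pair) :
    energyDeriv Ω p q ν κ₁ κ₂ η a₁ a₂ lam (toFun y) (toFun y) =
      d.dirichletPair (volume.restrict Ω) p y + d.dirichletPair (weighted Ω η) q y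
        - ((κ₁ + 1) + (κ₂ + 1)) * (lam * d.couplingPair y) - d.sublinearPair y := by
  have hp := d.adm.p_pos.ne'
  have hq := d.adm.q_pos.ne'
  have e1 : ∀ u : d.adm.W0, ∫ z in Ω, ‖weakGrad Ω u z‖ ^ (p - 2) *
      inner ℝ (weakGrad Ω u z) (weakGrad Ω u z) = dirichlet Ω (volume.restrict Ω) p u := fun u => by
    simp only [norm_rpow_sub_two_mul_inner hp]; rfl
  have e2 : ∀ u : d.adm.W0, ∫ z in Ω, η z * ‖weakGrad Ω u z‖ ^ (q - 2) *
      inner ℝ (weakGrad Ω u z) (weakGrad Ω u z) = dirichlet Ω (weighted Ω η) q u := fun u => by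
    rw [dirichlet, d.adm.integral_weighted]
    simp only [mul_assoc, norm_rpow_sub_two_mul_inner hq]
  have e3 : ∀ (a : E n → ℝ) (u : E n → ℝ), ∫ z in Ω, a z * |u z| ^ (-1 - ν) * u z * u z =
      sublinear Ω a (1 - ν) u := fun a u => by
    rw [sublinear]
    refine integral_congr_ae (.of_forall fun z => ?_)
    have := abs_rpow_mul_self d.α_pos.ne' (u z)
    rw [show 1 - ν - 2 = -1 - ν by ring] at this
    simp only
    rw [← this]; ring
  have e4 : ∫ z in Ω, |(y.1 : E n → ℝ) z| ^ (κ₁ - 1) * (y.1 : E n → ℝ) z *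
      |(y.2 : E n → ℝ) z| ^ (κ₂ + 1) * (y.1 : E n → ℝ) z = d.couplingPair y := by
    rw [couplingPair, coupling]
    refine integral_congr_ae (.of_forall fun z => ?_)
    have := abs_rpow_mul_self (s := κ₁ + 1) (by linarith [d.κ₁_pos]) ((y.1 : E n → ℝ) z)
    rw [show κ₁ + 1 - 2 = κ₁ - 1 by ring] at this
    simp only
    rw [← this]; ring
  have e5 : ∫ z in Ω, |(y.1 : E n → ℝ) z| ^ (κ₁ + 1) * |(y.2 : E n → ℝ) z| ^ (κ₂ - 1) *
      (y.2 : E n → ℝ) z * (y.2 : E n → ℝ) z = d.couplingPair y := by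
    rw [couplingPair, coupling]
    refine integral_congr_ae (.of_forall fun z => ?_)
    have := abs_rpow_mul_self (s := κ₂ + 1) (by linarith [d.κ₂_pos]) ((y.2 : E n → ℝ) z)
    rw [show κ₂ + 1 - 2 = κ₂ - 1 by ring] at this
    simp only
    rw [← this]; ring
  simp only [energyDeriv, toFun]
  rw [e1, e1, e2, e2, e3, e3, e4, e5, dirichletPair, dirichletPair, sublinearPair]
  ring

theorem sublinear_pos_of_ne {a u : E n → ℝ} (d : SystemData Ω p q ν κ₁ κ₂ η a₁ a₂)
    (ha : MemLp a ⊤ (volume.restrict Ω)) (hpos : ∀ᵐ z ∂volume.restrict Ω, 0 < a z)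
    (hu : MemW01H Ω p q η u) (h : ¬ u =ᵐ[volume.restrict Ω] 0) : 0 < sublinear Ω a (1 - ν) u := by
  refine lt_of_le_of_ne (sublinear_nonneg hpos _ _) fun h2 => h ?_
  have h3 := (integral_eq_zero_iff_of_nonneg_ae (by
    filter_upwards [hpos] with z hz
    exact mul_nonneg hz.le (Real.rpow_nonneg (abs_nonneg _) _))
    (d.adm.integrable_sublinear d.α_pos d.α_lt.le ha ((hu.isW0 d.adm).memLp_one d.adm))).1 h2.symm
  filter_upwards [h3, hpos] with z hz hz'
  by_contra hne
  exact (mul_pos hz' (Real.rpow_pos_of_pos (abs_pos.2 hne) _)).ne' hz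

theorem sublinear_eq_zero {a u : E n → ℝ} (d : SystemData Ω p q ν κ₁ κ₂ η a₁ a₂)
    (h : u =ᵐ[volume.restrict Ω] 0) : sublinear Ω a (1 - ν) u = 0 := by
  refine integral_eq_zero_of_ae ?_
  filter_upwards [h] with z hz
  rw [hz, Pi.zero_apply, abs_zero, Real.zero_rpow d.α_pos.ne', mul_zero]

theorem sublinearPair_pos_iff (y : d.Pair) :
    0 < d.sublinearPair y ↔ ¬ ((y.1 : E n → ℝ) =ᵐ[volume.restrict Ω] 0 ∧
      (y.2 : E n → ℝ) =ᵐ[volume.restrict Ω] 0) := by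
  constructor
  · rintro h ⟨h1, h2⟩
    rw [sublinearPair, d.sublinear_eq_zero h1, d.sublinear_eq_zero h2, add_zero] at h
    exact lt_irrefl _ h
  · intro h
    rw [not_and_or] at h
    rcases h with h | h
    · exact add_pos_of_pos_of_nonneg (d.sublinear_pos_of_ne d.memLp₁ d.pos₁ y.1.2 h)
        (sublinear_nonneg d.pos₂ _ _)
    · exact add_pos_of_nonneg_of_pos (sublinear_nonneg d.pos₁ _ _)
        (d.sublinear_pos_of_ne d.memLp₂ d.pos₂ y.2.2 h)

theorem mem_nehari_iff (y : d.Pair) : toFun y ∈ nehari Ω p q ν κ₁ κ₂ η a₁ a₂ lam ↔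
    0 < d.sublinearPair y ∧ d.toFibered.IsNehari lam y := by
  have e : d.toFibered.IsNehari lam y ↔ energyDeriv Ω p q ν κ₁ κ₂ η a₁ a₂ lam (toFun y) (toFun y)
      = 0 := by
    rw [d.energyDeriv_self, sub_eq_zero]
    exact Iff.rfl
  rw [d.sublinearPair_pos_iff, e]
  exact ⟨fun h => h.2.2, fun h => ⟨y.1.2, y.2.2, h⟩⟩

theorem iteratedDeriv_fibering {y : d.Pair} (hy : d.toFibered.IsNehari lam y) :
    iteratedDeriv 2 (fibering Ω p q ν κ₁ κ₂ η a₁ a₂ lam (toFun y)) 1 =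
      (p - (1 - ν)) * d.toFibered.A y + (q - (1 - ν)) * d.toFibered.B y -
        ((κ₁ + 1) + (κ₂ + 1)) * ((κ₁ + 1) + (κ₂ + 1) - (1 - ν)) * (lam * d.toFibered.K y) := by
  refine Eq.trans ?_ (iteratedDeriv_two_fib d.adm.p_pos d.adm.q_pos d.α_pos hy)
  refine Filter.EventuallyEq.iteratedDeriv_eq 2 ?_
  filter_upwards [lt_mem_nhds (zero_lt_one : (0 : ℝ) < 1)] with t ht
  exact (d.energy_eq (t • y)).trans (d.toFibered.J_smul ht y)

variable {R : ℝ}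

/-- Below the threshold for `lam`, the set `N^+` is the part of the Nehari manifold inside the barrier
sphere. The condition `0 < S y` expresses that `y` is not zero. -/
theorem mem_nehariPlus_iff (hR : 0 < R) (hl : 0 < lam) (hb : d.toFibered.IsBarrier lam R)
    (y : d.Pair) : toFun y ∈ nehariPlus Ω p q ν κ₁ κ₂ η a₁ a₂ lam ↔
      0 < d.sublinearPair y ∧ d.toFibered.IsNehari lam y ∧ d.toFibered.A y < R ^ p := by
  rw [nehariPlus, mem_ofPred_eq, d.mem_nehari_iff, and_assoc]
  refine and_congr_right fun hS => and_congr_right fun hN => ?_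
  rw [d.iteratedDeriv_fibering hN]
  constructor
  · intro h
    refine lt_of_le_of_ne (not_lt.1 fun hlt => ?_) (hb.ne hN)
    exact lt_asymm h (hb.minus hR hl.le hN hlt).1
  · intro h
    exact (hb.plus hR hl.le hN (FiberedSystem.A_pos_of_S_pos hS) h).1

/-- Below the threshold for `lam`, the set `N^-` is the part of the Nehari manifold outside the barrier
sphere. -/
theorem mem_nehariMinus_iff (hR : 0 < R) (hl : 0 < lam) (hb : d.toFibered.IsBarrier lam R)
    (y : d.Pair) : toFun y ∈ nehariMinus Ω p q ν κ₁ κ₂ η a₁ a₂ lam ↔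
      0 < d.sublinearPair y ∧ d.toFibered.IsNehari lam y ∧ R ^ p < d.toFibered.A y := by
  rw [nehariMinus, mem_ofPred_eq, d.mem_nehari_iff, and_assoc]
  refine and_congr_right fun hS => and_congr_right fun hN => ?_
  rw [d.iteratedDeriv_fibering hN]
  constructor
  · intro h
    refine lt_of_le_of_ne (not_lt.1 fun hlt => ?_) (hb.ne hN).symm
    exact lt_asymm h (hb.plus hR hl.le hN (FiberedSystem.A_pos_of_S_pos hS) hlt).1
  · intro h
    exact (hb.minus hR hl.le hN h).1

/-- The Dirichlet integral only depends on the almost everywhere equivalence classes. -/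
theorem dirichletPair_congr {y z : d.Pair}
    (h₁ : (y.1 : E n → ℝ) =ᵐ[volume.restrict Ω] (z.1 : E n → ℝ))
    (h₂ : (y.2 : E n → ℝ) =ᵐ[volume.restrict Ω] (z.2 : E n → ℝ)) :
    d.dirichletPair (volume.restrict Ω) p y = d.dirichletPair (volume.restrict Ω) p z :=
  congrArg₂ (· + ·)
    (d.adm.isPhase_p.dirichlet_eq d.adm
      ((MemW01H.isW0 d.adm z.1.2).congr h₁.symm (ae_eq_refl _)))
    (d.adm.isPhase_p.dirichlet_eq d.adm
      ((MemW01H.isW0 d.adm z.2.2).congr h₂.symm (ae_eq_refl _)))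

end SystemData

end DoublePhase

theorem theorem3p14 {n : ℕ} (Ω : Set (E n)) (hΩ : IsBoundedLipschitzDomain Ω)
    (p q ν κ₁ κ₂ : ℝ) (η a₁ a₂ : E n → ℝ)
    (hν₀ : 0 < ν) (hν₁ : ν < 1) (hp : 1 < p) (hpn : p < n) (hpq : p < q)
    (hqκ₁ : q < κ₁ + 1) (hqκ₂ : q < κ₂ + 1)
    (hκ : κ₁ + κ₂ + 2 < criticalExponent n p)
    (hη : MemLp η ⊤ (volume.restrict Ω)) (hη₀ : ∀ᵐ z ∂volume.restrict Ω, 0 ≤ η z)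
    (ha₁ : MemLp a₁ ⊤ (volume.restrict Ω)) (ha₁₀ : ∀ᵐ z ∂volume.restrict Ω, 0 < a₁ z)
    (ha₂ : MemLp a₂ ⊤ (volume.restrict Ω)) (ha₂₀ : ∀ᵐ z ∂volume.restrict Ω, 0 < a₂ z) :
    ∃ lamStar : ℝ, 0 < lamStar ∧ ∀ lam ∈ Ioo (0 : ℝ) lamStar,
      ∃ yPlus yMinus : (E n → ℝ) × (E n → ℝ),
        ¬ (yPlus.1 =ᵐ[volume.restrict Ω] yMinus.1 ∧ yPlus.2 =ᵐ[volume.restrict Ω] yMinus.2) ∧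
        IsPositiveWeakSolution Ω p q ν κ₁ κ₂ η a₁ a₂ lam yPlus ∧
        IsPositiveWeakSolution Ω p q ν κ₁ κ₂ η a₁ a₂ lam yMinus ∧
        yPlus ∈ nehariPlus Ω p q ν κ₁ κ₂ η a₁ a₂ lam ∧
        IsMinOn (energy Ω p q ν κ₁ κ₂ η a₁ a₂ lam)
          (nehariPlus Ω p q ν κ₁ κ₂ η a₁ a₂ lam) yPlus ∧
        yMinus ∈ nehariMinus Ω p q ν κ₁ κ₂ η a₁ a₂ lam ∧
        IsMinOn (energy Ω p q ν κ₁ κ₂ η a₁ a₂ lam)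
          (nehariMinus Ω p q ν κ₁ κ₂ η a₁ a₂ lam) yMinus ∧
        energy Ω p q ν κ₁ κ₂ η a₁ a₂ lam yPlus < 0 ∧
        0 ≤ energy Ω p q ν κ₁ κ₂ η a₁ a₂ lam yMinus := by
  have d : SystemData Ω p q ν κ₁ κ₂ η a₁ a₂ :=
    ⟨⟨hΩ.isOpen, hΩ.isConnected.nonempty, hΩ.isBounded, hp, hpn, hpq, by linarith, by linarith,
      hη, hη₀⟩, hν₀, hν₁, hqκ₁, hqκ₂, ha₁, ha₁₀, ha₂, ha₂₀⟩
  obtain ⟨R, lamStar, hR, hl0, hbar⟩ := d.toFibered.exists_isBarrier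
  refine ⟨lamStar, hl0, fun lam hlam => ?_⟩
  have hl := hlam.1
  have hb := hbar lam hl hlam.2
  obtain ⟨⟨y, yN, yS, yA, yL, ymin⟩, t, z, ht, zN, zK, zA, zL, zmin⟩ := hb.exists_minimizers hR hl
  have zS := d.sublinearPair_pos _ zK
  have hrep : ∀ w : (E n → ℝ) × (E n → ℝ), w ∈ nehari Ω p q ν κ₁ κ₂ η a₁ a₂ lam →
      ∃ v : d.Pair, SystemData.toFun v = w := fun w hw => ⟨(⟨w.1, hw.1⟩, ⟨w.2, hw.2.1⟩), rfl⟩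
  refine ⟨SystemData.toFun (d.absPair y), SystemData.toFun (t • d.absPair z), ?_,
    d.isPositiveWeakSolution yL (fun x => abs_nonneg _) (fun x => abs_nonneg _),
    d.isPositiveWeakSolution zL (fun x => mul_nonneg ht.le (abs_nonneg _))
      (fun x => mul_nonneg ht.le (abs_nonneg _)),
    (d.mem_nehariPlus_iff hR hl hb _).2 ⟨yS, yN, yA⟩, fun w hw => ?_,
    (d.mem_nehariMinus_iff hR hl hb _).2 ⟨zS, zN, zA⟩, fun w hw => ?_, ?_, ?_⟩
  · rintro ⟨h₁, h₂⟩
    have h := d.dirichletPair_congr (y := d.absPair y) (z := t • d.absPair z) h₁ h₂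
    exact lt_irrefl _ ((yA.trans zA).trans_eq h.symm)
  · obtain ⟨v, rfl⟩ := hrep w hw.1
    obtain ⟨-, -, hA⟩ := (d.mem_nehariPlus_iff hR hl hb v).1 hw
    rw [mem_ofPred_eq, d.energy_eq, d.energy_eq]
    exact ymin v hA.le
  · obtain ⟨v, rfl⟩ := hrep w hw.1
    obtain ⟨-, hN, hA⟩ := (d.mem_nehariMinus_iff hR hl hb v).1 hw
    rw [mem_ofPred_eq, d.energy_eq, d.energy_eq]
    exact zmin v hN hA
  · rw [d.energy_eq]
    exact (hb.plus hR hl.le yN (FiberedSystem.A_pos_of_S_pos yS) yA).2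
  · rw [d.energy_eq]
    exact (hb.minus hR hl.le zN zA).2.2.2.2.le
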